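/- Let $k$ be a commutative ring and let $n \ge 2$, $r \ge 1$, $r' \ge 1$ be integers. For $s\ge 1$ let $U(s;\mathbb{A}^n)\subset(\mathbb{A}^n_k)^s$ be the complement of the union over $i<j$ of the closed subschemes $\{x_{li}=x_{lj}\text{ for all }1\le l\le s\}$, let $S_n$ act on it by permuting the coordinates $x_{l1},\dots,x_{ln}$ of all $s$ factors $\mathbb{A}^n$ simultaneously, and let $\pi\colon U(s;\mathbb{A}^n)\to B(s;\mathbb{A}^n)=U(s;\mathbb{A}^n)/S_n$ be the quotient. On $B(s;\mathbb{A}^n)$ there is the canonical degree-$n$ étale algebra $\mathcal{E}(s)=(\pi_*\mathcal{O}_{U(s;\mathbb{A}^n)}^{\,n})^{S_n}$, with canonical generating sections $t_l=(x_{l1},\dots,x_{ln})$, $1\le l\le s$. For $s\le s'$, padding an $s$-tuple of $n$-tuples with zero $n$-tuples induces the stabilization map $B(s;\mathbb{A}^n)\to B(s';\mathbb{A}^n)$. Let $X$ be a $k$-scheme, let $\mathcal{A}$ and $\mathcal{A}'$ be degree-$n$ étale algebras on $X$ (sheaves of $\mathcal{O}_X$-algebras, locally free of constant rank $n$, with $\mathcal{A}(V)$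 étale over $\mathcal{O}_X(V)$ for every affine open $V$) that are isomorphic as $\mathcal{O}_X$-algebras, and let $a_1,\dots,a_r\in\Gamma(X,\mathcal{A})$ and $a'_1,\dots,a'_{r'}\in\Gamma(X,\mathcal{A}')$ generate $\mathcal{A}$ and $\mathcal{A}'$ respectively (that is, their restrictions generate the algebra of sections over every affine open). Then there are unique $k$-morphisms $\phi\colon X\to B(r;\mathbb{A}^n)$ and $\phi'\colon X\to B(r';\mathbb{A}^n)$ (the classifying morphisms) such that $\phi^*(\mathcal{E}(r),t_1,\dots,t_r)\cong(\mathcal{A},a_1,\dots,a_r)$ and $\phi'^*(\mathcal{E}(r'),t_1,\dots,t_{r'})\cong(\mathcal{A}',a'_1,\dots,a'_{r'})$, and, putting $R=r+r'$: 1. The composites $\tilde\phi\colon X\to B(r;\mathbb{A}^n)\to B(R;\mathbb{A}^n)$ and $\tilde\phi'\colon X\to B(r';\mathbb{A}^n)\to B(R;\mathbb{A}^n)$ with the stabilization maps are naively $\mathbb{A}^1$-homotopic: they are joined by a finite sequence of elementary $\mathbb{A}^1$-homotopies, where an elementary $\mathbb{A}^1$-homotopy from $f$ to $g\colon X\to B$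 is a $k$-morphism $X\times\mathbb{A}^1\to B$ that restricts to $f$ at $0$ and to $g$ at $1$. 2. $E(\tilde\phi)=E(\tilde\phi')$ for every $\mathbb{A}^1$-invariant cohomology theory $E$, that is, for every contravariant functor $E$, with values in any category, defined on a full subcategory of the category of $k$-schemes that is stable under $-\times\mathbb{A}^1$ and contains $X$ and $B(R;\mathbb{A}^n)$, such that $E(Y)\to E(Y\times\mathbb{A}^1)$ is an isomorphism for every $Y$ in that subcategory. -/

import Mathlib

open CategoryTheory AlgebraicGeometry TopologicalSpace Opposite

universe u v w

noncomputable section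

namespace EtaleGen

/-! ### Sheaves of algebras on a scheme -/

/-- A sheaf of (commutative) `𝒪_X`-algebras on a scheme `X`: a sheaf of commutative rings
together with a morphism of sheaves of rings from the structure sheaf. -/
structure AlgSheaf (X : Scheme.{u}) where
  sheaf : TopCat.Sheaf CommRingCat.{u} X
  unit : X.sheaf ⟶ sheaf

namespace AlgSheaf

variable {X Y : Scheme.{u}}

/-- The ring `𝒜(U)` of sections over `U`. -/
abbrev sec (A : AlgSheaf X) (U : X.Opens) : CommRingCat.{u} := A.sheaf.presheaf.obj (op U)

/-- The structure map `𝒪_X(U) ⟶ 𝒜(U)`. -/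
def str (A : AlgSheaf X) (U : X.Opens) : Γ(X, U) ⟶ A.sec U := A.unit.hom.app (op U)

/-- The restriction map `𝒜(U) ⟶ 𝒜(V)` for `V ≤ U`. -/
def res (A : AlgSheaf X) {U V : X.Opens} (h : V ≤ U) : A.sec U ⟶ A.sec V :=
  A.sheaf.presheaf.map (homOfLE h).op

instance (A : AlgSheaf X) (U : X.Opens) : Algebra Γ(X, U) (A.sec U) := (A.str U).hom.toAlgebra

/-- `𝒜` and `𝒜'` are isomorphic as sheaves of `𝒪_X`-algebras. -/
def IsIsomorphic (A A' : AlgSheaf X) : Prop :=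
  ∃ α : A.sheaf ≅ A'.sheaf, A.unit ≫ α.hom = A'.unit

/-- `𝒜` is locally free of constant rank `n` as a sheaf of `𝒪_X`-modules: every point has an open
neighbourhood `V` with sections `e₁, …, eₙ ∈ 𝒜(V)` such that the induced morphism of sheaves of
modules `𝒪_V^n ⟶ 𝒜|_V` is an isomorphism. -/
def IsLocallyFreeOfRank (A : AlgSheaf X) (n : ℕ) : Prop :=
  ∀ x : X, ∃ (V : X.Opens) (e : Fin n → A.sec V), x ∈ V ∧
    ∀ (W : X.Opens) (h : W ≤ V),
      Function.Bijective fun c : Fin n → Γ(X, W) ↦ ∑ i, c i • A.res h (e i)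

/-- `𝒜` is a degree-`n` étale algebra on `X`. -/
structure IsEtaleOfDegree (A : AlgSheaf X) (n : ℕ) : Prop where
  locallyFree : A.IsLocallyFreeOfRank n
  etale : ∀ U : X.Opens, IsAffineOpen U → Algebra.Etale Γ(X, U) (A.sec U)

/-- The global sections `a₁, …, a_r` generate `𝒜`: over every affine open `U`, the only
`𝒪_X(U)`-subalgebra of `𝒜(U)` containing the restrictions of the `a_j` is `𝒜(U)` itself. -/
def Generates (A : AlgSheaf X) {r : ℕ} (a : Fin r → A.sec ⊤) : Prop :=
  ∀ U : X.Opens, IsAffineOpen U →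
    Algebra.adjoin Γ(X, U) (Set.range fun j ↦ A.res (le_top : U ≤ ⊤) (a j)) = ⊤

/-- A morphism of sheaves of rings `ℰ ⟶ φ_* 𝒜` which is linear over `𝒪_Y ⟶ φ_* 𝒪_X`. -/
structure HomOver (φ : X ⟶ Y) (E : AlgSheaf Y) (A : AlgSheaf X) where
  app (V : Y.Opens) : E.sec V ⟶ A.sec (φ ⁻¹ᵁ V)
  naturality {U V : Y.Opens} (h : V ≤ U) :
    E.res h ≫ app V = app U ≫ A.res (φ.preimage_mono h)
  linear (V : Y.Opens) : E.str V ≫ app V = φ.app V ≫ A.str (φ ⁻¹ᵁ V)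

/-- `θ : ℰ ⟶ φ_* 𝒜` exhibits `𝒜` as the pullback `φ^* ℰ` (for `ℰ` quasi-coherent):
over all affine opens `V` of `Y` and `W ≤ φ⁻¹ V` of `X`, the algebra `𝒜(W)` is the base change
`𝒪_X(W) ⊗_{𝒪_Y(V)} ℰ(V)`. -/
def HomOver.IsPullback {φ : X ⟶ Y} {E : AlgSheaf Y} {A : AlgSheaf X} (θ : HomOver φ E A) : Prop :=
  ∀ (V : Y.Opens) (W : X.Opens) (h : W ≤ φ ⁻¹ᵁ V), IsAffineOpen V → IsAffineOpen W →
    IsPushout (φ.appLE V W h) (E.str V) (A.str W) (θ.app V ≫ A.res h)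

end AlgSheaf

/-! ### The schemes `U(r; 𝔸ⁿ)` and `B(r; 𝔸ⁿ)` -/

section Construction

variable (k : Type u) [CommRing k] (n r : ℕ)

/-- The coordinate ring `k[x_{ji}]`, `1 ≤ j ≤ r`, `1 ≤ i ≤ n`, of `(𝔸ⁿ)^r`. -/
abbrev Coord : Type u := MvPolynomial (Fin r × Fin n) k

/-- The diagonal action of the symmetric group, `σ • x_{ji} = x_{j,σ(i)}`. -/
instance permAction : MulSemiringAction (Equiv.Perm (Fin n)) (Coord k n r) where
  smul σ p := MvPolynomial.rename (Prod.map id σ) p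
  one_smul p := by
    change MvPolynomial.rename (Prod.map id id) p = p
    rw [Prod.map_id]; exact MvPolynomial.rename_id_apply p
  mul_smul σ τ p := by
    change MvPolynomial.rename _ p = MvPolynomial.rename _ (MvPolynomial.rename _ p)
    rw [MvPolynomial.rename_rename]; rfl
  smul_zero σ := map_zero (MvPolynomial.rename (Prod.map id σ))
  smul_add σ := map_add (MvPolynomial.rename (Prod.map id σ))
  smul_one σ := map_one (MvPolynomial.rename (Prod.map id σ))
  smul_mul σ := map_mul (MvPolynomial.rename (Prod.map id σ))

variable {k n r} in
lemma perm_smul_def (σ : Equiv.Perm (Fin n)) (p : Coord k n r) :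
    σ • p = MvPolynomial.rename (Prod.map id σ) p := rfl

instance : SMulCommClass (Equiv.Perm (Fin n)) k (Coord k n r) where
  smul_comm σ c p := map_smul (MvPolynomial.rename (Prod.map id σ)) c p

/-- The ring of invariants `k[x_{ji}]^{S_n}`. -/
abbrev Inv : Subalgebra k (Coord k n r) :=
  FixedPoints.subalgebra k (Coord k n r) (Equiv.Perm (Fin n))

instance : Algebra.IsInvariant (Inv k n r) (Coord k n r) (Equiv.Perm (Fin n)) where
  isInvariant b hb := ⟨⟨b, hb⟩, rfl⟩

/-- The affine scheme `(𝔸ⁿ)^r` over `k`. -/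
abbrev AffR : Scheme.{u} := Spec (.of (Coord k n r))

/-- The quotient `(𝔸ⁿ)^r / S_n`, the spectrum of the ring of invariants. -/
abbrev QuotR : Scheme.{u} := Spec (.of (Inv k n r))

/-- The quotient map `(𝔸ⁿ)^r ⟶ (𝔸ⁿ)^r / S_n`. -/
def quotMap : AffR k n r ⟶ QuotR k n r := Spec.map (CommRingCat.ofHom (Inv k n r).val.toRingHom)

/-- The automorphism of `(𝔸ⁿ)^r` corresponding to a permutation. -/
def actAff (σ : Equiv.Perm (Fin n)) : AffR k n r ⟶ AffR k n r :=
  Spec.map (CommRingCat.ofHom (MulSemiringAction.toRingHom _ (Coord k n r) σ))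

/-- The closed subset `Z_{ij}` of `(𝔸ⁿ)^r`, cut out by the equations `x_{li} = x_{lj}` for all
`l`. -/
def Z (i j : Fin n) : Set (AffR k n r) :=
  PrimeSpectrum.zeroLocus
    (Set.range fun l : Fin r ↦ (MvPolynomial.X (l, i) - MvPolynomial.X (l, j) : Coord k n r))

lemma isClosed_Z (i j : Fin n) : IsClosed (Z k n r i j) := PrimeSpectrum.isClosed_zeroLocus _

/-- `U(r; 𝔸ⁿ)`, the complement in `(𝔸ⁿ)^r` of the union of the `Z_{ij}`, `i < j`. -/
def UOpens : (AffR k n r).Opens where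
  carrier := (⋃ (i : Fin n) (j : Fin n) (_ : i < j), Z k n r i j)ᶜ
  is_open' := by
    rw [isOpen_compl_iff]
    exact isClosed_iUnion_of_finite fun i ↦ isClosed_iUnion_of_finite fun j ↦
      isClosed_iUnion_of_finite fun _ ↦ isClosed_Z k n r i j

variable {k n r} in
lemma mem_UOpens {p : AffR k n r} : p ∈ UOpens k n r ↔ ∀ i j : Fin n, i ≠ j →
    ∃ l : Fin r, (MvPolynomial.X (l, i) - MvPolynomial.X (l, j) : Coord k n r) ∉ p.asIdeal := by
  have h1 : p ∈ UOpens k n r ↔ ∀ i j : Fin n, i < j → p ∉ Z k n r i j := by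
    change p ∈ (⋃ (i : Fin n) (j : Fin n) (_ : i < j), Z k n r i j)ᶜ ↔ _
    simp
  have h2 : ∀ i j : Fin n, p ∉ Z k n r i j ↔
      ∃ l : Fin r, (MvPolynomial.X (l, i) - MvPolynomial.X (l, j) : Coord k n r) ∉ p.asIdeal := by
    intro i j
    change ¬ (Set.range fun l : Fin r ↦
      (MvPolynomial.X (l, i) - MvPolynomial.X (l, j) : Coord k n r)) ⊆ p.asIdeal ↔ _
    rw [Set.range_subset_iff, not_forall]
    rfl
  rw [h1]
  refine ⟨fun h i j hij ↦ ?_, fun h i j hij ↦ (h2 i j).2 (h i j hij.ne)⟩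
  rcases lt_or_gt_of_ne hij with hlt | hlt
  · exact (h2 i j).1 (h i j hlt)
  · obtain ⟨l, hl⟩ := (h2 j i).1 (h j i hlt)
    refine ⟨l, fun hc ↦ hl ?_⟩
    rw [← neg_sub]
    exact p.asIdeal.neg_mem hc

variable {k n r} in
lemma actAff_mem {p : AffR k n r} (σ : Equiv.Perm (Fin n)) (hp : p ∈ UOpens k n r) :
    actAff k n r σ p ∈ UOpens k n r := by
  rw [mem_UOpens] at hp ⊢
  intro i j hij
  obtain ⟨l, hl⟩ := hp (σ i) (σ j) (σ.injective.ne hij)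
  refine ⟨l, fun hc ↦ hl ?_⟩
  have hc' : σ • (MvPolynomial.X (l, i) - MvPolynomial.X (l, j) : Coord k n r) ∈ p.asIdeal := hc
  simpa [perm_smul_def] using hc'

lemma actAff_quotMap (σ : Equiv.Perm (Fin n)) :
    actAff k n r σ ≫ quotMap k n r = quotMap k n r := by
  rw [actAff, quotMap, ← Spec.map_comp]
  congr 1
  exact CommRingCat.hom_ext (RingHom.ext fun p ↦ p.2 σ)

variable {k n r} in
/-- The fibres of the quotient map are orbits. -/
lemma exists_actAff_eq {p q : AffR k n r} (h : quotMap k n r p = quotMap k n r q) :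
    ∃ σ, actAff k n r σ p = q := by
  have h' : p.asIdeal.under (Inv k n r) = q.asIdeal.under (Inv k n r) :=
    congrArg PrimeSpectrum.asIdeal h
  have hp : p.asIdeal.IsPrime := p.isPrime
  have hq : q.asIdeal.IsPrime := q.isPrime
  obtain ⟨σ, hσ⟩ := Algebra.IsInvariant.exists_smul_of_under_eq (Inv k n r) (Coord k n r)
    (Equiv.Perm (Fin n)) p.asIdeal q.asIdeal h'
  refine ⟨σ⁻¹, PrimeSpectrum.ext ?_⟩
  ext x
  rw [hσ, Ideal.mem_pointwise_smul_iff_inv_smul_mem]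
  rfl

/-- `B(r; 𝔸ⁿ)` as an open subset of `(𝔸ⁿ)^r / S_n`: the image of the `S_n`-stable open
subset `U(r; 𝔸ⁿ)`. -/
def BOpens : (QuotR k n r).Opens where
  carrier := quotMap k n r '' (UOpens k n r : Set (AffR k n r))
  is_open' := by
    have hcl : IsClosedMap (quotMap k n r) := by
      have := Algebra.IsInvariant.isIntegral (Inv k n r) (Coord k n r) (Equiv.Perm (Fin n))
      exact PrimeSpectrum.isClosedMap_comap_of_isIntegral
        (algebraMap (Inv k n r) (Coord k n r)) (algebraMap_isIntegral_iff.2 this)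
    have hsurj : Function.Surjective (quotMap k n r) := by
      have := Algebra.IsInvariant.isIntegral (Inv k n r) (Coord k n r) (Equiv.Perm (Fin n))
      exact Algebra.IsIntegral.comap_surjective (Inv k n r) (Coord k n r)
    have heq : quotMap k n r '' (UOpens k n r : Set (AffR k n r)) =
        (quotMap k n r '' (UOpens k n r : Set (AffR k n r))ᶜ)ᶜ := by
      ext y
      constructor
      · rintro ⟨p, hp, rfl⟩ ⟨q, hq, hqp⟩
        obtain ⟨σ, rfl⟩ := exists_actAff_eq hqp.symm
        exact hq (actAff_mem σ hp)
      · intro hy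
        obtain ⟨p, rfl⟩ := hsurj y
        by_contra hc
        exact hy ⟨p, fun hp ↦ hc ⟨p, hp, rfl⟩, rfl⟩
    rw [heq, isOpen_compl_iff]
    exact hcl _ (UOpens k n r).isOpen.isClosed_compl

lemma UOpens_le_quotMap : UOpens k n r ≤ quotMap k n r ⁻¹ᵁ BOpens k n r :=
  fun p hp ↦ ⟨p, hp, rfl⟩

lemma UOpens_le_actAff (σ : Equiv.Perm (Fin n)) :
    UOpens k n r ≤ actAff k n r σ ⁻¹ᵁ UOpens k n r :=
  fun _ hp ↦ actAff_mem σ hp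

/-- The scheme `U(r; 𝔸ⁿ)`. -/
abbrev U : Scheme.{u} := (UOpens k n r).toScheme

/-- The scheme `B(r; 𝔸ⁿ) = U(r; 𝔸ⁿ) / S_n`. -/
abbrev BScheme : Scheme.{u} := (BOpens k n r).toScheme

/-- `B(r; 𝔸ⁿ)` as a `k`-scheme. -/
def B : Over (Spec (.of k)) :=
  Over.mk ((BOpens k n r).ι ≫ Spec.map (CommRingCat.ofHom (algebraMap k (Inv k n r))))

/-- The quotient map `π : U(r; 𝔸ⁿ) ⟶ B(r; 𝔸ⁿ)`. -/
def quotU : U k n r ⟶ BScheme k n r :=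
  (quotMap k n r).resLE (BOpens k n r) (UOpens k n r) (UOpens_le_quotMap k n r)

/-- The action of a permutation on `U(r; 𝔸ⁿ)`. -/
def actU (σ : Equiv.Perm (Fin n)) : U k n r ⟶ U k n r :=
  (actAff k n r σ).resLE (UOpens k n r) (UOpens k n r) (UOpens_le_actAff k n r σ)

lemma actU_quotU (σ : Equiv.Perm (Fin n)) : actU k n r σ ≫ quotU k n r = quotU k n r := by
  rw [actU, quotU, Scheme.Hom.resLE_comp_resLE]
  simp only [actAff_quotMap]

lemma preimage_le (σ : Equiv.Perm (Fin n)) (W : (BScheme k n r).Opens) :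
    quotU k n r ⁻¹ᵁ W ≤ actU k n r σ ⁻¹ᵁ (quotU k n r ⁻¹ᵁ W) := by
  rw [← Scheme.Hom.comp_preimage, actU_quotU]

/-! ### The canonical étale algebra with generators on `B(r; 𝔸ⁿ)` -/

/-- The ring `ℰ(W)` of sections over `W` of the canonical algebra: the `S_n`-equivariant
morphisms `f = (f₁, …, fₙ) : π⁻¹ W ⟶ 𝔸ⁿ`. These are the `S_n`-invariant sections over `π⁻¹ W` of
the trivial algebra `𝒪_U^n`, that is, the sections over `W` of
`E(r; 𝔸ⁿ) = (U(r; 𝔸ⁿ) × 𝔸ⁿ) / S_n ⟶ B(r; 𝔸ⁿ)`. -/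
def equivSec (W : (BScheme k n r).Opens) : Subring (Fin n → Γ(U k n r, quotU k n r ⁻¹ᵁ W)) where
  carrier := {f | ∀ (σ : Equiv.Perm (Fin n)) (i : Fin n),
    (actU k n r σ).appLE _ _ (preimage_le k n r σ W) (f i) = f (σ i)}
  mul_mem' hf hg σ i := by simp [hf σ i, hg σ i]
  one_mem' σ i := by simp
  add_mem' hf hg σ i := by simp [hf σ i, hg σ i]
  zero_mem' σ i := by simp
  neg_mem' hf σ i := by simp [hf σ i]

lemma actU_appLE_map (σ : Equiv.Perm (Fin n)) {V W : (BScheme k n r).Opens} (h : V ≤ W)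
    (x : Γ(U k n r, quotU k n r ⁻¹ᵁ W)) :
    (actU k n r σ).appLE _ _ (preimage_le k n r σ V)
      ((U k n r).presheaf.map (homOfLE ((quotU k n r).preimage_mono h)).op x) =
    (U k n r).presheaf.map (homOfLE ((quotU k n r).preimage_mono h)).op
      ((actU k n r σ).appLE _ _ (preimage_le k n r σ W) x) := by
  rw [← CommRingCat.comp_apply, ← CommRingCat.comp_apply, Scheme.Hom.map_appLE,
    Scheme.Hom.appLE_map]

/-- Restriction of equivariant sections. -/
def equivRes {V W : (BScheme k n r).Opens} (h : V ≤ W) : equivSec k n r W →+* equivSec k n r V where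
  toFun f := ⟨fun i ↦ (U k n r).presheaf.map (homOfLE ((quotU k n r).preimage_mono h)).op (f.1 i),
    fun σ i ↦ by rw [actU_appLE_map k n r σ h, f.2 σ i]⟩
  map_one' := Subtype.ext (funext fun i ↦ map_one _)
  map_mul' f g := Subtype.ext (funext fun i ↦ map_mul _ _ _)
  map_zero' := Subtype.ext (funext fun i ↦ map_zero _)
  map_add' f g := Subtype.ext (funext fun i ↦ map_add _ _ _)

/-- The presheaf `W ↦ ℰ(W)`. -/
def canonicalPresheaf : TopCat.Presheaf CommRingCat.{u} (BScheme k n r) where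
  obj W := CommRingCat.of (equivSec k n r W.unop)
  map h := CommRingCat.ofHom (equivRes k n r h.unop.le)
  map_id W := by
    refine CommRingCat.hom_ext (RingHom.ext fun f ↦ Subtype.ext (funext fun i ↦ ?_))
    exact ConcreteCategory.congr_hom ((U k n r).presheaf.map_id _) (f.1 i)
  map_comp g h := by
    refine CommRingCat.hom_ext (RingHom.ext fun f ↦ Subtype.ext (funext fun i ↦ ?_))
    exact ConcreteCategory.congr_hom ((U k n r).presheaf.map_comp
      (homOfLE ((quotU k n r).preimage_mono g.unop.le)).op
      (homOfLE ((quotU k n r).preimage_mono h.unop.le)).op) (f.1 i)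

lemma canonicalPresheaf_isSheaf : (canonicalPresheaf k n r).IsSheaf := by
  rw [TopCat.Presheaf.isSheaf_iff_isSheafUniqueGluing]
  intro ι V sf hsf
  let G : TopCat.Sheaf CommRingCat.{u} (BScheme k n r) :=
    (TopCat.Sheaf.pushforward CommRingCat.{u} (quotU k n r).base).obj (U k n r).sheaf
  have hG : ∀ i : Fin n, ∃! s : ToType (G.1.obj (op (iSup V))),
      TopCat.Presheaf.IsGluing G.1 V (fun a ↦ (sf a).1 i) s := by
    intro i
    refine G.existsUnique_gluing V _ fun a b ↦ ?_
    exact congrFun (congrArg Subtype.val (hsf a b)) i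
  choose s hs hu using hG
  refine ⟨⟨s, fun σ i ↦ ?_⟩, fun a ↦ Subtype.ext (funext fun i ↦ hs i a), fun t ht ↦ ?_⟩
  · refine hu (σ i) _ fun a ↦ ?_
    have h1 := actU_appLE_map k n r σ (le_iSup V a) (s i)
    have h2 : (U k n r).presheaf.map (homOfLE ((quotU k n r).preimage_mono (le_iSup V a))).op (s i)
      = (sf a).1 i := hs i a
    rw [h2, (sf a).2 σ i] at h1
    exact h1.symm
  · refine Subtype.ext (funext fun i ↦ hu i _ fun a ↦ ?_)
    exact congrFun (congrArg Subtype.val (ht a)) i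

lemma actU_appLE_quotU (σ : Equiv.Perm (Fin n)) (W : (BScheme k n r).Opens)
    (x : Γ(BScheme k n r, W)) :
    (actU k n r σ).appLE _ _ (preimage_le k n r σ W) ((quotU k n r).app W x) =
      (quotU k n r).app W x := by
  have h := Scheme.Hom.comp_appLE (actU k n r σ) (quotU k n r) W (quotU k n r ⁻¹ᵁ W)
    (preimage_le k n r σ W)
  simp only [actU_quotU, Scheme.Hom.appLE_eq_app] at h
  exact (ConcreteCategory.congr_hom h x).symm

/-- The constant vector of the pullback of a function on `W` to `π⁻¹ W`. -/
def equivConst (W : (BScheme k n r).Opens) : Γ(BScheme k n r, W) →+* equivSec k n r W where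
  toFun x := ⟨fun _ ↦ (quotU k n r).app W x, fun σ _ ↦ actU_appLE_quotU k n r σ W x⟩
  map_one' := Subtype.ext (funext fun _ ↦ map_one _)
  map_mul' _ _ := Subtype.ext (funext fun _ ↦ map_mul _ _ _)
  map_zero' := Subtype.ext (funext fun _ ↦ map_zero _)
  map_add' _ _ := Subtype.ext (funext fun _ ↦ map_add _ _ _)

/-- The canonical `𝒪_B`-algebra `ℰ(r; 𝔸ⁿ) = (π_* 𝒪_U^n)^{S_n}` on `B(r; 𝔸ⁿ)`; a function on
`W` acts as the constant vector of its pullback to `π⁻¹ W`. -/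
def canonicalAlg : AlgSheaf (BScheme k n r) where
  sheaf := ⟨canonicalPresheaf k n r, canonicalPresheaf_isSheaf k n r⟩
  unit := ⟨{
    app W := CommRingCat.ofHom (R := Γ(BScheme k n r, W.unop)) (S := equivSec k n r W.unop)
      (equivConst k n r W.unop)
    naturality V W h := by
      refine CommRingCat.hom_ext (RingHom.ext fun f ↦ Subtype.ext (funext fun i ↦ ?_))
      exact ConcreteCategory.congr_hom ((quotU k n r).naturality h) f }⟩

/-- The coordinate function `x_{ji}` on `U(r; 𝔸ⁿ)`. -/
def coordU (j : Fin r) (i : Fin n) : Γ(U k n r, ⊤) :=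
  (UOpens k n r).ι.appTop ((Scheme.ΓSpecIso (.of (Coord k n r))).inv (MvPolynomial.X (j, i)))

lemma actU_coordU (σ : Equiv.Perm (Fin n)) (j : Fin r) (i : Fin n) :
    (actU k n r σ).appTop (coordU k n r j i) = coordU k n r j (σ i) := by
  have h1 : actU k n r σ ≫ (UOpens k n r).ι = (UOpens k n r).ι ≫ actAff k n r σ :=
    Scheme.Hom.resLE_comp_ι _ _
  have h2 : (actU k n r σ).appTop (coordU k n r j i) =
      (actU k n r σ ≫ (UOpens k n r).ι).appTop
        ((Scheme.ΓSpecIso (.of (Coord k n r))).inv (MvPolynomial.X (j, i))) := by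
    rw [Scheme.Hom.comp_appTop]; rfl
  have h3 : (actAff k n r σ).appTop
      ((Scheme.ΓSpecIso (.of (Coord k n r))).inv (MvPolynomial.X (j, i))) =
      (Scheme.ΓSpecIso (.of (Coord k n r))).inv (MvPolynomial.X (j, σ i)) := by
    rw [actAff, ← CommRingCat.comp_apply, ← Scheme.ΓSpecIso_inv_naturality, CommRingCat.comp_apply]
    congr 1
    exact MvPolynomial.rename_X _ _
  rw [h2, h1, Scheme.Hom.comp_appTop, CommRingCat.comp_apply, h3]
  rfl

/-- The canonical global section `t_j = (x_{j1}, …, x_{jn})` of `ℰ(r; 𝔸ⁿ)`. -/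
def canonicalSec (j : Fin r) : (canonicalAlg k n r).sec ⊤ :=
  (⟨fun i ↦ coordU k n r j i, fun σ i ↦
    (ConcreteCategory.congr_hom (Scheme.Hom.appLE_eq_app (actU k n r σ)) _).trans
      (actU_coordU k n r σ j i)⟩ : equivSec k n r ⊤)

end Construction

/-! ### Classifying maps -/

section Classifying

variable {k : Type u} [CommRing k] {n r : ℕ}

/-- `φ : X ⟶ B(r; 𝔸ⁿ)` is a classifying morphism for `(𝒜, a₁, …, a_r)`: the pullback along `φ`
of the canonical algebra with its canonical sections is isomorphic to `(𝒜, a₁, …, a_r)`. -/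
def Classifies {X : Over (Spec (.of k))} (φ : X ⟶ B k n r) (A : AlgSheaf X.left)
    (a : Fin r → A.sec ⊤) : Prop :=
  ∃ θ : AlgSheaf.HomOver (Y := BScheme k n r) φ.left (canonicalAlg k n r) A,
    θ.IsPullback ∧ ∀ j, θ.app ⊤ (canonicalSec k n r j) = a j

end Classifying

/-! ### Stabilization maps -/

section Stabilization

variable (k : Type u) [CommRing k] (n : ℕ) {r R : ℕ}

/-- The comorphism `k[x_{ji}]_{j ≤ R} ⟶ k[x_{ji}]_{j ≤ r}` of the map `(𝔸ⁿ)^r ⟶ (𝔸ⁿ)^R` that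
pads an `r`-tuple of `n`-tuples with the `n`-tuple `(0, …, 0)`. -/
def padHom (r R : ℕ) : Coord k n R →ₐ[k] Coord k n r :=
  MvPolynomial.aeval fun p ↦ if h : p.1.1 < r then MvPolynomial.X (⟨p.1.1, h⟩, p.2) else 0

variable {k n} in
lemma padHom_smul (σ : Equiv.Perm (Fin n)) (p : Coord k n R) :
    padHom k n r R (σ • p) = σ • padHom k n r R p := by
  rw [perm_smul_def, perm_smul_def, ← AlgHom.comp_apply, ← AlgHom.comp_apply]
  congr 1
  refine MvPolynomial.algHom_ext fun q ↦ ?_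
  simp only [AlgHom.comp_apply, MvPolynomial.rename_X, padHom, MvPolynomial.aeval_X, Prod.map,
    id]
  split_ifs <;> simp

/-- The map induced on rings of invariants. -/
def padInv (r R : ℕ) : Inv k n R →ₐ[k] Inv k n r :=
  ((padHom k n r R).comp (Inv k n R).val).codRestrict (Inv k n r) fun p σ ↦ by
    have := p.2 σ
    change σ • padHom k n r R p.1 = padHom k n r R p.1
    rw [← padHom_smul, this]

/-- The map `(𝔸ⁿ)^r / S_n ⟶ (𝔸ⁿ)^R / S_n` induced by padding with zeros. -/
def stabQuot (r R : ℕ) : QuotR k n r ⟶ QuotR k n R :=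
  Spec.map (CommRingCat.ofHom (padInv k n r R).toRingHom)

lemma BOpens_le_stabQuot (h : r ≤ R) : BOpens k n r ≤ stabQuot k n r R ⁻¹ᵁ BOpens k n R := by
  rintro _ ⟨p, hp, rfl⟩
  refine ⟨Spec.map (CommRingCat.ofHom (padHom k n r R).toRingHom) p, ?_, ?_⟩
  · change _ ∈ UOpens k n R
    have hp' : p ∈ UOpens k n r := hp
    rw [mem_UOpens] at hp' ⊢
    intro i j hij
    obtain ⟨l, hl⟩ := hp' i j hij
    refine ⟨Fin.castLE h l, fun hc ↦ hl ?_⟩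
    have hc' : padHom k n r R (MvPolynomial.X (Fin.castLE h l, i) -
      MvPolynomial.X (Fin.castLE h l, j)) ∈ p.asIdeal := hc
    simpa [padHom] using hc'
  · rfl

/-- The stabilization map `B(r; 𝔸ⁿ) ⟶ B(R; 𝔸ⁿ)` for `r ≤ R`. -/
def stab (h : r ≤ R) : B k n r ⟶ B k n R :=
  Over.homMk ((stabQuot k n r R).resLE (BOpens k n R) (BOpens k n r) (BOpens_le_stabQuot k n h)) (by
    change Scheme.Hom.resLE _ _ _ _ ≫ (BOpens k n R).ι ≫ _ = (BOpens k n r).ι ≫ _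
    rw [Scheme.Hom.resLE_comp_ι_assoc, stabQuot, ← Spec.map_comp]
    congr 2
    exact CommRingCat.hom_ext (RingHom.ext fun c ↦ (padInv k n r R).commutes c))

end Stabilization

/-! ### Naive `𝔸¹`-homotopies -/

section Homotopy

variable {S : Scheme.{u}}

/-- The `S`-scheme `X × 𝔸¹`. -/
def timesA1 (X : Over S) : Over S := Over.mk ((𝔸(PUnit.{u + 1}; X.left) ↘ X.left) ≫ X.hom)

/-- The projection `X × 𝔸¹ ⟶ X`. -/
def projA1 (X : Over S) : timesA1 X ⟶ X := Over.homMk (𝔸(PUnit.{u + 1}; X.left) ↘ X.left)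

/-- The morphism `X ⟶ X × 𝔸¹`, `x ↦ (x, c)`, for a global function `c` on `X`. -/
def sectionA1 (X : Over S) (c : Γ(X.left, ⊤)) : X ⟶ timesA1 X :=
  Over.homMk (AffineSpace.homOfVector (𝟙 X.left) fun _ ↦ c) (by
    have h := AffineSpace.homOfVector_over_assoc (𝟙 X.left) (fun _ : PUnit.{u + 1} ↦ c) X.hom
    rw [Category.id_comp] at h
    exact h)

/-- There is an elementary `𝔸¹`-homotopy from `f` to `g`. -/
def ElementaryHomotopic {X Y : Over S} (f g : X ⟶ Y) : Prop :=
  ∃ H : timesA1 X ⟶ Y, sectionA1 X 0 ≫ H = f ∧ sectionA1 X 1 ≫ H = g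

/-- `f` and `g` are naively `𝔸¹`-homotopic: they are joined by a finite sequence of elementary
`𝔸¹`-homotopies. -/
def NaivelyHomotopic {X Y : Over S} (f g : X ⟶ Y) : Prop :=
  Relation.ReflTransGen ElementaryHomotopic f g

/-- A contravariant functor `E` on a full subcategory `P` of `S`-schemes, stable under `- × 𝔸¹`,
is `𝔸¹`-invariant if `E(X) ⟶ E(X × 𝔸¹)` is an isomorphism for all `X`. -/
def IsA1Invariant {P : ObjectProperty (Over S)} (hP : ∀ X, P X → P (timesA1 X))
    {C : Type v} [Category.{w} C] (E : P.FullSubcategoryᵒᵖ ⥤ C) : Prop :=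
  ∀ (X : Over S) (hX : P X),
    IsIso (E.map (P.homMk (X := ⟨timesA1 X, hP X hX⟩) (Y := ⟨X, hX⟩) (projA1 X)).op)

end Homotopy

end EtaleGen

end

open EtaleGen

open EtaleGen

/-! ### Separated families of algebra homomorphisms -/

section SepFamily

open TensorProduct

variable {ι R A L : Type*} [CommRing R] [CommRing A] [Algebra R A] [CommRing L] [Algebra R L]

/-! Since `B(r; 𝔸ⁿ)` is open in the spectrum of the ring of invariants, a morphism to it is
determined by the pullbacks of the invariant polynomials `f`. For a pair `(𝒜, a)` the pullback of
`f` has to be the value `f(a)`: wherever `𝒜` is split by `n` homomorphisms `s_i` that agree pairwise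
at no point, this value is `f` evaluated at the matrix `s_i(a_j)`. Over a local ring two such
splittings differ by a permutation (`SepFamily.exists_perm`), so invariance of `f` makes the value
independent of the splitting, and faithfully flat descent brings it down to `𝒪_X`
(`exists_isValue`). Generation of `𝒜` by the `a_j` keeps the points `s_i(a_j)` off the diagonals
`Z_{ij}`. Hence exactly one morphism takes these values; this is the predicate `Computes`
(`exists_computes`, `Computes.eq`).

That computing is the same as classifying rests on the freeness of the action on `U(r; 𝔸ⁿ)`: over
affine pieces the differences `x_{ji} - x_{ji'}` generate the unit ideal, which yields dual bases
and an element of trace one, hence explicit descent for equivariant functions. If `φ` classifies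
`(𝒜, a)`, base change along `π : U ⟶ B` splits `𝒜` tautologically and turns `a_j` into the vector of
the `x_{ji}` (`Classifies.computes`). If `φ` computes `a`, the sections of `ℰ` over affine opens are
polynomials in the `t_j`, and `t_j ↦ a_j` is well defined and exhibits `𝒜` as the pullback because
both claims can be tested on splittings (`Computes.classifies`).

For the homotopy, whenever `x + t (y - x)` generates `𝒜[t]` over `𝒪[t]`, the same recipe over
polynomial rings gives a morphism `X × 𝔸¹ ⟶ B` joining the morphisms of `x` and `y`
(`exists_homotopy`). After moving `a'` into `𝒜` by the isomorphism, the chain is `(a, 0) → (a, a') →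
(a', 0) + (0, a') → (a', 0)`; the two summands of the third tuple overlap when `r' > r`. The first
path keeps `a` unchanged; along the other two `a'` is recovered by a triangular elimination, which
works because the shift `r` is positive. An `𝔸¹`-invariant functor cannot distinguish the sections
at `0` and `1`, both being inverted by the same isomorphism. -/

/-- A family of algebra homomorphisms is separated if no two of its members agree at any point of
the spectrum of the target. -/
def SepFamily (s : ι → A →ₐ[R] L) : Prop :=
  ∀ i j, i ≠ j → Ideal.span (Set.range fun b ↦ s i b - s j b) = ⊤

/-- The homomorphism `L ⊗ A → ∏ L` induced by a family of homomorphisms `A → L`. -/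
noncomputable def familyHom (s : ι → A →ₐ[R] L) : L ⊗[R] A →ₐ[L] (ι → L) :=
  Algebra.TensorProduct.lift (Algebra.ofId L (ι → L)) (AlgHom.pi s)
    (fun _ _ ↦ Commute.all _ _)

@[simp]
lemma familyHom_tmul (s : ι → A →ₐ[R] L) (l : L) (b : A) (i : ι) :
    familyHom s (l ⊗ₜ b) i = l * s i b := by
  simp [familyHom, Algebra.ofId_apply]

/-- Writing `1` as a combination of the differences `s i b - s j b` gives an element of the image
that is `1` at `i` and `0` at `j`. The product of these over `j ≠ i` is the `i`-th standard
idempotent. -/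
lemma SepFamily.familyHom_surjective [Finite ι] {s : ι → A →ₐ[R] L} (hs : SepFamily s) :
    Function.Surjective (familyHom s) := by
  classical
  cases nonempty_fintype ι
  have h1 : ∀ i j, i ≠ j → ∃ w ∈ (familyHom s).range, w i = 1 ∧ w j = 0 := by
    intro i j hij
    have key : ∀ x ∈ Ideal.span (Set.range fun b ↦ s i b - s j b),
        ∃ w ∈ (familyHom s).range, w i = x ∧ w j = 0 := by
      intro x hx
      induction hx using Submodule.span_induction with
      | mem x hx =>
        obtain ⟨b, rfl⟩ := hx
        exact ⟨_, ⟨1 ⊗ₜ b - s j b ⊗ₜ 1, rfl⟩, by simp, by simp⟩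
      | zero => exact ⟨0, zero_mem _, rfl, rfl⟩
      | add x y _ _ hx hy =>
        obtain ⟨w, hw, rfl, hwj⟩ := hx
        obtain ⟨w', hw', rfl, hwj'⟩ := hy
        exact ⟨w + w', add_mem hw hw', rfl, by simp [hwj, hwj']⟩
      | smul c x _ hx =>
        obtain ⟨w, hw, rfl, hwj⟩ := hx
        exact ⟨c • w, Subalgebra.smul_mem _ hw c, rfl, by simp [hwj]⟩
    exact key 1 (by rw [hs i j hij]; trivial)
  choose! w hw hw1 hw0 using h1
  have h2 : ∀ i, (Pi.single i 1 : ι → L) ∈ (familyHom s).range := by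
    intro i
    have : (Pi.single i 1 : ι → L) = ∏ j ∈ Finset.univ.erase i, w i j := by
      ext l
      rw [Finset.prod_apply]
      by_cases hl : l = i
      · subst hl
        rw [Pi.single_eq_same, Finset.prod_eq_one]
        intro j hj
        exact hw1 _ _ (Finset.ne_of_mem_erase hj).symm
      · rw [Pi.single_eq_of_ne hl, Finset.prod_eq_zero (i := l) (by simp [hl])]
        exact hw0 _ _ (Ne.symm hl)
    rw [this]
    exact prod_mem fun j hj ↦ hw _ _ (Finset.ne_of_mem_erase hj).symm
  intro v
  have : v = ∑ i, v i • (Pi.single i 1 : ι → L) := by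
    ext l
    simp [Finset.sum_apply, Pi.single_apply]
  rw [this]
  exact sum_mem (S := (familyHom s).range) fun i _ ↦ Subalgebra.smul_mem _ (h2 i) _

/-- When the family has as many members as the rank, the surjection becomes a surjective
endomorphism of `L^n`, which is automatically injective. -/
lemma SepFamily.familyHom_bijective {n : ℕ} (e : Module.Basis (Fin n) R A)
    {s : Fin n → A →ₐ[R] L} (hs : SepFamily s) : Function.Bijective (familyHom s) := by
  let e' : (L ⊗[R] A) ≃ₗ[L] (Fin n → L) := (e.baseChange L).equivFun
  have h := OrzechProperty.bijective_of_surjective_endomorphism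
    ((familyHom s).toLinearMap ∘ₗ e'.symm.toLinearMap)
    (hs.familyHom_surjective.comp e'.symm.surjective)
  have : (familyHom s : L ⊗[R] A → (Fin n → L)) =
      ((familyHom s).toLinearMap ∘ₗ e'.symm.toLinearMap) ∘ e' := by
    ext x; simp
  rw [this]
  exact h.comp e'.bijective

lemma SepFamily.comp {L' : Type*} [CommRing L'] [Algebra R L'] {s : ι → A →ₐ[R] L}
    (hs : SepFamily s) (g : L →ₐ[R] L') : SepFamily fun i ↦ g.comp (s i) := by
  intro i j hij
  have := congrArg (Ideal.map g) (hs i j hij)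
  rw [Ideal.map_span, Ideal.map_top, ← Set.range_comp] at this
  rw [← this]
  congr 1
  ext; simp

/-- To check that a family is separated it suffices to look at algebra generators. -/
lemma sepFamily_iff_of_adjoin {κ : Type*} {a : κ → A} (ha : Algebra.adjoin R (Set.range a) = ⊤)
    (s : ι → A →ₐ[R] L) :
    SepFamily s ↔ ∀ i j, i ≠ j → Ideal.span (Set.range fun l ↦ s i (a l) - s j (a l)) = ⊤ := by
  refine forall₃_congr fun i j _ ↦ ?_
  suffices h : Ideal.span (Set.range fun b ↦ s i b - s j b) =
      Ideal.span (Set.range fun l ↦ s i (a l) - s j (a l)) by rw [h]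
  apply le_antisymm
  · rw [Ideal.span_le]
    rintro _ ⟨b, rfl⟩
    have hb : b ∈ Algebra.adjoin R (Set.range a) := by rw [ha]; trivial
    set I := Ideal.span (Set.range fun l ↦ s i (a l) - s j (a l))
    change s i b - s j b ∈ I
    induction hb using Algebra.adjoin_induction with
    | mem x hx =>
      obtain ⟨l, rfl⟩ := hx
      exact Ideal.subset_span ⟨l, rfl⟩
    | algebraMap c => simp
    | add x y _ _ hx hy =>
      have : s i (x + y) - s j (x + y) = (s i x - s j x) + (s i y - s j y) := by simp; ring
      rw [this]; exact I.add_mem hx hy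
    | mul x y _ _ hx hy =>
      have : s i (x * y) - s j (x * y) =
        s i y * (s i x - s j x) + s j x * (s i y - s j y) := by simp; ring
      rw [this]; exact I.add_mem (I.mul_mem_left _ hx) (I.mul_mem_left _ hy)
  · refine Ideal.span_mono ?_
    rintro _ ⟨l, rfl⟩
    exact ⟨a l, rfl⟩

/-- The images of the standard idempotents sum to `1`, so in a local ring one of them is a unit; an
idempotent unit is `1`. -/
lemma algHom_pi_eq_eval {M : Type*} [CommRing M] [IsLocalRing M] [Fintype ι]
    (g : (ι → M) →ₐ[M] M) : ∃ i, ∀ v, g v = v i := by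
  classical
  have hsum : ∑ i, g (Pi.single i 1) = 1 := by
    rw [← map_sum, Finset.univ_sum_single (fun _ : ι ↦ (1 : M))]
    exact map_one g
  obtain ⟨i, hi⟩ : ∃ i, IsUnit (g (Pi.single i 1)) := by
    by_contra! h
    have : ∑ i, g (Pi.single i 1) ∈ IsLocalRing.maximalIdeal M :=
      sum_mem fun i _ ↦ (IsLocalRing.mem_maximalIdeal _).2 (h i)
    rw [hsum] at this
    exact (Ideal.ne_top_iff_one _).1 (IsLocalRing.maximalIdeal.isMaximal M).ne_top this
  have hone : g (Pi.single i 1) = 1 := by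
    apply hi.mul_left_cancel
    rw [← map_mul, ← Pi.single_mul, mul_one, mul_one]
  refine ⟨i, fun v ↦ ?_⟩
  have : g v * g (Pi.single i 1) = g (v i • Pi.single i 1) := by
    rw [← map_mul]
    congr 1
    ext l
    by_cases h : l = i
    · subst h; simp
    · simp [h]
  rwa [hone, mul_one, map_smul, hone, smul_eq_mul, mul_one] at this

/-- Over a local ring two separated families of maximal length agree up to a permutation. -/
lemma SepFamily.exists_perm {M : Type*} [CommRing M] [IsLocalRing M] [Algebra R M] {n : ℕ}
    (e : Module.Basis (Fin n) R A) {s s' : Fin n → A →ₐ[R] M} (hs : SepFamily s)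
    (hs' : SepFamily s') : ∃ τ : Equiv.Perm (Fin n), ∀ i, s' i = s (τ i) := by
  let E := AlgEquiv.ofBijective (familyHom s) (hs.familyHom_bijective e)
  have h : ∀ i, ∃ j, s' i = s j := by
    intro i
    -- Extended to `M ⊗ A` and transported along the splitting `M ⊗ A ≃ M^n` given by `s`, the map
    -- `s' i` becomes an algebra map `M^n → M`, that is, a projection.
    let g : (Fin n → M) →ₐ[M] M :=
      (Algebra.TensorProduct.lift (Algebra.ofId M M) (s' i) (fun _ _ ↦ Commute.all _ _)).comp
        E.symm.toAlgHom
    obtain ⟨j, hj⟩ := algHom_pi_eq_eval g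
    refine ⟨j, AlgHom.ext fun b ↦ ?_⟩
    have h1 := hj (familyHom s (1 ⊗ₜ b))
    have h2 : E.symm (familyHom s (1 ⊗ₜ b)) = 1 ⊗ₜ b := E.symm_apply_apply (1 ⊗ₜ b)
    simpa [g, h2] using h1
  choose τ hτ using h
  have hinj : Function.Injective τ := by
    intro i j hij
    by_contra hne
    have h1 := hs' i j hne
    have h2 : s' i = s' j := by rw [hτ, hτ, hij]
    simp [h2, Set.range_const] at h1
  exact ⟨Equiv.ofBijective τ (Finite.injective_iff_bijective.1 hinj), hτ⟩

end SepFamily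

/-! ### Values of multisymmetric functions -/

section Value

open TensorProduct

variable {k : Type u} [CommRing k] {n r : ℕ}

/-- Evaluation of a polynomial in the coordinates `x_{ji}` at a point. -/
noncomputable def evalPt {L : Type*} [CommRing L] (κ : k →+* L) (α : Fin r → Fin n → L) :
    Coord k n r →+* L :=
  MvPolynomial.eval₂Hom κ fun p ↦ α p.1 p.2

@[simp]
lemma evalPt_C {L : Type*} [CommRing L] (κ : k →+* L) (α : Fin r → Fin n → L) (c : k) :
    evalPt κ α (MvPolynomial.C c) = κ c := MvPolynomial.eval₂_C _ _ _

@[simp]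
lemma evalPt_X {L : Type*} [CommRing L] (κ : k →+* L) (α : Fin r → Fin n → L)
    (p : Fin r × Fin n) : evalPt κ α (MvPolynomial.X p) = α p.1 p.2 :=
  MvPolynomial.eval₂_X _ _ _

lemma coord_ringHom_ext {L : Type*} [CommRing L] {f g : Coord k n r →+* L}
    (hC : ∀ c, f (MvPolynomial.C c) = g (MvPolynomial.C c))
    (hX : ∀ j i, f (MvPolynomial.X (j, i)) = g (MvPolynomial.X (j, i))) : f = g :=
  MvPolynomial.ringHom_ext hC fun p ↦ hX p.1 p.2

lemma comp_evalPt {L L' : Type*} [CommRing L] [CommRing L'] (g : L →+* L') (κ : k →+* L)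
    (α : Fin r → Fin n → L) : g.comp (evalPt κ α) = evalPt (g.comp κ) fun j i ↦ g (α j i) :=
  coord_ringHom_ext (by simp) (by simp)

lemma evalPt_perm {L : Type*} [CommRing L] (κ : k →+* L) (α : Fin r → Fin n → L)
    (f : Inv k n r) (τ : Equiv.Perm (Fin n)) :
    evalPt κ (fun j i ↦ α j (τ i)) f = evalPt κ α f := by
  conv_rhs => rw [← f.2 τ]
  rw [perm_smul_def]
  have : (evalPt κ α).comp (MvPolynomial.rename (Prod.map id τ)).toRingHom =
      evalPt κ (fun j i ↦ α j (τ i)) := coord_ringHom_ext (by simp) (by simp)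
  rw [← this]
  rfl

variable {R A : Type u} [CommRing R] [CommRing A] [Algebra R A]

/-- Equality in `M` may be checked in the localizations at maximal ideals, where the two families
differ by a permutation that an invariant polynomial does not see. -/
lemma SepFamily.evalPt_eq (e : Module.Basis (Fin n) R A) {M : Type*} [CommRing M] [Algebra R M]
    {s s' : Fin n → A →ₐ[R] M} (hs : SepFamily s) (hs' : SepFamily s') (κ : k →+* M)
    (a : Fin r → A) (f : Inv k n r) :
    evalPt κ (fun j i ↦ s i (a j)) f = evalPt κ (fun j i ↦ s' i (a j)) f := by
  refine Module.eq_of_localization_maximal (R := M)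
    (Mₚ := fun P _ ↦ Localization.AtPrime P)
    (f := fun P _ ↦ Algebra.linearMap M (Localization.AtPrime P)) _ _ fun P _ ↦ ?_
  let g : M →ₐ[R] Localization.AtPrime P := IsScalarTower.toAlgHom R M _
  obtain ⟨τ, hτ⟩ := (hs.comp g).exists_perm e (hs'.comp g)
  have h : ∀ s : Fin n → A →ₐ[R] M, (g : M →+* Localization.AtPrime P)
      (evalPt κ (fun j i ↦ s i (a j)) f) =
      evalPt ((g : M →+* Localization.AtPrime P).comp κ) (fun j i ↦ g.comp (s i) (a j)) f := by
    intro s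
    rw [← RingHom.comp_apply, comp_evalPt]
    rfl
  change (g : M →+* Localization.AtPrime P) (evalPt _ _ _) =
    (g : M →+* Localization.AtPrime P) (evalPt _ _ _)
  rw [h, h]
  simp_rw [hτ]
  exact (evalPt_perm _ (fun j i ↦ g.comp (s i) (a j)) f τ).symm

/-- `x` is the value of the multisymmetric function `f` at the `r`-tuple `a`: this holds after
every base change to a ring over which the algebra splits. -/
def IsValue (κ : k →+* R) (a : Fin r → A) (f : Coord k n r) (x : R) : Prop :=
  ∀ (L : Type u) [CommRing L] [Algebra R L] (s : Fin n → A →ₐ[R] L), SepFamily s →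
    algebraMap R L x = evalPt ((algebraMap R L).comp κ) (fun j i ↦ s i (a j)) f

/-- A finite étale algebra of constant rank splits after a faithfully flat base change. -/
lemma exists_sepFamily [Algebra.Etale R A] (e : Module.Basis (Fin n) R A) :
    ∃ (L : Type u) (_ : CommRing L) (_ : Algebra R L) (_ : Module.FaithfullyFlat R L)
      (s : Fin n → A →ₐ[R] L), SepFamily s := by
  have := Module.Free.of_basis e
  have := Module.Finite.of_basis e
  cases subsingleton_or_nontrivial R with
  | inl h =>
    refine ⟨R, inferInstance, inferInstance, inferInstance, fun _ ↦
      { toFun := fun _ ↦ 0, map_one' := Subsingleton.elim _ _, map_zero' := Subsingleton.elim _ _,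
        map_mul' := fun _ _ ↦ Subsingleton.elim _ _, map_add' := fun _ _ ↦ Subsingleton.elim _ _,
        commutes' := fun _ ↦ Subsingleton.elim _ _ }, fun _ _ _ ↦ ?_⟩
    exact Subsingleton.elim (α := Ideal R) _ _
  | inr h =>
    have hrank : Module.rankAtStalk (R := R) A = n := by
      ext p
      rw [Module.rankAtStalk_eq_finrank_of_free]
      simp [Module.finrank_eq_card_basis e]
    obtain ⟨L, _, _, _, _, _, hL⟩ := Algebra.IsFiniteSplit.exists_tensorProduct_of_etale hrank
    obtain ⟨m, ⟨E⟩⟩ := hL.nonempty_algEquiv_fun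
    have : Nontrivial L := (FaithfulSMul.algebraMap_injective R L).nontrivial
    -- The splitting supplies some number `m` of factors; comparing ranks over the nontrivial ring
    -- `L` identifies it with `n`.
    have hm : m = n := by
      have h1 := Module.finrank_eq_card_basis ((Pi.basisFun L (Fin m)).map E.symm.toLinearEquiv)
      have h2 := Module.finrank_eq_card_basis (e.baseChange L)
      rw [h1] at h2
      simpa using h2
    subst hm
    refine ⟨L, inferInstance, inferInstance, inferInstance, fun i ↦
      (((Pi.evalAlgHom L (fun _ ↦ L) i).comp E.toAlgHom).restrictScalars R).comp
        Algebra.TensorProduct.includeRight, fun i j hij ↦ ?_⟩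
    rw [Ideal.eq_top_iff_one]
    set I : Ideal L := Ideal.span _
    have key : ∀ x : L ⊗[R] A, E x i - E x j ∈ I := by
      intro x
      induction x using TensorProduct.induction_on with
      | zero => simp
      | tmul l b =>
        have : (l ⊗ₜ b : L ⊗[R] A) = l • (1 ⊗ₜ b) := by simp [TensorProduct.smul_tmul']
        rw [this, map_smul, Pi.smul_apply, Pi.smul_apply, ← smul_sub]
        exact I.mul_mem_left _ (Ideal.subset_span ⟨b, rfl⟩)
      | add x y hx hy =>
        have : E (x + y) i - E (x + y) j = (E x i - E x j) + (E y i - E y j) := by simp; ring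
        rw [this]; exact I.add_mem hx hy
    -- The element corresponding to the `i`-th idempotent has `i`-th minus `j`-th component equal to
    -- `1`.
    simpa [hij.symm] using key (E.symm (Pi.single i 1))

lemma IsValue.unique [Algebra.Etale R A] (e : Module.Basis (Fin n) R A) {κ : k →+* R}
    {a : Fin r → A} {f : Coord k n r} {x y : R} (hx : IsValue κ a f x) (hy : IsValue κ a f y) :
    x = y := by
  obtain ⟨L, _, _, _, s, hs⟩ := exists_sepFamily e
  exact FaithfulSMul.algebraMap_injective R L ((hx L s hs).trans (hy L s hs).symm)

/-- Faithfully flat descent. The value `z` computed in one splitting ring `L` has equal images under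
the two maps to `L ⊗ L`, since both are values for separated families there; so `z` comes from `R`.
Any other splitting ring `L'` is compared with `L` inside `L' ⊗ L`, into which `L'` injects. -/
lemma exists_isValue [Algebra.Etale R A] (e : Module.Basis (Fin n) R A) (κ : k →+* R)
    (a : Fin r → A) (f : Inv k n r) : ∃ x, IsValue κ a (f : Coord k n r) x := by
  obtain ⟨L, _, _, _, s, hs⟩ := exists_sepFamily e
  set z := evalPt ((algebraMap R L).comp κ) (fun j i ↦ s i (a j)) f with hz
  have hcomp : ∀ (L' L'' : Type u) [CommRing L'] [CommRing L''] [Algebra R L'] [Algebra R L'']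
      (g : L' →ₐ[R] L'') (s : Fin n → A →ₐ[R] L'),
      g (evalPt ((algebraMap R L').comp κ) (fun j i ↦ s i (a j)) f) =
        evalPt ((algebraMap R L'').comp κ) (fun j i ↦ (g.comp (s i)) (a j)) f := by
    intro L' L'' _ _ _ _ g s
    change (g : L' →+* L'') _ = _
    rw [← RingHom.comp_apply, comp_evalPt, ← RingHom.comp_assoc, AlgHom.comp_algebraMap]
    rfl
  have hloc : z ∈ Set.range (algebraMap R L) := by
    refine (Algebra.IsEffective.of_faithfullyFlat R L z).1 ?_
    rw [Algebra.TensorProduct.includeLeftSubRight_apply, sub_eq_zero]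
    have h1 := hcomp L (L ⊗[R] L) Algebra.TensorProduct.includeLeft s
    have h2 := hcomp L (L ⊗[R] L) Algebra.TensorProduct.includeRight s
    refine h1.trans (Eq.trans ?_ h2.symm)
    exact (hs.comp _).evalPt_eq e (hs.comp _) _ a f
  obtain ⟨x, hx⟩ := hloc
  refine ⟨x, fun L' _ _ s' hs' ↦ ?_⟩
  have hinj : Function.Injective (Algebra.TensorProduct.includeLeft : L' →ₐ[R] L' ⊗[R] L) :=
    FaithfulSMul.algebraMap_injective L' (L' ⊗[R] L)
  apply hinj
  rw [hcomp, AlgHom.commutes,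
    (hs'.comp _).evalPt_eq e (hs.comp (Algebra.TensorProduct.includeRight : L →ₐ[R] L' ⊗[R] L)),
    ← hcomp, ← hz, ← hx, AlgHom.commutes]

/-- Values are compatible with base change. -/
lemma IsValue.map {R' A' : Type u} [CommRing R'] [CommRing A'] [Algebra R' A']
    {κ : k →+* R} {a : Fin r → A} {f : Inv k n r} {x : R}
    (hx : IsValue κ a (f : Coord k n r) x) (g : R →+* R') (h : A →+* A')
    (hgh : ∀ c, h (algebraMap R A c) = algebraMap R' A' (g c))
    (hgen : Algebra.adjoin R' (Set.range h) = ⊤) :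
    IsValue (g.comp κ) (fun j ↦ h (a j)) (f : Coord k n r) (g x) := by
  intro L _ _ s hs
  let _ : Algebra R L := ((algebraMap R' L).comp g).toAlgebra
  let s' : Fin n → A →ₐ[R] L := fun i ↦
    { ((s i : A' →+* L).comp h) with
      commutes' := fun c ↦ by
        change s i (h _) = _
        rw [hgh, AlgHom.commutes]; rfl }
  -- Separatedness of `s` may be tested on the generators `h b`, and on these it is the
  -- separatedness of the restricted family `s'`. Thus `A'` need only be generated by the image of
  -- `A`.
  exact hx L s' ((sepFamily_iff_of_adjoin hgen s).1 hs)

/-- The ring homomorphism evaluating multisymmetric functions at an `r`-tuple of elements of an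
étale algebra. -/
noncomputable def valueHom [Algebra.Etale R A] (e : Module.Basis (Fin n) R A) (κ : k →+* R)
    (a : Fin r → A) : Inv k n r →+* R where
  toFun f := (exists_isValue e κ a f).choose
  map_one' := IsValue.unique e (exists_isValue e κ a 1).choose_spec fun L _ _ s _ ↦ by simp
  map_zero' := IsValue.unique e (exists_isValue e κ a 0).choose_spec fun L _ _ s _ ↦ by simp
  map_mul' f g := IsValue.unique e (exists_isValue e κ a (f * g)).choose_spec
    fun L _ _ s hs ↦ by
      rw [map_mul, (exists_isValue e κ a f).choose_spec L s hs,
        (exists_isValue e κ a g).choose_spec L s hs, Subalgebra.coe_mul, map_mul]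
  map_add' f g := IsValue.unique e (exists_isValue e κ a (f + g)).choose_spec
    fun L _ _ s hs ↦ by
      rw [map_add, (exists_isValue e κ a f).choose_spec L s hs,
        (exists_isValue e κ a g).choose_spec L s hs, Subalgebra.coe_add, map_add]

lemma valueHom_isValue [Algebra.Etale R A] (e : Module.Basis (Fin n) R A) (κ : k →+* R)
    (a : Fin r → A) (f : Inv k n r) : IsValue κ a (f : Coord k n r) (valueHom e κ a f) :=
  (exists_isValue e κ a f).choose_spec

end Value

/-! ### Galois descent along a free action of the symmetric group -/

section Galois

open TensorProduct

variable {S : Type*} {T : Type u} [CommRing S] [CommRing T] [Algebra S T] {n r : ℕ}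
  [MulSemiringAction (Equiv.Perm (Fin n)) T] [SMulCommClass (Equiv.Perm (Fin n)) S T]

/-- Equivariant functions from `{1, …, n}` to a ring with an action of the symmetric group. -/
def IsEquivariant (f : Fin n → T) : Prop := ∀ (σ : Equiv.Perm (Fin n)) i, σ • f i = f (σ i)

/-- The trace of an action of the symmetric group. -/
def permTrace (n : ℕ) [MulSemiringAction (Equiv.Perm (Fin n)) T] (z : T) : T :=
  ∑ σ : Equiv.Perm (Fin n), σ • z

lemma smul_permTrace (τ : Equiv.Perm (Fin n)) (z : T) : τ • permTrace n z = permTrace n z := by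
  simp only [permTrace, Finset.smul_sum, smul_smul]
  exact Fintype.sum_equiv (Equiv.mulLeft τ) _ _ fun σ ↦ rfl

variable {x : Fin r → Fin n → T} (hx : ∀ j, IsEquivariant (x j))
  (hsep : ∀ i i', i ≠ i' → Ideal.span (Set.range fun j ↦ x j i - x j i') = ⊤)

include hx hsep

/-- Since `x` separates indices, the automorphisms `σ` of `T` form a separated family over `ℤ`. The
pair `u`, `v` spells out a preimage in `T ⊗ T` of the indicator function of the identity
permutation. -/
lemma exists_dual_pair : ∃ (ι : Type u) (_ : Fintype ι) (u v : ι → T),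
    ∀ σ : Equiv.Perm (Fin n), ∑ m, u m * σ • v m = if σ = 1 then 1 else 0 := by
  classical
  let s : Equiv.Perm (Fin n) → T →ₐ[ℤ] T := fun σ ↦
    (MulSemiringAction.toRingHom (Equiv.Perm (Fin n)) T σ).toIntAlgHom
  have hs : SepFamily s := by
    intro σ τ hστ
    obtain ⟨i, hi⟩ : ∃ i, σ i ≠ τ i := by
      by_contra! h
      exact hστ (Equiv.ext h)
    rw [eq_top_iff, ← hsep _ _ hi]
    refine Ideal.span_mono ?_
    rintro _ ⟨j, rfl⟩
    refine ⟨x j i, ?_⟩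
    simp [s, hx j _ _]
  obtain ⟨z, hz⟩ := hs.familyHom_surjective (Pi.single 1 1)
  obtain ⟨F, rfl⟩ := TensorProduct.exists_finset z
  refine ⟨F, inferInstance, fun m ↦ m.1.1, fun m ↦ m.1.2, fun σ ↦ ?_⟩
  have := congrFun hz σ
  rw [Pi.single_apply, map_sum, Finset.sum_apply, ← Finset.sum_coe_sort] at this
  simpa [s] using this

/-- `T` is generated over the invariants by a finite family with explicit dual basis. -/
lemma exists_dual_basis : ∃ (ι : Type u) (_ : Fintype ι) (u v : ι → T),
    ∀ z : T, z = ∑ m, permTrace n (z * v m) * u m := by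
  obtain ⟨ι, _, u, v, h⟩ := exists_dual_pair hx hsep
  refine ⟨ι, inferInstance, u, v, fun z ↦ ?_⟩
  simp only [permTrace, Finset.sum_mul]
  rw [Finset.sum_comm]
  -- The summand for `σ` is `σ • z` times the dual pairing, so only the identity contributes.
  have : ∀ σ : Equiv.Perm (Fin n), ∑ m, σ • (z * v m) * u m = if σ = 1 then z else 0 := by
    intro σ
    have : ∀ m, σ • (z * v m) * u m = σ • z * (u m * σ • v m) := fun m ↦ by
      rw [smul_mul']; ring
    simp only [this]
    rw [← Finset.mul_sum, h]
    split_ifs with hσ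
    · subst hσ; simp
    · simp
  rw [Finset.sum_congr rfl fun σ _ ↦ this σ]
  simp

variable [Algebra.IsInvariant S T (Equiv.Perm (Fin n))]

/-- The traces form an ideal `J` of the invariants. The dual basis expansion of `1` shows that `J`
generates the unit ideal of `T`; as `T` is integral over `S`, already `J` is the unit ideal. -/
lemma exists_permTrace_eq_one (hinj : Function.Injective (algebraMap S T)) :
    ∃ w : T, permTrace n w = 1 := by
  obtain ⟨ι, _, u, v, h⟩ := exists_dual_basis hx hsep
  let J : Ideal S :=
    { carrier := {c | ∃ z : T, permTrace n z = algebraMap S T c}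
      add_mem' := by
        rintro a b ⟨z, hz⟩ ⟨y, hy⟩
        refine ⟨z + y, ?_⟩
        rw [map_add, ← hz, ← hy]
        simp [permTrace, Finset.sum_add_distrib]
      zero_mem' := ⟨0, by simp [permTrace]⟩
      smul_mem' := by
        rintro c a ⟨z, hz⟩
        refine ⟨c • z, ?_⟩
        rw [smul_eq_mul, map_mul, ← hz]
        simp only [permTrace, Finset.mul_sum]
        exact Finset.sum_congr rfl fun σ _ ↦ by rw [smul_comm, Algebra.smul_def] }
  have hint := Algebra.IsInvariant.isIntegral S T (Equiv.Perm (Fin n))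
  have hJ : J.map (algebraMap S T) = ⊤ := by
    rw [Ideal.eq_top_iff_one, h 1]
    refine sum_mem fun m _ ↦ Ideal.mul_mem_right _ _ ?_
    obtain ⟨c, hc⟩ := Algebra.IsInvariant.isInvariant (A := S) (G := Equiv.Perm (Fin n))
      (permTrace n (1 * v m)) fun τ ↦ smul_permTrace τ _
    rw [← hc]
    exact Ideal.mem_map_of_mem _ ⟨_, hc.symm⟩
  rw [Ideal.map_eq_top_iff _ hinj (algebraMap_isIntegral_iff.2 hint), Ideal.eq_top_iff_one] at hJ
  obtain ⟨w, hw⟩ := hJ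
  exact ⟨w, by rw [hw, map_one]⟩

/-- The module of equivariant functions has a finite dual basis over the invariants. -/
lemma exists_equivariant_dual_basis (hinj : Function.Injective (algebraMap S T)) :
    ∃ (ι : Type u) (_ : Fintype ι) (c : ι → Fin n) (v : ι → T) (p : ι → Fin n → T),
      (∀ m, IsEquivariant (p m)) ∧ ∀ f : Fin n → T, IsEquivariant f →
        ∀ i, f i = ∑ m, permTrace n (f (c m) * v m) * p m i := by
  classical
  obtain ⟨ι, _, u, v, h⟩ := exists_dual_basis hx hsep
  obtain ⟨w, hw⟩ := exists_permTrace_eq_one hx hsep hinj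
  -- For an index pair `(l, m)`, the function is the symmetrization of the one supported at `l` with
  -- value `w * u m`. Weighting by `w`, of trace one, makes the sum over all `l` reproduce `f` once.
  refine ⟨Fin n × ι, inferInstance, fun m ↦ m.1, fun m ↦ v m.2, fun m i ↦
    ∑ σ : Equiv.Perm (Fin n), if σ m.1 = i then σ • (w * u m.2) else 0, fun m τ i ↦ ?_,
    fun f hf i ↦ ?_⟩
  · rw [Finset.smul_sum]
    refine Fintype.sum_equiv (Equiv.mulLeft τ) _ _ fun σ ↦ ?_
    simp only [Equiv.coe_mulLeft, Equiv.Perm.coe_mul, Function.comp_apply, smul_ite, smul_zero,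
      EmbeddingLike.apply_eq_iff_eq, mul_smul]
  · rw [Fintype.sum_prod_type]
    have h1 : ∀ (l : Fin n) (σ : Equiv.Perm (Fin n)),
        ∑ m, permTrace n (f l * v m) * (if σ l = i then σ • (w * u m) else 0) =
          if σ l = i then σ • w * f i else 0 := by
      intro l σ
      split_ifs with hl
      · have h2 : ∀ m, permTrace n (f l * v m) * σ • (w * u m) =
            σ • w * σ • (permTrace n (f l * v m) * u m) := fun m ↦ by
          rw [smul_mul', smul_mul', smul_permTrace]; ring
        simp only [h2]
        rw [← Finset.mul_sum, ← Finset.smul_sum, ← h, hf, hl]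
      · simp
    simp only [Finset.mul_sum]
    have h3 : ∀ l : Fin n, ∑ m, ∑ σ : Equiv.Perm (Fin n),
        permTrace n (f l * v m) * (if σ l = i then σ • (w * u m) else 0) =
        ∑ σ : Equiv.Perm (Fin n), if σ l = i then σ • w * f i else 0 := fun l ↦ by
      rw [Finset.sum_comm]; exact Finset.sum_congr rfl fun σ _ ↦ h1 l σ
    simp only [h3]
    rw [Finset.sum_comm]
    have h4 : ∀ σ : Equiv.Perm (Fin n),
        (∑ l : Fin n, if σ l = i then σ • w * f i else 0) = σ • w * f i := by
      intro σ
      rw [Finset.sum_eq_single (σ⁻¹ i)]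
      · simp
      · intro l _ hl
        rw [if_neg]
        rintro rfl
        simp at hl
      · simp
    simp only [h4]
    rw [← Finset.sum_mul]
    change _ = permTrace n w * _
    rw [hw, one_mul]

/-- The algebra of equivariant functions is generated over the invariants by any tuple of
equivariant functions which separates points. -/
lemma mem_adjoin_of_isEquivariant (hinj : Function.Injective (algebraMap S T)) {f : Fin n → T}
    (hf : IsEquivariant f) : f ∈ Algebra.adjoin S (Set.range x) := by
  obtain ⟨w, hw⟩ := exists_permTrace_eq_one hx hsep hinj
  let Q := Algebra.adjoin S (Set.range x)
  let s : Fin n → Q →ₐ[S] T := fun i ↦ (Pi.evalAlgHom S (fun _ ↦ T) i).comp Q.val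
  have hs : SepFamily s := by
    intro i i' hi
    rw [eq_top_iff, ← hsep _ _ hi]
    refine Ideal.span_mono ?_
    rintro _ ⟨j, rfl⟩
    exact ⟨⟨x j, Algebra.subset_adjoin ⟨j, rfl⟩⟩, rfl⟩
  have hQ : ∀ q ∈ Q, IsEquivariant q := by
    intro q hq
    induction hq using Algebra.adjoin_induction with
    | mem q hq => obtain ⟨j, rfl⟩ := hq; exact hx j
    | algebraMap c =>
      intro σ i
      simp [Pi.algebraMap_apply, Algebra.algebraMap_eq_smul_one, smul_comm σ c (1 : T)]
    | add q q' _ _ h h' => intro σ i; simp [h σ i, h' σ i]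
    | mul q q' _ _ h h' => intro σ i; simp [h σ i, h' σ i]
  -- Separatedness writes `f` as a combination of elements of `Q` with coefficients in `T`.
  -- Averaging against `w` then replaces each coefficient `c` by the invariant trace of `w * c`.
  obtain ⟨z, hz⟩ := hs.familyHom_surjective f
  obtain ⟨F, rfl⟩ := TensorProduct.exists_finset z
  have hfi : ∀ i, f i = ∑ m ∈ F, m.1 * m.2.1 i := by
    intro i
    rw [← hz, map_sum, Finset.sum_apply]
    simp [s]
  have htr : ∀ z : T, ∃ c : S, algebraMap S T c = permTrace n z := fun z ↦
    Algebra.IsInvariant.isInvariant (A := S) (G := Equiv.Perm (Fin n)) _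
      fun τ ↦ smul_permTrace τ _
  choose tr htr using htr
  have : f = ∑ m ∈ F, tr (w * m.1) • (m.2.1 : Fin n → T) := by
    ext i
    rw [Finset.sum_apply]
    simp only [Pi.smul_apply, Algebra.smul_def, htr, permTrace, Finset.sum_mul]
    rw [Finset.sum_comm]
    have : ∀ σ : Equiv.Perm (Fin n), ∑ m ∈ F, σ • (w * m.1) * m.2.1 i = σ • w * f i := by
      intro σ
      have h1 : σ • f (σ⁻¹ i) = f i := by rw [hf]; simp
      rw [← h1, hfi, Finset.smul_sum, Finset.mul_sum]
      refine Finset.sum_congr rfl fun m _ ↦ ?_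
      rw [smul_mul', smul_mul', hQ _ m.2.2 σ]
      simp [mul_assoc]
    simp only [this]
    rw [← Finset.sum_mul]
    change _ = permTrace n w * _
    rw [hw, one_mul]
  rw [this]
  exact sum_mem fun m _ ↦ Subalgebra.smul_mem _ m.2.2 _

end Galois

/-! ### Restriction of sections -/

section Sections

variable {X Y : Scheme.{u}}

lemma app_map_apply (f : X ⟶ Y) {U V : Y.Opens} (h : V ≤ U) (s : Γ(Y, U)) :
    f.app V (Y.presheaf.map (homOfLE h).op s) =
      X.presheaf.map (homOfLE (f.preimage_mono h)).op (f.app U s) :=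
  ConcreteCategory.congr_hom (f.naturality (homOfLE h).op) s

lemma map_map_apply {U V W : X.Opens} (h : V ≤ U) (h' : W ≤ V) (s : Γ(X, U)) :
    X.presheaf.map (homOfLE h').op (X.presheaf.map (homOfLE h).op s) =
      X.presheaf.map (homOfLE (h'.trans h)).op s := by
  rw [← CommRingCat.comp_apply, ← Functor.map_comp]
  rfl

lemma map_appLE_apply (f : X ⟶ Y) {U U' : Y.Opens} {V : X.Opens} (e : V ≤ f ⁻¹ᵁ U) (h : U ≤ U')
    (s : Γ(Y, U')) : f.appLE U V e (Y.presheaf.map (homOfLE h).op s) =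
      f.appLE U' V (e.trans (f.preimage_mono h)) s := by
  rw [← CommRingCat.comp_apply, Scheme.Hom.map_appLE]

lemma appLE_map_apply (f : X ⟶ Y) {U : Y.Opens} {V V' : X.Opens} (e : V ≤ f ⁻¹ᵁ U) (h : V' ≤ V)
    (s : Γ(Y, U)) : X.presheaf.map (homOfLE h).op (f.appLE U V e s) =
      f.appLE U V' (h.trans e) s := by
  rw [← CommRingCat.comp_apply, Scheme.Hom.appLE_map]

lemma section_ext {U : X.Opens} {s t : Γ(X, U)}
    (h : ∀ x ∈ U, ∃ (V : X.Opens) (hV : V ≤ U), x ∈ V ∧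
      X.presheaf.map (homOfLE hV).op s = X.presheaf.map (homOfLE hV).op t) : s = t := by
  choose V hV hx hst using h
  exact X.sheaf.eq_of_locally_eq' (fun x : U ↦ V x.1 x.2) U (fun x ↦ homOfLE (hV _ _))
    (fun x hxU ↦ Opens.mem_iSup.2 ⟨⟨x, hxU⟩, hx _ _⟩) s t fun x ↦ hst _ _

end Sections

/-! ### Sections over basic opens of affine schemes -/

section SpecSec

variable {R R' : CommRingCat.{u}}

/-- The basic open subset of `Spec R` defined by an element of `R`. -/
def specD (f : R) : (Spec R).Opens := PrimeSpectrum.basicOpen f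

/-- The section of the structure sheaf of `Spec R` defined by an element of `R`. -/
noncomputable def specSec (U : (Spec R).Opens) : R ⟶ Γ(Spec R, U) :=
  (Scheme.ΓSpecIso R).inv ≫ (Spec R).presheaf.map (homOfLE le_top).op

lemma specSec_appLE (φ : R ⟶ R') (U : (Spec R).Opens) (V : (Spec R').Opens)
    (e : V ≤ Spec.map φ ⁻¹ᵁ U) :
    specSec U ≫ (Spec.map φ).appLE U V e = φ ≫ specSec V := by
  rw [specSec, specSec, Category.assoc, Scheme.Hom.map_appLE, Scheme.Hom.appLE,
    Scheme.ΓSpecIso_inv_naturality_assoc]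
  rfl

lemma specSec_isLocalization (f : R) :
    @IsLocalization.Away R _ f Γ(Spec R, specD f) _ (specSec (specD f)).hom.toAlgebra := by
  have h := @IsAffineOpen.instAwayCarrierObjOppositeOpensCarrierCarrierCommRingCatSpecPresheafOpOpensBasicOpen R f
  have e : @IsAffineOpen.instAlgebraCarrierObjOppositeOpensCarrierCarrierCommRingCatSpecPresheafOpOpens R (specD f) =
    (specSec (specD f)).hom.toAlgebra := Algebra.algebra_ext _ _ fun _ ↦ rfl
  rw [← e]
  exact h

lemma isUnit_specSec {f : R} {U : (Spec R).Opens} (hU : U = specD f) : IsUnit (specSec U f) := by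
  subst hU
  let _ := (specSec (specD f)).hom.toAlgebra
  have := specSec_isLocalization f
  exact IsLocalization.Away.algebraMap_isUnit f

lemma exists_specSec {f : R} {U : (Spec R).Opens} (hU : U = specD f) (z : Γ(Spec R, U)) :
    ∃ (p : R) (N : ℕ), z * specSec U f ^ N = specSec U p := by
  subst hU
  let _ := (specSec (specD f)).hom.toAlgebra
  have := specSec_isLocalization f
  obtain ⟨N, p, h⟩ := IsLocalization.Away.surj f z
  exact ⟨p, N, h⟩

lemma specSec_eq_zero {f : R} {U : (Spec R).Opens} (hU : U = specD f) {p : R}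
    (h : specSec U p = 0) : ∃ N : ℕ, f ^ N * p = 0 := by
  subst hU
  let _ := (specSec (specD f)).hom.toAlgebra
  have := specSec_isLocalization f
  obtain ⟨⟨_, N, rfl⟩, hc⟩ := (IsLocalization.map_eq_zero_iff (Submonoid.powers f)
    Γ(Spec R, specD f) p).1 h
  exact ⟨N, hc⟩

lemma exists_specD_mem_le (U : (Spec R).Opens) (x : Spec R) (hx : x ∈ U) :
    ∃ f : R, x ∈ specD f ∧ specD f ≤ U := by
  obtain ⟨_, ⟨f, rfl⟩, h1, h2⟩ :=
    PrimeSpectrum.isTopologicalBasis_basic_opens.exists_subset_of_mem_open hx U.isOpen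
  exact ⟨f, h1, h2⟩

end SpecSec

/-! ### Functions on the quotient are invariant functions -/

section Invariants

variable {k : Type u} [CommRing k] {n r : ℕ}

/-- The section over an open subset of `(𝔸ⁿ)^r` defined by a polynomial. -/
noncomputable def coordSec (P : (AffR k n r).Opens) : Coord k n r →+* Γ(AffR k n r, P) :=
  (specSec (R := .of (Coord k n r)) P).hom

/-- The section over an open subset of `(𝔸ⁿ)^r / S_n` defined by an invariant polynomial. -/
noncomputable def invSec (O : (QuotR k n r).Opens) : Inv k n r →+* Γ(QuotR k n r, O) :=
  (specSec (R := .of (Inv k n r)) O).hom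

/-- The basic open subset of `(𝔸ⁿ)^r / S_n` defined by an invariant polynomial. -/
noncomputable def quotD (h : Inv k n r) : (QuotR k n r).Opens := specD (R := .of (Inv k n r)) h

lemma quotMap_preimage_quotD (h : Inv k n r) :
    quotMap k n r ⁻¹ᵁ (quotD h) = specD (R := .of (Coord k n r)) (h : Coord k n r) :=
  rfl

lemma quotMap_invSec (O : (QuotR k n r).Opens) (p : Inv k n r) :
    (quotMap k n r).app O (invSec O p) = coordSec (quotMap k n r ⁻¹ᵁ O) (p : Coord k n r) := by
  rw [← Scheme.Hom.appLE_eq_app]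
  exact ConcreteCategory.congr_hom
    (specSec_appLE (CommRingCat.ofHom (Inv k n r).val.toRingHom) O _ le_rfl) p

lemma actAff_coordSec (σ : Equiv.Perm (Fin n)) (O P : (AffR k n r).Opens)
    (e : P ≤ actAff k n r σ ⁻¹ᵁ O) (p : Coord k n r) :
    (actAff k n r σ).appLE O P e (coordSec O p) = coordSec P (σ • p) :=
  ConcreteCategory.congr_hom (specSec_appLE
    (CommRingCat.ofHom (MulSemiringAction.toRingHom _ (Coord k n r) σ)) O P e) p

lemma isUnit_invSec (h : Inv k n r) : IsUnit (invSec (quotD h) h) :=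
  isUnit_specSec (R := .of (Inv k n r)) rfl

lemma isUnit_coordSec (h : Inv k n r) :
    IsUnit (coordSec (quotMap k n r ⁻¹ᵁ quotD h) (h : Coord k n r)) :=
  isUnit_specSec (R := .of (Coord k n r)) (quotMap_preimage_quotD h)

lemma coordSec_eq_zero {h : Inv k n r} {p : Coord k n r}
    (hp : coordSec (quotMap k n r ⁻¹ᵁ quotD h) p = 0) : ∃ N : ℕ, (h : Coord k n r) ^ N * p = 0 :=
  specSec_eq_zero (R := .of (Coord k n r)) (quotMap_preimage_quotD h) hp

lemma exists_coordSec {h : Inv k n r} (z : Γ(AffR k n r, quotMap k n r ⁻¹ᵁ quotD h)) :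
    ∃ (p : Coord k n r) (N : ℕ), z * coordSec (quotMap k n r ⁻¹ᵁ quotD h) (h : Coord k n r) ^ N =
      coordSec (quotMap k n r ⁻¹ᵁ quotD h) p :=
  exists_specSec (R := .of (Coord k n r)) (quotMap_preimage_quotD h) z

lemma exists_invSec {h : Inv k n r} (z : Γ(QuotR k n r, quotD h)) :
    ∃ (p : Inv k n r) (N : ℕ), z * invSec (quotD h) h ^ N = invSec (quotD h) p :=
  exists_specSec (R := .of (Inv k n r)) rfl z

lemma exists_quotD_mem_le (O : (QuotR k n r).Opens) (x : QuotR k n r) (hx : x ∈ O) :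
    ∃ f : Inv k n r, x ∈ quotD f ∧ quotD f ≤ O :=
  exists_specD_mem_le (R := .of (Inv k n r)) O x hx

/-- A numerator that vanishes after inverting `h` is killed by a power of `h`, and this relation
already holds in the subring of invariants. -/
lemma quotMap_app_injective_quotD (h : Inv k n r) (y : Γ(QuotR k n r, quotD h))
    (hy : (quotMap k n r).app (quotD h) y = 0) : y = 0 := by
  obtain ⟨p, N, hp⟩ := exists_invSec y
  have h1 := congrArg ((quotMap k n r).app (quotD h)) hp
  rw [map_mul, hy, zero_mul, quotMap_invSec] at h1
  obtain ⟨M, hM⟩ := coordSec_eq_zero h1.symm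
  have hM' : h ^ M * p = 0 := Subtype.ext hM
  have hu := isUnit_invSec h
  have h2 := congrArg (invSec (quotD h)) hM'
  rw [map_zero, map_mul, map_pow, (hu.pow M).mul_right_eq_zero] at h2
  rw [h2, (hu.pow N).mul_left_eq_zero] at hp
  exact hp

lemma actAff_preimage_le (O : (QuotR k n r).Opens) (σ : Equiv.Perm (Fin n)) :
    quotMap k n r ⁻¹ᵁ O ≤ actAff k n r σ ⁻¹ᵁ (quotMap k n r ⁻¹ᵁ O) := by
  rw [← Scheme.Hom.comp_preimage, actAff_quotMap]

/-- Invariance of the fraction `p / h ^ N` makes `p` invariant only up to `h`-power torsion.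
Multiplying by a power of the invariant `h` that works for all permutations gives an invariant
numerator. -/
lemma exists_quotMap_app_eq_quotD (h : Inv k n r)
    (z : Γ(AffR k n r, quotMap k n r ⁻¹ᵁ quotD h))
    (hz : ∀ σ, (actAff k n r σ).appLE _ _ (actAff_preimage_le _ σ) z = z) :
    ∃ y, (quotMap k n r).app (quotD h) y = z := by
  obtain ⟨p, N, hp⟩ := exists_coordSec z
  have h1 : ∀ σ : Equiv.Perm (Fin n), ∃ M, (h : Coord k n r) ^ M * (σ • p - p) = 0 := by
    intro σ
    refine coordSec_eq_zero ?_
    rw [map_sub, sub_eq_zero, ← actAff_coordSec σ _ _ (actAff_preimage_le (quotD h) σ), ← hp,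
      map_mul, map_pow, hz, actAff_coordSec, h.2 σ]
  choose M hM using h1
  let M' := ∑ σ, M σ
  have h2 : ∀ σ : Equiv.Perm (Fin n),
      σ • ((h : Coord k n r) ^ M' * p) = (h : Coord k n r) ^ M' * p := by
    -- The exponent `M'` is the sum of the individual exponents, hence at least each `M σ`.
    intro σ
    rw [smul_mul', smul_pow', h.2 σ, ← sub_eq_zero, ← mul_sub]
    have : M' = (M' - M σ) + M σ :=
      (Nat.sub_add_cancel (Finset.single_le_sum (fun _ _ ↦ Nat.zero_le _) (Finset.mem_univ σ))).symm
    rw [this, pow_add, mul_assoc, hM, mul_zero]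
  let q : Inv k n r := ⟨(h : Coord k n r) ^ M' * p, h2⟩
  obtain ⟨w, hw⟩ := (isUnit_invSec h).pow (M' + N)
  refine ⟨↑w⁻¹ * invSec (quotD h) q, ((isUnit_coordSec h).pow (M' + N)).mul_left_cancel ?_⟩
  have hw1 : (quotMap k n r).app (quotD h) w = coordSec _ (h : Coord k n r) ^ (M' + N) := by
    rw [hw, map_pow, quotMap_invSec]
  rw [← hw1, ← map_mul, ← mul_assoc, Units.mul_inv, one_mul, quotMap_invSec, hw1, pow_add,
    mul_assoc, mul_comm (_ ^ N), hp, map_mul, map_pow]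

lemma quotMap_app_injective (O : (QuotR k n r).Opens) :
    Function.Injective ((quotMap k n r).app O) := by
  rw [injective_iff_map_eq_zero]
  intro y hy
  refine section_ext fun x hx ↦ ?_
  obtain ⟨f, hf, hfO⟩ := exists_quotD_mem_le O x hx
  refine ⟨_, hfO, hf, ?_⟩
  rw [map_zero]
  refine quotMap_app_injective_quotD f _ ?_
  rw [app_map_apply, hy, map_zero]

lemma exists_quotMap_app_eq (O : (QuotR k n r).Opens)
    (z : Γ(AffR k n r, quotMap k n r ⁻¹ᵁ O))
    (hz : ∀ σ, (actAff k n r σ).appLE _ _ (actAff_preimage_le _ σ) z = z) :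
    ∃ y, (quotMap k n r).app O y = z := by
  choose f hf hfO using fun x : O ↦ exists_quotD_mem_le O x.1 x.2
  have h1 : ∀ x : O, ∃ y, (quotMap k n r).app (quotD (f x)) y = (AffR k n r).presheaf.map
      (homOfLE ((quotMap k n r).preimage_mono (hfO x))).op z := by
    intro x
    refine exists_quotMap_app_eq_quotD _ _ fun σ ↦ ?_
    conv_rhs => rw [← hz σ]
    rw [map_appLE_apply, appLE_map_apply]
  choose y hy using h1
  obtain ⟨s, hs, -⟩ := (QuotR k n r).sheaf.existsUnique_gluing'
    (fun x ↦ quotD (f x)) O (fun x ↦ homOfLE (hfO x))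
    (fun x hx ↦ Opens.mem_iSup.2 ⟨⟨x, hx⟩, hf _⟩) y (by
      intro a b
      apply quotMap_app_injective
      have key : ∀ (c : O) (W : (QuotR k n r).Opens) (hW : W ≤ quotD (f c)),
          (quotMap k n r).app W ((QuotR k n r).presheaf.map (homOfLE hW).op (y c)) =
          (AffR k n r).presheaf.map
            (homOfLE ((quotMap k n r).preimage_mono (hW.trans (hfO c)))).op z := by
        intro c W hW
        rw [app_map_apply, hy, map_map_apply]
      exact (key a _ inf_le_left).trans (key b _ inf_le_right).symm)
  refine ⟨s, section_ext fun x hx ↦ ⟨_, (quotMap k n r).preimage_mono (hfO ⟨_, hx⟩),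
    hf ⟨quotMap k n r x, hx⟩, ?_⟩⟩
  refine (app_map_apply (quotMap k n r) (hfO ⟨quotMap k n r x, hx⟩) s).symm.trans ?_
  rw [← hy]
  exact congrArg _ (hs ⟨_, hx⟩)

end Invariants

/-! ### Morphisms to open subschemes of affine schemes -/

section SpecHom

variable {Y Z : Scheme.{u}} {R R' : CommRingCat.{u}}

/-- The morphism to an affine scheme defined by a ring homomorphism to the global sections. -/
noncomputable def specHom (ρ : R ⟶ Γ(Y, ⊤)) : Y ⟶ Spec R := Y.toSpecΓ ≫ Spec.map ρ

/-- The ring homomorphism defined by a morphism to an affine scheme. -/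
noncomputable def globalHom (f : Y ⟶ Spec R) : R ⟶ Γ(Y, ⊤) := (Scheme.ΓSpecIso R).inv ≫ f.appTop

lemma globalHom_specHom (ρ : R ⟶ Γ(Y, ⊤)) : globalHom (specHom ρ) = ρ := by
  simp [globalHom, specHom]

lemma globalHom_injective : Function.Injective (globalHom : (Y ⟶ Spec R) → _) := by
  intro f g h
  refine ext_of_isAffine ?_
  rwa [globalHom, globalHom, cancel_epi] at h

lemma globalHom_comp (g : Z ⟶ Y) (f : Y ⟶ Spec R) :
    globalHom (g ≫ f) = globalHom f ≫ g.appTop := by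
  simp [globalHom]

lemma globalHom_comp_specMap (f : Y ⟶ Spec R) (φ : R' ⟶ R) :
    globalHom (f ≫ Spec.map φ) = φ ≫ globalHom f := by
  simp [globalHom]

lemma notMem_asIdeal_iff (f : Y ⟶ Spec R) (y : Y) (p : R) :
    p ∉ (f y).asIdeal ↔ y ∈ Y.basicOpen (globalHom f p) := by
  rw [globalHom, CommRingCat.comp_apply]
  have := Scheme.preimage_basicOpen_top f ((Scheme.ΓSpecIso R).inv p)
  rw [← this]
  change _ ↔ f y ∈ (Spec R).basicOpen _
  rw [basicOpen_eq_of_affine]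
  rfl

end SpecHom

/-! ### The `S_n`-torsor `U(r; 𝔸ⁿ) ⟶ B(r; 𝔸ⁿ)` -/

section Torsor

lemma appLE_apply_of_eq_id {Y : Scheme.{u}} {g : Y ⟶ Y} (hg : g = 𝟙 Y) (W : Y.Opens)
    (e : W ≤ g ⁻¹ᵁ W) (z : Γ(Y, W)) : g.appLE W W e z = z := by
  subst hg
  exact ConcreteCategory.congr_hom (Y.presheaf.map_id (op W)) z

lemma appLE_apply_of_eq_comp {Y : Scheme.{u}} {g h l : Y ⟶ Y} (hl : l = g ≫ h) (W : Y.Opens)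
    (el : W ≤ l ⁻¹ᵁ W) (eg : W ≤ g ⁻¹ᵁ W) (eh : W ≤ h ⁻¹ᵁ W) (z : Γ(Y, W)) :
    l.appLE W W el z = g.appLE W W eg (h.appLE W W eh z) := by
  subst hl
  rw [← CommRingCat.comp_apply, Scheme.Hom.appLE_comp_appLE]

variable {k : Type u} [CommRing k] {n r : ℕ}

/-- The fibres of the quotient map are orbits and `U` is stable under the action. -/
lemma UOpens_eq_preimage : UOpens k n r = quotMap k n r ⁻¹ᵁ BOpens k n r := by
  refine le_antisymm (UOpens_le_quotMap k n r) fun p hp ↦ ?_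
  obtain ⟨q, hq, hqp⟩ := hp
  obtain ⟨σ, rfl⟩ := exists_actAff_eq hqp
  exact actAff_mem σ hq

lemma quotU_ι : quotU k n r ≫ (BOpens k n r).ι = (UOpens k n r).ι ≫ quotMap k n r :=
  Scheme.Hom.resLE_comp_ι _ _

/-- Through this, affineness of preimages and descent of invariant functions for `π` are inherited
from the ambient affine quotient map. -/
lemma image_quotU_preimage (V : (BScheme k n r).Opens) :
    (UOpens k n r).ι ''ᵁ (quotU k n r ⁻¹ᵁ V) = quotMap k n r ⁻¹ᵁ ((BOpens k n r).ι ''ᵁ V) := by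
  have hpt : ∀ p : U k n r, (quotU k n r p).1 = quotMap k n r p.1 := fun p ↦
    congrArg (fun f : U k n r ⟶ QuotR k n r ↦ f p) quotU_ι
  ext p
  constructor
  · rintro ⟨q, hq, rfl⟩
    exact ⟨quotU k n r q, hq, hpt q⟩
  · rintro ⟨b, hb, hbp⟩
    have hp : p ∈ UOpens k n r := by
      rw [UOpens_eq_preimage]
      change quotMap k n r p ∈ BOpens k n r
      rw [← hbp]
      exact b.2
    refine ⟨⟨p, hp⟩, ?_, rfl⟩
    change quotU k n r ⟨p, hp⟩ ∈ V
    have : quotU k n r ⟨p, hp⟩ = b := Subtype.ext ((hpt ⟨p, hp⟩).trans hbp.symm)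
    rwa [this]

lemma isAffineOpen_quotU_preimage {V : (BScheme k n r).Opens} (hV : IsAffineOpen V) :
    IsAffineOpen (quotU k n r ⁻¹ᵁ V) := by
  rw [← Scheme.Hom.isAffineOpen_iff_of_isOpenImmersion (UOpens k n r).ι, image_quotU_preimage]
  have : IsAffineHom (quotMap k n r) := inferInstanceAs (IsAffineHom (Spec.map _))
  exact (hV.image_of_isOpenImmersion (BOpens k n r).ι).preimage (quotMap k n r)

lemma appLE_injective_of_eq {O : (QuotR k n r).Opens} {P : (AffR k n r).Opens}
    (h : P = quotMap k n r ⁻¹ᵁ O) : Function.Injective ((quotMap k n r).appLE O P h.le) := by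
  subst h
  rw [Scheme.Hom.appLE_eq_app]
  exact quotMap_app_injective O

lemma exists_appLE_eq_of_eq {O : (QuotR k n r).Opens} {P : (AffR k n r).Opens}
    (h : P = quotMap k n r ⁻¹ᵁ O) (hP : ∀ σ, P ≤ actAff k n r σ ⁻¹ᵁ P) (z : Γ(AffR k n r, P))
    (hz : ∀ σ, (actAff k n r σ).appLE P P (hP σ) z = z) :
    ∃ y, (quotMap k n r).appLE O P h.le y = z := by
  subst h
  rw [Scheme.Hom.appLE_eq_app]
  exact exists_quotMap_app_eq O z hz

lemma quotU_app_injective (V : (BScheme k n r).Opens) :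
    Function.Injective ((quotU k n r).app V) := by
  rw [← Scheme.Hom.appLE_eq_app, quotU, Scheme.Hom.resLE_appLE]
  exact appLE_injective_of_eq (image_quotU_preimage V)

lemma exists_quotU_app_eq (V : (BScheme k n r).Opens) (z : Γ(U k n r, quotU k n r ⁻¹ᵁ V))
    (hz : ∀ σ, (actU k n r σ).appLE _ _ (preimage_le k n r σ V) z = z) :
    ∃ y, (quotU k n r).app V y = z := by
  simp only [actU, Scheme.Hom.resLE_appLE] at hz
  rw [← Scheme.Hom.appLE_eq_app]
  simp only [quotU, Scheme.Hom.resLE_appLE]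
  exact exists_appLE_eq_of_eq (image_quotU_preimage V) _ z hz

lemma actAff_one : actAff k n r 1 = 𝟙 _ := by
  rw [actAff, ← Spec.map_id]
  congr 1
  exact CommRingCat.hom_ext (RingHom.ext fun p : Coord k n r ↦ one_smul (Equiv.Perm (Fin n)) p)

lemma actAff_mul (σ τ : Equiv.Perm (Fin n)) :
    actAff k n r (σ * τ) = actAff k n r σ ≫ actAff k n r τ := by
  rw [actAff, actAff, actAff, ← Spec.map_comp]
  congr 1
  exact CommRingCat.hom_ext (RingHom.ext fun p : Coord k n r ↦ mul_smul σ τ p)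

lemma actU_one : actU k n r 1 = 𝟙 _ := by
  rw [← cancel_mono (UOpens k n r).ι, actU, Scheme.Hom.resLE_comp_ι, Category.id_comp, actAff_one,
    Category.comp_id]

lemma actU_mul (σ τ : Equiv.Perm (Fin n)) :
    actU k n r (σ * τ) = actU k n r σ ≫ actU k n r τ := by
  rw [← cancel_mono (UOpens k n r).ι, actU, actU, actU, Category.assoc, Scheme.Hom.resLE_comp_ι,
    Scheme.Hom.resLE_comp_ι, Scheme.Hom.resLE_comp_ι_assoc, actAff_mul]

/-- The action of the symmetric group on functions on `π⁻¹ V`, as a monoid homomorphism. -/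
noncomputable def permActionHom (V : (BScheme k n r).Opens) :
    Equiv.Perm (Fin n) →* (Γ(U k n r, quotU k n r ⁻¹ᵁ V) →+* Γ(U k n r, quotU k n r ⁻¹ᵁ V)) where
  toFun σ := ((actU k n r σ).appLE _ _ (preimage_le k n r σ V)).hom
  map_one' := RingHom.ext fun z ↦ appLE_apply_of_eq_id actU_one _ _ z
  map_mul' σ τ := RingHom.ext fun z ↦ appLE_apply_of_eq_comp (actU_mul σ τ) _ _ _ _ z

/-- The action of the symmetric group on functions on `π⁻¹ V`. -/
noncomputable instance permActionU (V : (BScheme k n r).Opens) :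
    MulSemiringAction (Equiv.Perm (Fin n)) Γ(U k n r, quotU k n r ⁻¹ᵁ V) :=
  MulSemiringAction.compHom _ (permActionHom V)

lemma smul_sectionU_def (V : (BScheme k n r).Opens) (σ : Equiv.Perm (Fin n))
    (z : Γ(U k n r, quotU k n r ⁻¹ᵁ V)) :
    σ • z = (actU k n r σ).appLE _ _ (preimage_le k n r σ V) z := rfl

noncomputable instance quotUAlgebra (V : (BScheme k n r).Opens) :
    Algebra Γ(BScheme k n r, V) Γ(U k n r, quotU k n r ⁻¹ᵁ V) :=
  ((quotU k n r).app V).hom.toAlgebra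

lemma algebraMap_quotU (V : (BScheme k n r).Opens) (c : Γ(BScheme k n r, V)) :
    algebraMap Γ(BScheme k n r, V) Γ(U k n r, quotU k n r ⁻¹ᵁ V) c = (quotU k n r).app V c := rfl

instance (V : (BScheme k n r).Opens) : Algebra.IsInvariant Γ(BScheme k n r, V)
    Γ(U k n r, quotU k n r ⁻¹ᵁ V) (Equiv.Perm (Fin n)) where
  isInvariant z hz := exists_quotU_app_eq V z hz

instance (V : (BScheme k n r).Opens) : SMulCommClass (Equiv.Perm (Fin n)) Γ(BScheme k n r, V)
    Γ(U k n r, quotU k n r ⁻¹ᵁ V) where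
  smul_comm σ c z := by
    rw [Algebra.smul_def, Algebra.smul_def, smul_mul', algebraMap_quotU, smul_sectionU_def,
      actU_appLE_quotU]

/-- The section over an open subset of `U(r; 𝔸ⁿ)` defined by a polynomial. -/
noncomputable def polySec (W : (U k n r).Opens) : Coord k n r →+* Γ(U k n r, W) :=
  (globalHom (R := .of (Coord k n r)) (UOpens k n r).ι ≫
    (U k n r).presheaf.map (homOfLE le_top).op).hom

/-- The section over an open subset of `B(r; 𝔸ⁿ)` defined by an invariant polynomial. -/
noncomputable def invPolySec (V : (BScheme k n r).Opens) : Inv k n r →+* Γ(BScheme k n r, V) :=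
  (globalHom (R := .of (Inv k n r)) (BOpens k n r).ι ≫
    (BScheme k n r).presheaf.map (homOfLE le_top).op).hom

lemma quotU_app_invPolySec (V : (BScheme k n r).Opens) (f : Inv k n r) :
    (quotU k n r).app V (invPolySec V f) = polySec (quotU k n r ⁻¹ᵁ V) (f : Coord k n r) := by
  have h : globalHom (R := .of (Inv k n r)) (BOpens k n r).ι ≫ (quotU k n r).appTop =
      CommRingCat.ofHom (Inv k n r).val.toRingHom ≫
        globalHom (R := .of (Coord k n r)) (UOpens k n r).ι := by
    rw [← globalHom_comp, ← globalHom_comp_specMap, quotU_ι]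
    rfl
  change (quotU k n r).app V ((BScheme k n r).presheaf.map _ _) = _
  rw [app_map_apply]
  exact congrArg _ (ConcreteCategory.congr_hom h f)

lemma isEquivariant_polySec (V : (BScheme k n r).Opens) (j : Fin r) :
    IsEquivariant fun i ↦ polySec (quotU k n r ⁻¹ᵁ V) (MvPolynomial.X (j, i)) := by
  intro σ i
  have h1 := actU_appLE_map k n r σ (le_top : V ≤ ⊤) (coordU k n r j i)
  have h2 : (actU k n r σ).appLE _ _ (preimage_le k n r σ ⊤) (coordU k n r j i) =
      coordU k n r j (σ i) :=
    (ConcreteCategory.congr_hom (Scheme.Hom.appLE_eq_app (actU k n r σ)) _).trans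
      (actU_coordU k n r σ j i)
  rw [h2] at h1
  exact h1

/-- At each point of `U` some difference `x_{li} - x_{li'}` does not vanish, so the basic opens of
these differences cover the affine open `W`. This is the freeness hypothesis used in the descent
arguments. -/
lemma span_polySec_eq_top {W : (U k n r).Opens} (hW : IsAffineOpen W) {i i' : Fin n}
    (h : i ≠ i') : Ideal.span (Set.range fun j : Fin r ↦ polySec W (MvPolynomial.X (j, i)) -
      polySec W (MvPolynomial.X (j, i'))) = ⊤ := by
  rw [← hW.self_le_iSup_basicOpen_iff]
  intro p hp
  obtain ⟨l, hl⟩ := mem_UOpens.1 p.2 i i' h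
  refine Opens.mem_iSup.2 ⟨⟨_, l, rfl⟩, ?_⟩
  have h1 := (notMem_asIdeal_iff (R := .of (Coord k n r)) (UOpens k n r).ι p _).1 hl
  change p ∈ (U k n r).basicOpen (polySec W _ - polySec W _)
  rw [← map_sub]
  change p ∈ (U k n r).basicOpen ((U k n r).presheaf.map _ _)
  rw [Scheme.basicOpen_res]
  exact ⟨hp, h1⟩

end Torsor

/-! ### Morphisms to `B(r; 𝔸ⁿ)` -/

section MapsToB

variable {k : Type u} [CommRing k] {n r : ℕ} {Y Z : Scheme.{u}}

/-- The functions obtained by pulling back invariant polynomials along a morphism to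
`B(r; 𝔸ⁿ)`. -/
noncomputable def pullInv (φ : Y ⟶ BScheme k n r) : Inv k n r →+* Γ(Y, ⊤) :=
  (globalHom (R := .of (Inv k n r)) (φ ≫ (BOpens k n r).ι)).hom

lemma pullInv_injective : Function.Injective (pullInv : (Y ⟶ BScheme k n r) → _) := by
  intro φ ψ h
  rw [← cancel_mono (BOpens k n r).ι]
  exact globalHom_injective (CommRingCat.hom_ext h)

lemma pullInv_comp (g : Z ⟶ Y) (φ : Y ⟶ BScheme k n r) (f : Inv k n r) :
    pullInv (g ≫ φ) f = g.appTop (pullInv φ f) := by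
  rw [pullInv, Category.assoc, globalHom_comp]
  rfl

lemma appLE_invPolySec (φ : Y ⟶ BScheme k n r) (V : (BScheme k n r).Opens) (W : Y.Opens)
    (e : W ≤ φ ⁻¹ᵁ V) (f : Inv k n r) :
    φ.appLE V W e (invPolySec V f) = Y.presheaf.map (homOfLE le_top).op (pullInv φ f) := by
  change φ.appLE V W e ((BScheme k n r).presheaf.map (homOfLE le_top).op _) = _
  rw [map_appLE_apply, pullInv, globalHom_comp]
  rfl

lemma exists_pullInv_eq (ρ : Inv k n r →+* Γ(Y, ⊤))
    (h : ∀ y, specHom (R := .of (Inv k n r)) (CommRingCat.ofHom ρ) y ∈ BOpens k n r) :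
    ∃ φ : Y ⟶ BScheme k n r, pullInv φ = ρ := by
  have hr : Set.range (specHom (R := .of (Inv k n r)) (CommRingCat.ofHom ρ)) ⊆
      Set.range (BOpens k n r).ι := by
    rw [Scheme.Opens.range_ι]
    rintro _ ⟨y, rfl⟩
    exact h y
  refine ⟨IsOpenImmersion.lift (BOpens k n r).ι _ hr, ?_⟩
  · rw [pullInv, IsOpenImmersion.lift_fac, globalHom_specHom]
    rfl

/-- A ring homomorphism given by the values at a generating tuple of an étale algebra defines
points of `B(r; 𝔸ⁿ)`. -/
lemma mem_BOpens_of_valueHom (f : Y ⟶ QuotR k n r) {y : Y} {O : Y.Opens} (hy : y ∈ O)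
    {C D : Type u} [CommRing C] [CommRing D] [Algebra C D] [Algebra.Etale C D]
    (e : Module.Basis (Fin n) C D) (κ : k →+* C) {b : Fin r → D}
    (hb : Algebra.adjoin C (Set.range b) = ⊤) (g : C →+* Γ(Y, O))
    (hf : ∀ q, Y.presheaf.map (homOfLE le_top).op
      (globalHom (R := .of (Inv k n r)) f q) = g (valueHom e κ b q)) : f y ∈ BOpens k n r := by
  obtain ⟨L, _, _, _, s, hs⟩ := exists_sepFamily e
  -- The closed point of the stalk at `y` gives a prime of `C`, which lifts to a prime `q` of the
  -- faithfully flat splitting ring. The matrix `s i (b j)` modulo `q` is then a point of `U` above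
  -- `f y`.
  let m : C →+* Y.presheaf.stalk y := (Y.presheaf.germ O y hy).hom.comp g
  obtain ⟨q, hq⟩ := PrimeSpectrum.comap_surjective_of_faithfullyFlat (A := C) (B := L)
    (PrimeSpectrum.comap m (IsLocalRing.closedPoint _))
  have hq' : ∀ c, algebraMap C L c ∈ q.asIdeal ↔ ¬ IsUnit (m c) := fun c ↦ by
    have := congrArg (fun p : PrimeSpectrum C ↦ c ∈ p.asIdeal) hq
    exact (iff_of_eq this).trans (IsLocalRing.mem_maximalIdeal _)
  let E := evalPt ((algebraMap C L).comp κ) fun j i ↦ s i (b j)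
  let P : AffR k n r := PrimeSpectrum.comap E q
  refine ⟨P, ?_, ?_⟩
  · refine mem_UOpens.2 ?_
    intro i i' hi
    by_contra! hc
    refine q.isPrime.ne_top (top_le_iff.1 ?_)
    rw [← (sepFamily_iff_of_adjoin hb s).1 hs i i' hi, Ideal.span_le]
    rintro _ ⟨j, rfl⟩
    have := hc j
    change E _ ∈ q.asIdeal at this
    simpa [E] using this
  · refine PrimeSpectrum.ext (SetLike.ext fun p ↦ ?_)
    change E (p : Coord k n r) ∈ q.asIdeal ↔ p ∈ (f y).asIdeal
    rw [← valueHom_isValue e κ b p L s hs, hq', ← not_iff_not, not_not,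
      notMem_asIdeal_iff (R := .of (Inv k n r)) f y p, Scheme.mem_basicOpen_top]
    change IsUnit (Y.presheaf.germ O y hy (g _)) ↔ _
    rw [← hf, TopCat.Presheaf.germ_res_apply']

/-- Each value glues by the sheaf property, and uniqueness of gluing gives compatibility with the
ring operations. Agreement is asked only near each point of an overlap, since overlaps of
trivializing opens need not be affine. -/
lemma exists_ringHom_gluing {R : Type*} [CommRing R] {I : Type*} (W : I → Y.Opens)
    (hW : ∀ y, ∃ i, y ∈ W i) (v : ∀ i, R →+* Γ(Y, W i))
    (hv : ∀ i j, ∀ y ∈ W i, y ∈ W j → ∃ (O : Y.Opens) (hi : O ≤ W i) (hj : O ≤ W j), y ∈ O ∧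
      ∀ f, Y.presheaf.map (homOfLE hi).op (v i f) = Y.presheaf.map (homOfLE hj).op (v j f)) :
    ∃ ρ : R →+* Γ(Y, ⊤), ∀ i f, Y.presheaf.map (homOfLE le_top).op (ρ f) = v i f := by
  have h1 : ∀ f, ∃ s : Γ(Y, ⊤), ∀ i, Y.presheaf.map (homOfLE le_top).op s = v i f := by
    intro f
    obtain ⟨s, hs, -⟩ := Y.sheaf.existsUnique_gluing' W ⊤ (fun i ↦ homOfLE le_top)
      (fun y _ ↦ Opens.mem_iSup.2 (hW y)) (fun i ↦ v i f) (by
        intro i j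
        refine section_ext fun y hy ↦ ?_
        obtain ⟨O, hi, hj, hyO, hO⟩ := hv i j y hy.1 hy.2
        refine ⟨O, le_inf hi hj, hyO, ?_⟩
        exact (map_map_apply _ _ _).trans ((hO f).trans (map_map_apply _ _ _).symm))
    exact ⟨s, hs⟩
  choose ρ hρ using h1
  have hext : ∀ s t : Γ(Y, ⊤), (∀ i, Y.presheaf.map (homOfLE (le_top : W i ≤ ⊤)).op s =
      Y.presheaf.map (homOfLE le_top).op t) → s = t := fun s t h ↦ section_ext fun y _ ↦ by
    obtain ⟨i, hi⟩ := hW y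
    exact ⟨W i, le_top, hi, h i⟩
  exact ⟨
    { toFun := ρ
      map_one' := hext _ _ fun i ↦ by rw [hρ, map_one, map_one]
      map_zero' := hext _ _ fun i ↦ by rw [hρ, map_zero, map_zero]
      map_mul' := fun f g ↦ hext _ _ fun i ↦ by rw [hρ, map_mul, map_mul, hρ, hρ]
      map_add' := fun f g ↦ hext _ _ fun i ↦ by rw [hρ, map_add, map_add, hρ, hρ] },
    fun i f ↦ hρ f i⟩

end MapsToB

/-! ### Morphisms to `B(r; 𝔸ⁿ)` over the base ring -/

section OverB

variable {k : Type u} [CommRing k] {n r : ℕ} {X : Over (Spec (.of k))}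

/-- The structure homomorphism from the base ring to the sections over an open subset. -/
noncomputable def baseSec (X : Over (Spec (.of k))) (W : X.left.Opens) : k →+* Γ(X.left, W) :=
  (globalHom (R := .of k) X.hom ≫ X.left.presheaf.map (homOfLE le_top).op).hom

lemma baseSec_map {W W' : X.left.Opens} (h : W' ≤ W) (c : k) :
    X.left.presheaf.map (homOfLE h).op (baseSec X W c) = baseSec X W' c :=
  map_map_apply _ _ _

lemma pullInv_algebraMap (φ : X ⟶ B k n r) (c : k) :
    pullInv φ.left (algebraMap k (Inv k n r) c) = baseSec X ⊤ c := by
  have h1 : ((show X.left ⟶ BScheme k n r from φ.left) ≫ (BOpens k n r).ι) ≫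
      Spec.map (CommRingCat.ofHom (algebraMap k (Inv k n r))) = X.hom :=
    (Category.assoc _ _ _).trans (Over.w φ)
  have h2 := congrArg (globalHom (R := .of k)) h1
  rw [globalHom_comp_specMap] at h2
  have h3 := ConcreteCategory.congr_hom h2 c
  refine h3.trans ?_
  exact (ConcreteCategory.congr_hom (X.left.presheaf.map_id (op ⊤)) _).symm

lemma exists_over_hom (ρ : Inv k n r →+* Γ(X.left, ⊤))
    (h : ∀ y, specHom (R := .of (Inv k n r)) (CommRingCat.ofHom ρ) y ∈ BOpens k n r)
    (hk : ∀ c, ρ (algebraMap k (Inv k n r) c) = baseSec X ⊤ c) :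
    ∃ φ : X ⟶ B k n r, pullInv φ.left = ρ := by
  obtain ⟨φ, hφ⟩ := exists_pullInv_eq ρ h
  refine ⟨Over.homMk φ ?_, hφ⟩
  change φ ≫ (BOpens k n r).ι ≫ Spec.map _ = _
  refine globalHom_injective (R := .of k) ?_
  rw [← Category.assoc, globalHom_comp_specMap]
  refine CommRingCat.hom_ext (RingHom.ext fun c ↦ ?_)
  change pullInv φ (algebraMap k (Inv k n r) c) = _
  rw [hφ, hk]
  exact ConcreteCategory.congr_hom (X.left.presheaf.map_id (op ⊤)) _

lemma over_hom_ext {φ ψ : X ⟶ B k n r} (h : pullInv φ.left = pullInv ψ.left) : φ = ψ :=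
  Over.OverMorphism.ext (pullInv_injective h)

/-- Morphisms to `B(r; 𝔸ⁿ)` can be constructed locally from generating tuples of étale
algebras. -/
lemma exists_over_hom_of_valueHom {I : Type*} (W : I → X.left.Opens) (hW : ∀ y, ∃ i, y ∈ W i)
    (C D : I → Type u) [∀ i, CommRing (C i)] [∀ i, CommRing (D i)] [∀ i, Algebra (C i) (D i)]
    [∀ i, Algebra.Etale (C i) (D i)] (e : ∀ i, Module.Basis (Fin n) (C i) (D i))
    (κ : ∀ i, k →+* C i) (b : ∀ i, Fin r → D i)
    (hb : ∀ i, Algebra.adjoin (C i) (Set.range (b i)) = ⊤) (g : ∀ i, C i →+* Γ(X.left, W i))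
    (hk : ∀ i c, g i (κ i c) = baseSec X (W i) c)
    (hv : ∀ i j, ∀ y ∈ W i, y ∈ W j →
      ∃ (O : X.left.Opens) (hi : O ≤ W i) (hj : O ≤ W j), y ∈ O ∧ ∀ f : Inv k n r,
        X.left.presheaf.map (homOfLE hi).op (g i (valueHom (e i) (κ i) (b i) f)) =
          X.left.presheaf.map (homOfLE hj).op (g j (valueHom (e j) (κ j) (b j) f))) :
    ∃ φ : X ⟶ B k n r, ∀ i f, X.left.presheaf.map (homOfLE le_top).op (pullInv φ.left f) =
      g i (valueHom (e i) (κ i) (b i) f) := by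
  obtain ⟨ρ, hρ⟩ := exists_ringHom_gluing W hW
    (fun i ↦ (g i).comp (valueHom (e i) (κ i) (b i))) hv
  obtain ⟨φ, hφ⟩ := exists_over_hom ρ (fun y ↦ by
    obtain ⟨i, hi⟩ := hW y
    refine mem_BOpens_of_valueHom _ hi (e i) (κ i) (hb i) (g i) fun q ↦ ?_
    rw [globalHom_specHom]
    exact hρ i q) (fun c ↦ section_ext fun y _ ↦ by
    obtain ⟨i, hi⟩ := hW y
    refine ⟨W i, le_top, hi, ?_⟩
    rw [hρ, baseSec_map, ← hk]
    refine congrArg (g i) (IsValue.unique (e i) (valueHom_isValue (e i) (κ i) (b i) _)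
      fun L _ _ s _ ↦ ?_)
    exact (evalPt_C ((algebraMap (C i) L).comp (κ i)) _ c).symm)
  exact ⟨φ, fun i f ↦ by rw [hφ]; exact hρ i f⟩

end OverB

/-! ### Good opens -/

namespace EtaleGen.AlgSheaf

variable {X : Scheme.{u}} (A : AlgSheaf X)

lemma res_res {U V W : X.Opens} (h : V ≤ U) (h' : W ≤ V) (s : A.sec U) :
    A.res h' (A.res h s) = A.res (h'.trans h) s := by
  rw [res, res, ← CommRingCat.comp_apply, ← Functor.map_comp]
  rfl

lemma res_algebraMap {U V : X.Opens} (h : V ≤ U) (c : Γ(X, U)) :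
    A.res h (algebraMap Γ(X, U) (A.sec U) c) =
      algebraMap Γ(X, V) (A.sec V) (X.presheaf.map (homOfLE h).op c) :=
  (ConcreteCategory.congr_hom (A.unit.hom.naturality (homOfLE h).op) c).symm

lemma res_smul {U V : X.Opens} (h : V ≤ U) (c : Γ(X, U)) (s : A.sec U) :
    A.res h (c • s) = X.presheaf.map (homOfLE h).op c • A.res h s := by
  rw [Algebra.smul_def, Algebra.smul_def, map_mul, res_algebraMap]

lemma sec_ext {U : X.Opens} {s t : A.sec U}
    (h : ∀ x ∈ U, ∃ (V : X.Opens) (hV : V ≤ U), x ∈ V ∧ A.res hV s = A.res hV t) : s = t := by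
  choose V hV hx hst using h
  exact A.sheaf.eq_of_locally_eq' (fun x : U ↦ V x.1 x.2) U (fun x ↦ homOfLE (hV _ _))
    (fun x hxU ↦ Opens.mem_iSup.2 ⟨⟨x, hxU⟩, hx _ _⟩) s t fun x ↦ hst _ _

/-- An affine open over which the algebra is free. -/
structure IsTrivializing (n : ℕ) (W : X.Opens) : Prop where
  isAffineOpen : IsAffineOpen W
  exists_basis : ∃ e : Fin n → A.sec W, ∀ (W' : X.Opens) (h : W' ≤ W),
    Function.Bijective fun c : Fin n → Γ(X, W') ↦ ∑ i, c i • A.res h (e i)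

variable {A} {n : ℕ}

lemma IsTrivializing.of_le {W W' : X.Opens} (hW : A.IsTrivializing n W) (h : W' ≤ W)
    (hW' : IsAffineOpen W') : A.IsTrivializing n W' := by
  obtain ⟨e, he⟩ := hW.exists_basis
  refine ⟨hW', fun i ↦ A.res h (e i), fun W'' h' ↦ ?_⟩
  simpa only [res_res] using he W'' (h'.trans h)

lemma IsEtaleOfDegree.exists_isTrivializing (hA : A.IsEtaleOfDegree n) {x : X} {O : X.Opens}
    (hx : x ∈ O) : ∃ W, A.IsTrivializing n W ∧ x ∈ W ∧ W ≤ O := by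
  obtain ⟨V, e, hxV, he⟩ := hA.locallyFree x
  obtain ⟨_, ⟨W, hW, rfl⟩, hxW, hWV⟩ :=
    X.isBasis_affineOpens.exists_subset_of_mem_open (show x ∈ V ⊓ O from ⟨hxV, hx⟩) (V ⊓ O).isOpen
  have hWV' : W ≤ V ⊓ O := hWV
  refine ⟨W, ⟨hW, fun i ↦ A.res (hWV'.trans inf_le_left) (e i), fun W' h ↦ ?_⟩, hxW,
    hWV'.trans inf_le_right⟩
  simpa only [res_res] using he W' (h.trans (hWV'.trans inf_le_left))

/-- A basis of the sections over a trivializing open. -/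
noncomputable def IsTrivializing.basis {W : X.Opens} (hW : A.IsTrivializing n W) :
    Module.Basis (Fin n) Γ(X, W) (A.sec W) :=
  .ofEquivFun (LinearEquiv.ofBijective
    (Fintype.linearCombination Γ(X, W) hW.exists_basis.choose) (by
    have h := hW.exists_basis.choose_spec W le_rfl
    have h' : ∀ s : A.sec W, A.res le_rfl s = s := fun s ↦
      ConcreteCategory.congr_hom (A.sheaf.obj.map_id (op W)) s
    simp only [h'] at h
    exact h)).symm

/-- The restricted basis spans. This is the generation hypothesis of `IsValue.map` for restriction
maps. -/
lemma IsTrivializing.adjoin_range_res {W W' : X.Opens} (hW : A.IsTrivializing n W) (h : W' ≤ W) :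
    Algebra.adjoin Γ(X, W') (Set.range (A.res h).hom) = ⊤ := by
  obtain ⟨e, he⟩ := hW.exists_basis
  rw [eq_top_iff]
  rintro s -
  obtain ⟨c, rfl⟩ := (he W' h).2 s
  exact sum_mem fun i _ ↦ Subalgebra.smul_mem _ (Algebra.subset_adjoin (Set.mem_range_self (e i))) _

end EtaleGen.AlgSheaf

/-! ### Padding of tuples -/

/-- The tuple of length `R` obtained by putting zeros at the end. -/
def padTuple {A : Type*} [Zero A] {r : ℕ} (R : ℕ) (a : Fin r → A) : Fin R → A :=
  fun j ↦ if h : j.1 < r then a ⟨j, h⟩ else 0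

/-- The tuple of length `r + r'` obtained by putting `r` zeros at the beginning. -/
def shiftTuple {A : Type*} [Zero A] (r : ℕ) {r' : ℕ} (a : Fin r' → A) : Fin (r + r') → A :=
  fun j ↦ if h : r ≤ j.1 then a ⟨j.1 - r, by omega⟩ else 0

lemma map_padTuple {A A' F : Type*} [Zero A] [Zero A'] [FunLike F A A'] [ZeroHomClass F A A']
    {r : ℕ} (R : ℕ) (a : Fin r → A) (f : F) (j : Fin R) :
    f (padTuple R a j) = padTuple R (fun j ↦ f (a j)) j := by
  unfold padTuple
  split_ifs <;> simp

lemma map_shiftTuple {A A' F : Type*} [Zero A] [Zero A'] [FunLike F A A'] [ZeroHomClass F A A']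
    (r : ℕ) {r' : ℕ} (a : Fin r' → A) (f : F) (j : Fin (r + r')) :
    f (shiftTuple r a j) = shiftTuple r (fun j ↦ f (a j)) j := by
  unfold shiftTuple
  split_ifs <;> simp

/-! ### Morphisms computing multisymmetric functions of a tuple of sections -/

section Computes

open AlgSheaf

variable {k : Type u} [CommRing k] {n r : ℕ} {X Y : Over (Spec (.of k))}

lemma appLE_baseSec (φ : X ⟶ Y) {V : Y.left.Opens} {W : X.left.Opens} (e : W ≤ φ.left ⁻¹ᵁ V)
    (c : k) : φ.left.appLE V W e (baseSec Y V c) = baseSec X W c := by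
  change φ.left.appLE V W e (Y.left.presheaf.map (homOfLE le_top).op _) =
    X.left.presheaf.map _ (globalHom (R := .of k) X.hom c)
  rw [map_appLE_apply, ← Over.w φ, globalHom_comp]
  rfl

variable {A : AlgSheaf X.left}

lemma IsValue.res {W W' : X.left.Opens} (hW : A.IsTrivializing n W) (h : W' ≤ W)
    {a : Fin r → A.sec W} {f : Inv k n r} {x : Γ(X.left, W)}
    (hx : IsValue (baseSec X W) a (f : Coord k n r) x) :
    IsValue (baseSec X W') (fun j ↦ A.res h (a j)) (f : Coord k n r)
      (X.left.presheaf.map (homOfLE h).op x) := by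
  have h1 := hx.map (X.left.presheaf.map (homOfLE h).op).hom (A.res h).hom
    (A.res_algebraMap h) (hW.adjoin_range_res h)
  have h2 : (X.left.presheaf.map (homOfLE h).op).hom.comp (baseSec X W) = baseSec X W' :=
    RingHom.ext (baseSec_map h)
  rw [h2] at h1
  exact h1

/-- A value over `W` exists in any case; by uniqueness over the smaller opens it coincides locally,
hence globally, with `x`. -/
lemma EtaleGen.AlgSheaf.IsEtaleOfDegree.isValue_of_local (hA : A.IsEtaleOfDegree n)
    {W : X.left.Opens} (hW : A.IsTrivializing n W) {a : Fin r → A.sec W}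
    {f : Inv k n r} {x : Γ(X.left, W)}
    (h : ∀ y ∈ W, ∃ (W' : X.left.Opens) (hW' : W' ≤ W), y ∈ W' ∧ A.IsTrivializing n W' ∧
      IsValue (baseSec X W') (fun j ↦ A.res hW' (a j)) (f : Coord k n r)
        (X.left.presheaf.map (homOfLE hW').op x)) :
    IsValue (baseSec X W) a (f : Coord k n r) x := by
  have := hA.etale W hW.isAffineOpen
  obtain ⟨x', hx'⟩ := exists_isValue hW.basis (baseSec X W) a f
  have : x = x' := section_ext fun y hy ↦ by
    obtain ⟨W', hW', hyW', hgood, hval⟩ := h y hy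
    have := hA.etale W' hgood.isAffineOpen
    exact ⟨W', hW', hyW', hval.unique hgood.basis (hx'.res hW hW')⟩
  rwa [this]

/-- The pullbacks of invariant polynomials along `φ` are the values of these polynomials at the
tuple `a`. -/
def Computes (φ : X ⟶ B k n r) (A : AlgSheaf X.left) (a : Fin r → A.sec ⊤) : Prop :=
  ∀ W, A.IsTrivializing n W → ∀ f : Inv k n r,
    IsValue (baseSec X W) (fun j ↦ A.res (le_top : W ≤ ⊤) (a j)) (f : Coord k n r)
      (X.left.presheaf.map (homOfLE le_top).op (pullInv φ.left f))

/-- A morphism to `B` is determined by its pullbacks of invariant polynomials, and these are locally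
determined as values. -/
lemma Computes.eq (hA : A.IsEtaleOfDegree n) {φ ψ : X ⟶ B k n r} {a : Fin r → A.sec ⊤}
    (hφ : Computes φ A a) (hψ : Computes ψ A a) : φ = ψ := by
  refine over_hom_ext (RingHom.ext fun f ↦ section_ext fun y hy ↦ ?_)
  obtain ⟨W, hW, hyW, -⟩ := hA.exists_isTrivializing hy
  have := hA.etale W hW.isAffineOpen
  exact ⟨W, le_top, hyW, (hφ W hW f).unique hW.basis (hψ W hW f)⟩

/-- The homomorphisms `valueHom` over trivializing opens glue because values restrict and are
unique; generation makes the resulting map land in `B`. -/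
lemma exists_computes (hA : A.IsEtaleOfDegree n) {a : Fin r → A.sec ⊤} (ha : A.Generates a) :
    ∃ φ : X ⟶ B k n r, Computes φ A a := by
  let I := {W : X.left.Opens // A.IsTrivializing n W}
  have hE : ∀ i : I, Algebra.Etale Γ(X.left, i.1) (A.sec i.1) :=
    fun i ↦ hA.etale i.1 i.2.isAffineOpen
  obtain ⟨φ, hφ⟩ := exists_over_hom_of_valueHom (X := X) (n := n) (r := r) (I := I) (fun i ↦ i.1)
    (fun y ↦ by
      obtain ⟨W, hW, hyW, -⟩ := hA.exists_isTrivializing (Opens.mem_top y)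
      exact ⟨⟨W, hW⟩, hyW⟩)
    (fun i ↦ Γ(X.left, i.1)) (fun i ↦ A.sec i.1) (fun i ↦ i.2.basis) (fun i ↦ baseSec X i.1)
    (fun i j ↦ A.res le_top (a j)) (fun i ↦ ha _ i.2.isAffineOpen) (fun i ↦ RingHom.id _)
    (fun i c ↦ rfl) (fun i j y hi hj ↦ by
      obtain ⟨W, hW, hyW, hWO⟩ := hA.exists_isTrivializing (O := i.1 ⊓ j.1) ⟨hi, hj⟩
      have := hA.etale W hW.isAffineOpen
      refine ⟨W, hWO.trans inf_le_left, hWO.trans inf_le_right, hyW, fun f ↦ ?_⟩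
      have h1 := (valueHom_isValue i.2.basis (baseSec X i.1)
        (fun j ↦ A.res le_top (a j)) f).res i.2 (hWO.trans inf_le_left)
      have h2 := (valueHom_isValue j.2.basis (baseSec X j.1)
        (fun j ↦ A.res le_top (a j)) f).res j.2 (hWO.trans inf_le_right)
      simp only [res_res] at h1 h2
      exact h1.unique hW.basis h2)
  refine ⟨φ, fun W hW f ↦ ?_⟩
  have := hA.etale W hW.isAffineOpen
  rw [hφ ⟨W, hW⟩]
  exact valueHom_isValue hW.basis _ _ f

lemma pullInv_eq_padInv {Y : Scheme.{u}} {R : ℕ} {ψ : Y ⟶ BScheme k n R}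
    {φ : Y ⟶ BScheme k n r}
    (h : ψ ≫ (BOpens k n R).ι = (φ ≫ (BOpens k n r).ι) ≫ stabQuot k n r R) (f : Inv k n R) :
    pullInv ψ f = pullInv φ (padInv k n r R f) := by
  have h1 : globalHom (R := .of (Inv k n R)) (ψ ≫ (BOpens k n R).ι) =
      CommRingCat.ofHom (padInv k n r R).toRingHom ≫
        globalHom (R := .of (Inv k n r)) (φ ≫ (BOpens k n r).ι) := by
    rw [h, stabQuot, globalHom_comp_specMap]
  rw [pullInv, h1]
  rfl

lemma pullInv_comp_stab {R : ℕ} (h : r ≤ R) (φ : X ⟶ B k n r) (f : Inv k n R) :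
    pullInv (φ ≫ stab k n h).left f = pullInv φ.left (padInv k n r R f) := by
  refine pullInv_eq_padInv (φ := φ.left) ?_ f
  let s : BScheme k n r ⟶ BScheme k n R := (stabQuot k n r R).resLE (BOpens k n R) (BOpens k n r)
    (BOpens_le_stabQuot k n h)
  have h1 : s ≫ (BOpens k n R).ι = (BOpens k n r).ι ≫ stabQuot k n r R :=
    Scheme.Hom.resLE_comp_ι _ _
  have h2 : ∀ ψ : X.left ⟶ BScheme k n r, (ψ ≫ s) ≫ (BOpens k n R).ι =
      (ψ ≫ (BOpens k n r).ι) ≫ stabQuot k n r R := fun ψ ↦ by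
    rw [Category.assoc, h1, Category.assoc]
  exact h2 φ.left

/-- The comorphism of padding sends the extra coordinates to zero, so evaluating after it at `a` is
evaluating at the padded tuple. -/
lemma Computes.comp_stab {R : ℕ} (h : r ≤ R) {φ : X ⟶ B k n r} {a : Fin r → A.sec ⊤}
    (hφ : Computes φ A a) : Computes (φ ≫ stab k n h) A (padTuple R a) := by
  intro W hW f L _ _ s hs
  have h1 : pullInv (φ ≫ stab k n h).left f = pullInv φ.left (padInv k n r R f) :=
    pullInv_comp_stab h φ f
  rw [h1, hφ W hW _ L s hs]
  have h2 : (evalPt ((algebraMap Γ(X.left, W) L).comp (baseSec X W))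
      fun j i ↦ s i (A.res le_top (a j))).comp (padHom k n r R).toRingHom =
      evalPt ((algebraMap Γ(X.left, W) L).comp (baseSec X W)) fun j i ↦
        s i (A.res le_top (padTuple R a j)) := by
    refine coord_ringHom_ext (fun c ↦ ?_) fun j i ↦ ?_
    · simp [padHom, MvPolynomial.algebraMap_eq]
    · simp only [AlgHom.toRingHom_eq_coe, RingHom.coe_comp, RingHom.coe_coe, padHom,
        Function.comp_apply, MvPolynomial.aeval_X, evalPt_X, padTuple]
      split_ifs <;> simp
  exact RingHom.congr_fun h2 f

lemma Computes.of_isIsomorphic {A' : AlgSheaf X.left} (hA : A.IsEtaleOfDegree n)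
    (hA' : A'.IsEtaleOfDegree n) {α : A.sheaf ≅ A'.sheaf} (hα : A.unit ≫ α.hom = A'.unit)
    {φ : X ⟶ B k n r} {a' : Fin r → A'.sec ⊤} (hφ : Computes φ A' a') :
    Computes φ A fun j ↦ α.inv.hom.app (op ⊤) (a' j) := by
  have hα' : A'.unit ≫ α.inv = A.unit := by
    rw [← hα, Category.assoc, Iso.hom_inv_id, Category.comp_id]
  have hinv : ∀ (W : X.left.Opens) (z : A.sec W),
      α.inv.hom.app (op W) (α.hom.hom.app (op W) z) = z := fun W z ↦ by
    have := congrArg (fun f : A.sheaf ⟶ A.sheaf ↦ f.hom.app (op W) z) α.hom_inv_id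
    exact this
  intro W hW f
  refine hA.isValue_of_local hW fun y hy ↦ ?_
  -- Passing to a smaller open that trivializes `A'`, hence both algebras, makes the hypothesis on
  -- `A'` applicable.
  obtain ⟨W', hW', hyW', hle⟩ := hA'.exists_isTrivializing hy
  refine ⟨W', hle, hyW', hW.of_le hle hW'.isAffineOpen, ?_⟩
  have h1 := (hφ W' hW' f).map (RingHom.id _) (α.inv.hom.app (op W')).hom (fun c ↦ by
    have := congrArg (fun f : X.left.sheaf ⟶ A.sheaf ↦ f.hom.app (op W') c) hα'
    exact this) (by
    rw [eq_top_iff]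
    exact fun z _ ↦ Algebra.subset_adjoin ⟨α.hom.hom.app (op W') z, hinv W' z⟩)
  rw [map_map_apply]
  simp only [res_res]
  have h2 : ∀ j, A.res (le_top : W' ≤ ⊤) (α.inv.hom.app (op ⊤) (a' j)) =
      α.inv.hom.app (op W') (A'.res le_top (a' j)) := fun j ↦
    (ConcreteCategory.congr_hom (α.inv.hom.naturality (homOfLE (le_top : W' ≤ ⊤)).op) (a' j)).symm
  simp only [h2]
  exact h1

end Computes

/-! ### Homotopies along paths of generating tuples -/

section Path

open AlgSheaf Polynomial TensorProduct

attribute [local instance] Polynomial.algebra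

/-- The tuple `x + t (y - x)` over the polynomial ring in `t`. -/
noncomputable def pathTuple {A : Type*} [CommRing A] {r : ℕ} (x y : Fin r → A) : Fin r → A[X] :=
  fun j ↦ C (x j) + X * C (y j - x j)

/-- `A[X]` is the base change of `A` along `R → R[X]`. -/
lemma etale_polynomial {R A : Type u} [CommRing R] [CommRing A] [Algebra R A] [Algebra.Etale R A] :
    Algebra.Etale R[X] A[X] :=
  Algebra.Etale.of_equiv (Algebra.IsPushout.equiv R R[X] A A[X])

/-- The basis of the polynomial ring over an algebra induced by a basis of the algebra. -/
noncomputable def polynomialBasis {R A ι : Type*} [CommRing R] [CommRing A] [Algebra R A]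
    (e : Module.Basis ι R A) : Module.Basis ι R[X] A[X] :=
  (e.baseChange R[X]).map (Algebra.IsPushout.equiv R R[X] A A[X]).toLinearEquiv

section Generation

variable {R A : Type*} [CommRing R] [CommRing A] [Algebra R A]

lemma X_mem_subalgebra (Q : Subalgebra R[X] A[X]) : (X : A[X]) ∈ Q := by
  have : (X : A[X]) = algebraMap R[X] A[X] X := by rw [algebraMap_def, coe_mapRingHom, map_X]
  rw [this]
  exact Subalgebra.algebraMap_mem _ _

/-- The variable and the constants from `R` come from `R[X]`, so only the generators of `A` have to
be found in `Q`. Generation along a path thus reduces to recovering the entries of one generating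
tuple. -/
lemma polynomial_subalgebra_eq_top {κ : Type*} {a : κ → A}
    (ha : Algebra.adjoin R (Set.range a) = ⊤) {Q : Subalgebra R[X] A[X]}
    (hQ : ∀ j, C (a j) ∈ Q) : Q = ⊤ := by
  rw [eq_top_iff]
  rintro P -
  have hC : ∀ s : A, C s ∈ Q := by
    intro s
    have hs : s ∈ Algebra.adjoin R (Set.range a) := by rw [ha]; trivial
    induction hs using Algebra.adjoin_induction with
    | mem s hs =>
      obtain ⟨j, rfl⟩ := hs
      exact hQ j
    | algebraMap c =>
      have : C (algebraMap R A c) = algebraMap R[X] A[X] (C c) := by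
        rw [algebraMap_def, coe_mapRingHom, map_C]
      rw [this]
      exact Subalgebra.algebraMap_mem _ _
    | add s t _ _ hs ht => rw [C_add]; exact add_mem hs ht
    | mul s t _ _ hs ht => rw [C_mul]; exact mul_mem hs ht
  induction P using Polynomial.induction_on' with
  | add P Q hP hQ => exact add_mem hP hQ
  | monomial m s =>
    rw [← C_mul_X_pow_eq_monomial]
    exact mul_mem (hC s) (pow_mem (X_mem_subalgebra Q) m)

end Generation

variable {k : Type u} [CommRing k] {n r : ℕ} {X : Over (Spec (.of k))}

/-- The coordinate function on `X × 𝔸¹`. -/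
noncomputable def coordA1 (X : Over (Spec (.of k))) : Γ((timesA1 X).left, ⊤) :=
  AffineSpace.coord X.left PUnit.unit

lemma sectionA1_projA1 (c : Γ(X.left, ⊤)) : sectionA1 X c ≫ projA1 X = 𝟙 X :=
  Over.OverMorphism.ext (AffineSpace.homOfVector_over (𝟙 X.left) fun _ : PUnit.{u + 1} ↦ c)

lemma sectionA1_appTop_coordA1 (c : Γ(X.left, ⊤)) :
    (sectionA1 X c).left.appTop (coordA1 X) = c :=
  AffineSpace.homOfVector_appTop_coord (𝟙 X.left) (fun _ : PUnit.{u + 1} ↦ c) PUnit.unit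

/-- The sections of `X × 𝔸¹` over the preimage of an open subset `W` of `X` which are polynomials
in the coordinate over the ring of sections over `W`. -/
noncomputable def polyA1 (W : X.left.Opens) :
    Γ(X.left, W)[X] →+* Γ((timesA1 X).left, (projA1 X).left ⁻¹ᵁ W) :=
  eval₂RingHom ((projA1 X).left.app W).hom
    ((timesA1 X).left.presheaf.map (homOfLE le_top).op (coordA1 X))

lemma polyA1_map {W W' : X.left.Opens} (h : W' ≤ W) (P : Γ(X.left, W)[X]) :
    (timesA1 X).left.presheaf.map (homOfLE ((projA1 X).left.preimage_mono h)).op (polyA1 W P) =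
      polyA1 W' (P.map (X.left.presheaf.map (homOfLE h).op).hom) := by
  have : ((timesA1 X).left.presheaf.map (homOfLE ((projA1 X).left.preimage_mono h)).op).hom.comp
      (polyA1 W) = (polyA1 W').comp (mapRingHom (X.left.presheaf.map (homOfLE h).op).hom) := by
    refine Polynomial.ringHom_ext (fun c ↦ ?_) ?_
    · simp only [polyA1, RingHom.comp_apply, coe_eval₂RingHom, eval₂_C, coe_mapRingHom, map_C]
      exact (app_map_apply _ _ _).symm
    · simp only [polyA1, RingHom.comp_apply, coe_eval₂RingHom, eval₂_X, coe_mapRingHom, map_X]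
      exact map_map_apply _ _ _
  exact RingHom.congr_fun this P

lemma le_sectionA1_preimage (c : Γ(X.left, ⊤)) (W : X.left.Opens) :
    W ≤ (sectionA1 X c).left ⁻¹ᵁ ((projA1 X).left ⁻¹ᵁ W) := by
  have h : (sectionA1 X c).left ≫ (projA1 X).left = 𝟙 X.left :=
    congrArg (fun f : X ⟶ X ↦ f.left) (sectionA1_projA1 c)
  rw [← Scheme.Hom.comp_preimage, h]
  rfl

lemma sectionA1_appLE_app (c : Γ(X.left, ⊤)) (W : X.left.Opens) (x : Γ(X.left, W)) :
    (sectionA1 X c).left.appLE _ W (le_sectionA1_preimage c W) ((projA1 X).left.app W x) = x := by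
  have h : (sectionA1 X c).left ≫ (projA1 X).left = 𝟙 X.left :=
    congrArg (fun f : X ⟶ X ↦ f.left) (sectionA1_projA1 c)
  have h1 := Scheme.Hom.comp_appLE (sectionA1 X c).left (projA1 X).left W W
    (le_sectionA1_preimage c W)
  refine (ConcreteCategory.congr_hom h1 x).symm.trans ?_
  exact appLE_apply_of_eq_id h W _ x

lemma sectionA1_appLE_polyA1 (c : Γ(X.left, ⊤)) (W : X.left.Opens) (P : Γ(X.left, W)[X]) :
    (sectionA1 X c).left.appLE _ W (le_sectionA1_preimage c W) (polyA1 W P) =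
      P.eval (X.left.presheaf.map (homOfLE le_top).op c) := by
  have : ((sectionA1 X c).left.appLE _ W (le_sectionA1_preimage c W)).hom.comp (polyA1 W) =
      evalRingHom (X.left.presheaf.map (homOfLE le_top).op c) := by
    refine Polynomial.ringHom_ext (fun x ↦ ?_) ?_
    · simp only [polyA1, RingHom.comp_apply, coe_eval₂RingHom, eval₂_C, coe_evalRingHom, eval_C]
      exact sectionA1_appLE_app c W x
    · simp only [polyA1, RingHom.comp_apply, coe_eval₂RingHom, eval₂_X, coe_evalRingHom, eval_X]
      refine (map_appLE_apply _ _ _ _).trans ?_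
      conv_rhs => rw [← sectionA1_appTop_coordA1 c]
      exact (appLE_map_apply (sectionA1 X c).left (U := ⊤) le_rfl le_top (coordA1 X)).symm.trans
        (by rw [Scheme.Hom.appLE_eq_app]; rfl)
  exact RingHom.congr_fun this P

lemma map_pathTuple {A A' : Type*} [CommRing A] [CommRing A'] (h : A →+* A') (x y : Fin r → A)
    (j : Fin r) : (pathTuple x y j).map h = pathTuple (fun j ↦ h (x j)) (fun j ↦ h (y j)) j := by
  simp [pathTuple]

variable {A : AlgSheaf X.left}

/-- Over a trivializing `W` the path is a generating tuple of the étale `Γ(W)[t]`-algebra `A(W)[t]`.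
Its values are polynomials, which `polyA1` turns into functions on `W × 𝔸¹`; these define `H`, and
no sheaf of algebras on `X × 𝔸¹` is needed. Setting `t = c` is a base change of values. -/
lemma exists_homotopy (hA : A.IsEtaleOfDegree n) {x y : Fin r → A.sec ⊤}
    (hgen : ∀ W, A.IsTrivializing n W → Algebra.adjoin Γ(X.left, W)[X] (Set.range
      (pathTuple (fun j ↦ A.res (le_top : W ≤ ⊤) (x j)) fun j ↦ A.res le_top (y j))) = ⊤) :
    ∃ H : timesA1 X ⟶ B k n r, ∀ c : Γ(X.left, ⊤),
      Computes (sectionA1 X c ≫ H) A fun j ↦ x j + c • (y j - x j) := by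
  let I := {W : X.left.Opens // A.IsTrivializing n W}
  let p := (projA1 X).left
  have hE : ∀ W, A.IsTrivializing n W → Algebra.Etale Γ(X.left, W)[X] (A.sec W)[X] :=
    fun W hW ↦ by
      have := hA.etale W hW.isAffineOpen
      exact etale_polynomial
  have hE' : ∀ i : I, Algebra.Etale Γ(X.left, i.1)[X] (A.sec i.1)[X] := fun i ↦ hE i.1 i.2
  let κ : ∀ W, k →+* Γ(X.left, W)[X] := fun W ↦ C.comp (baseSec X W)
  let b : ∀ W, Fin r → (A.sec W)[X] := fun W ↦
    pathTuple (fun j ↦ A.res (le_top : W ≤ ⊤) (x j)) fun j ↦ A.res le_top (y j)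
  have hres : ∀ W W' (hW : A.IsTrivializing n W) (h : W' ≤ W) (f : Inv k n r) (z),
      IsValue (κ W) (b W) (f : Coord k n r) z → IsValue (κ W') (b W') (f : Coord k n r)
        (z.map (X.left.presheaf.map (homOfLE h).op).hom) := by
    intro W W' hW h f z hz
    have h1 := hz.map (mapRingHom (X.left.presheaf.map (homOfLE h).op).hom)
      (mapRingHom (A.res h).hom) (fun c ↦ ?_) ?_
    · have h2 : (mapRingHom (X.left.presheaf.map (homOfLE h).op).hom).comp (κ W) = κ W' :=
        RingHom.ext fun c ↦ by
          simp only [κ, RingHom.comp_apply, coe_mapRingHom, map_C]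
          exact congrArg C (baseSec_map h c)
      have h3 : (fun j ↦ mapRingHom (A.res h).hom (b W j)) = b W' := funext fun j ↦ by
        refine (map_pathTuple _ _ _ j).trans ?_
        exact congrArg₂ (fun x y ↦ pathTuple x y j) (funext fun j ↦ A.res_res le_top h (x j))
          (funext fun j ↦ A.res_res le_top h (y j))
      rw [h2, h3] at h1
      exact h1
    · rw [algebraMap_def, algebraMap_def, ← RingHom.comp_apply, ← RingHom.comp_apply,
        mapRingHom_comp, mapRingHom_comp]
      congr 2
      exact RingHom.ext (A.res_algebraMap h)
    · exact polynomial_subalgebra_eq_top (hW.adjoin_range_res h) fun s ↦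
        Algebra.subset_adjoin ⟨C s, by simp⟩
  obtain ⟨H, hH⟩ := exists_over_hom_of_valueHom (X := timesA1 X) (n := n) (r := r) (I := I)
    (fun i ↦ p ⁻¹ᵁ i.1)
    (fun y ↦ by
      obtain ⟨W, hW, hyW, -⟩ := hA.exists_isTrivializing (Opens.mem_top (p y))
      exact ⟨⟨W, hW⟩, hyW⟩)
    (fun i ↦ Γ(X.left, i.1)[X]) (fun i ↦ (A.sec i.1)[X]) (fun i ↦ polynomialBasis i.2.basis)
    (fun i ↦ κ i.1) (fun i ↦ b i.1) (fun i ↦ hgen _ i.2) (fun i ↦ polyA1 i.1)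
    (fun i c ↦ by
      simp only [κ, polyA1, RingHom.comp_apply, coe_eval₂RingHom, eval₂_C]
      have := appLE_baseSec (projA1 X) (V := i.1) le_rfl c
      rw [Scheme.Hom.appLE_eq_app] at this
      exact this) (fun i j y hi hj ↦ by
      obtain ⟨W, hW, hyW, hWO⟩ := hA.exists_isTrivializing (x := p y) (O := i.1 ⊓ j.1) ⟨hi, hj⟩
      have := hE W hW
      refine ⟨p ⁻¹ᵁ W, p.preimage_mono (hWO.trans inf_le_left),
        p.preimage_mono (hWO.trans inf_le_right), hyW, fun f ↦ ?_⟩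
      have h1 := hres _ W i.2 (hWO.trans inf_le_left) f _
        (valueHom_isValue (polynomialBasis i.2.basis) (κ i.1) (b i.1) f)
      have h2 := hres _ W j.2 (hWO.trans inf_le_right) f _
        (valueHom_isValue (polynomialBasis j.2.basis) (κ j.1) (b j.1) f)
      exact (polyA1_map (hWO.trans inf_le_left) _).trans ((congrArg (polyA1 W)
        (h1.unique (polynomialBasis hW.basis) h2)).trans
          (polyA1_map (hWO.trans inf_le_right) _).symm))
  refine ⟨H, fun c W hW f ↦ ?_⟩
  have := hE W hW
  have := hE' ⟨W, hW⟩
  -- Pulling back along the section at `c` amounts to evaluating the polynomial value at `c`.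
  have h1 : X.left.presheaf.map (homOfLE le_top).op (pullInv (sectionA1 X c ≫ H).left f) =
      (valueHom (polynomialBasis hW.basis) (κ W) (b W) f).eval
        (X.left.presheaf.map (homOfLE (le_top : W ≤ ⊤)).op c) := by
    rw [← sectionA1_appLE_polyA1 c W, ← hH ⟨W, hW⟩]
    refine Eq.trans ?_ (map_appLE_apply _ _ _ _).symm
    refine Eq.trans ?_ (appLE_map_apply (sectionA1 X c).left (U := ⊤) le_rfl le_top _)
    rw [Scheme.Hom.appLE_eq_app]
    exact congrArg _ (pullInv_comp (sectionA1 X c).left H.left f)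
  rw [h1]
  set c' := X.left.presheaf.map (homOfLE (le_top : W ≤ ⊤)).op c with hc'
  have h2 := (valueHom_isValue (polynomialBasis hW.basis) (κ W) (b W) f).map
    (evalRingHom c') (evalRingHom (algebraMap Γ(X.left, W) (A.sec W) c')) (fun P ↦ ?_) ?_
  · have h3 : (evalRingHom c').comp (κ W) = baseSec X W := RingHom.ext fun c ↦ by simp [κ]
    have h4 : (fun j ↦ evalRingHom (algebraMap Γ(X.left, W) (A.sec W) c') (b W j)) =
        fun j ↦ A.res (le_top : W ≤ ⊤) (x j + c • (y j - x j)) := funext fun j ↦ by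
      simp only [b, pathTuple, coe_evalRingHom]
      rw [eval_add, eval_mul, eval_C, eval_X, eval_C, map_add, res_smul, Algebra.smul_def, map_sub]
    rw [h3, h4] at h2
    exact h2
  · rw [algebraMap_def, coe_mapRingHom, coe_evalRingHom, coe_evalRingHom, Polynomial.eval_map,
      eval₂_at_apply]
  · rw [eq_top_iff]
    exact fun s _ ↦ Algebra.subset_adjoin ⟨C s, by simp⟩

end Path

/-! ### The chain of homotopies -/

section Chain

open AlgSheaf Polynomial

attribute [local instance] Polynomial.algebra

/-! ### Generation along the three straight-line paths -/

section Generation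

variable {R A : Type*} [CommRing R] [CommRing A] [Algebra R A] {r r' : ℕ}

/-- The first `r` entries of the path are constantly the `a j`, because the shifted tuple vanishes
there. -/
lemma adjoin_pathTuple_pad_shift {a : Fin r → A} {a' : Fin r' → A}
    (ha : Algebra.adjoin R (Set.range a) = ⊤) :
    Algebra.adjoin R[X] (Set.range (pathTuple (padTuple (r + r') a)
      (padTuple (r + r') a + shiftTuple r a'))) = ⊤ := by
  refine polynomial_subalgebra_eq_top ha fun j ↦ Algebra.subset_adjoin ⟨Fin.castAdd r' j, ?_⟩
  simp [pathTuple, padTuple, shiftTuple, not_le.2 j.2]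

/-- The entry at position `r + j` is `a'_j + t a'_{r+j}`, where the second term is absent once `r +
j ≥ r'`. As `r ≥ 1`, descending induction on `j` recovers every `a'_j`. -/
lemma adjoin_pathTuple_shift (hr : 1 ≤ r) {a : Fin r → A} {a' : Fin r' → A}
    (ha' : Algebra.adjoin R (Set.range a') = ⊤) :
    Algebra.adjoin R[X] (Set.range (pathTuple (padTuple (r + r') a + shiftTuple r a')
      (padTuple (r + r') a' + shiftTuple r a'))) = ⊤ := by
  set Q := Algebra.adjoin R[X] (Set.range (pathTuple (padTuple (r + r') a + shiftTuple r a')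
      (padTuple (r + r') a' + shiftTuple r a')))
  refine polynomial_subalgebra_eq_top ha' fun j ↦ ?_
  induction hm : r' - j.1 using Nat.strong_induction_on generalizing j with
  | _ m ih =>
    have h1 : pathTuple (padTuple (r + r') a + shiftTuple r a')
        (padTuple (r + r') a' + shiftTuple r a') (Fin.natAdd r j) ∈ Q :=
      Algebra.subset_adjoin ⟨_, rfl⟩
    have h2 : C (padTuple (r + r') a' (Fin.natAdd r j)) ∈ Q := by
      unfold padTuple
      split_ifs with h
      · exact ih _ (by simp only [Fin.val_natAdd] at h ⊢; omega) ⟨_, h⟩ rfl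
      · rw [C_0]; exact zero_mem _
    have h3 : C (a' j) = pathTuple (padTuple (r + r') a + shiftTuple r a')
        (padTuple (r + r') a' + shiftTuple r a') (Fin.natAdd r j) -
          X * C (padTuple (r + r') a' (Fin.natAdd r j)) := by
      have h4 : padTuple (r + r') a (Fin.natAdd r j) = 0 := by simp [padTuple]
      have h5 : shiftTuple r a' (Fin.natAdd r j) = a' j := by simp [shiftTuple]
      simp [pathTuple, h4, h5]
    rw [h3]
    exact sub_mem h1 (mul_mem (X_mem_subalgebra Q) h2)

/-- The entry at position `j < r'` is `a'_j + (1 - t) a'_{j-r}`, where the second term is absent for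
`j < r`. As `r ≥ 1`, ascending induction on `j` recovers every `a'_j`. -/
lemma adjoin_pathTuple_shift_pad (hr : 1 ≤ r) {a' : Fin r' → A}
    (ha' : Algebra.adjoin R (Set.range a') = ⊤) :
    Algebra.adjoin R[X] (Set.range (pathTuple (padTuple (r + r') a' + shiftTuple r a')
      (padTuple (r + r') a'))) = ⊤ := by
  set Q := Algebra.adjoin R[X] (Set.range (pathTuple (padTuple (r + r') a' + shiftTuple r a')
      (padTuple (r + r') a')))
  refine polynomial_subalgebra_eq_top ha' fun j ↦ ?_
  induction hm : j.1 using Nat.strong_induction_on generalizing j with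
  | _ m ih =>
    let j' : Fin (r + r') := Fin.castLE (Nat.le_add_left r' r) j
    have h1 : pathTuple (padTuple (r + r') a' + shiftTuple r a') (padTuple (r + r') a') j' ∈ Q :=
      Algebra.subset_adjoin ⟨_, rfl⟩
    have h2 : C (shiftTuple r a' j') ∈ Q := by
      unfold shiftTuple
      split_ifs with h
      · exact ih (j'.1 - r) (by simp only [j', Fin.val_castLE] at h ⊢; omega) _ rfl
      · rw [C_0]; exact zero_mem _
    have h3 : C (a' j) = pathTuple (padTuple (r + r') a' + shiftTuple r a')
        (padTuple (r + r') a') j' - (1 - X) * C (shiftTuple r a' j') := by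
      have h4 : padTuple (r + r') a' j' = a' j := by simp [padTuple, j']
      simp only [pathTuple, Pi.add_apply, h4, C_add, C_sub]
      ring
    rw [h3]
    exact sub_mem h1 (mul_mem (sub_mem (one_mem _) (X_mem_subalgebra Q)) h2)

end Generation

variable {k : Type u} [CommRing k] {n r r' : ℕ} {X : Over (Spec (.of k))} {A : AlgSheaf X.left}

lemma exists_elementaryHomotopic (hA : A.IsEtaleOfDegree n) {x y : Fin r → A.sec ⊤}
    (hgen : ∀ W, A.IsTrivializing n W → Algebra.adjoin Γ(X.left, W)[X] (Set.range
      (pathTuple (fun j ↦ A.res (le_top : W ≤ ⊤) (x j)) fun j ↦ A.res le_top (y j))) = ⊤) :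
    ∃ f g : X ⟶ B k n r, Computes f A x ∧ Computes g A y ∧ ElementaryHomotopic f g := by
  obtain ⟨H, hH⟩ := exists_homotopy hA hgen
  refine ⟨_, _, ?_, ?_, H, rfl, rfl⟩
  · simpa using hH 0
  · simpa using hH 1

/-- The intermediate tuples are `(a, a')` and `(a', 0) + (0, a')`. Both ends have their zeros in the
last places, so `a'` is first introduced in the last places and copied to the front from there.
Consecutive homotopies match at their ends because a computing morphism is unique. -/
lemma naivelyHomotopic_of_computes (hr : 1 ≤ r) (hA : A.IsEtaleOfDegree n)
    {a : Fin r → A.sec ⊤} {a' : Fin r' → A.sec ⊤} (ha : A.Generates a) (ha' : A.Generates a')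
    {f g : X ⟶ B k n (r + r')} (hf : Computes f A (padTuple (r + r') a))
    (hg : Computes g A (padTuple (r + r') a')) : NaivelyHomotopic f g := by
  have h1 : ∀ (W : X.left.Opens) (a : Fin r → A.sec ⊤),
      (fun j ↦ A.res (le_top : W ≤ ⊤) (padTuple (r + r') a j)) =
        padTuple (r + r') fun j ↦ A.res le_top (a j) :=
    fun W a ↦ funext fun j ↦ map_padTuple _ _ (A.res (le_top : W ≤ ⊤)).hom _
  have h1' : ∀ (W : X.left.Opens) (a : Fin r' → A.sec ⊤),
      (fun j ↦ A.res (le_top : W ≤ ⊤) (padTuple (r + r') a j)) =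
        padTuple (r + r') fun j ↦ A.res le_top (a j) :=
    fun W a ↦ funext fun j ↦ map_padTuple _ _ (A.res (le_top : W ≤ ⊤)).hom _
  have h2 : ∀ (W : X.left.Opens) (x : Fin (r + r') → A.sec ⊤) (a : Fin r' → A.sec ⊤),
      (fun j ↦ A.res (le_top : W ≤ ⊤) ((x + shiftTuple r a) j)) =
        (fun j ↦ A.res le_top (x j)) + shiftTuple r fun j ↦ A.res le_top (a j) :=
    fun W x a ↦ funext fun j ↦ by
      rw [Pi.add_apply, Pi.add_apply, map_add]
      congr 1
      exact map_shiftTuple r a (A.res (le_top : W ≤ ⊤)).hom j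
  obtain ⟨f1, g1, hf1, hg1, H1⟩ := exists_elementaryHomotopic (X := X) hA
    (x := padTuple (r + r') a) (y := padTuple (r + r') a + shiftTuple r a') fun W hW ↦ by
      rw [h2, h1]
      exact adjoin_pathTuple_pad_shift (ha W hW.isAffineOpen)
  obtain ⟨f2, g2, hf2, hg2, H2⟩ := exists_elementaryHomotopic (X := X) hA
    (x := padTuple (r + r') a + shiftTuple r a')
    (y := padTuple (r + r') a' + shiftTuple r a') fun W hW ↦ by
      rw [h2, h2, h1, h1']
      exact adjoin_pathTuple_shift hr (ha' W hW.isAffineOpen)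
  obtain ⟨f3, g3, hf3, hg3, H3⟩ := exists_elementaryHomotopic (X := X) hA
    (x := padTuple (r + r') a' + shiftTuple r a') (y := padTuple (r + r') a') fun W hW ↦ by
      rw [h2, h1']
      exact adjoin_pathTuple_shift_pad hr (ha' W hW.isAffineOpen)
  obtain rfl := hf.eq hA hf1
  obtain rfl := hg1.eq hA hf2
  obtain rfl := hg2.eq hA hf3
  obtain rfl := hg.eq hA hg3
  exact .head H1 (.head H2 (.single H3))

end Chain

/-! ### `𝔸¹`-invariant functors -/

section Invariance

variable {k : Type u} [CommRing k]

/-- The sections at `0` and `1` both split the projection, which `E` inverts, so `E` takes the same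
value on them; the ends of each elementary homotopy are composites with these sections. -/
lemma EtaleGen.IsA1Invariant.map_eq {P : ObjectProperty (Over (Spec (.of k)))}
    {hP : ∀ X, P X → P (timesA1 X)} {C : Type v} [Category.{w} C]
    {E : P.FullSubcategoryᵒᵖ ⥤ C} (hE : IsA1Invariant hP E) {X Y : Over (Spec (.of k))}
    (hX : P X) (hY : P Y) {f g : X ⟶ Y} (h : NaivelyHomotopic f g) :
    E.map (P.homMk (X := ⟨X, hX⟩) (Y := ⟨Y, hY⟩) f).op =
      E.map (P.homMk (X := ⟨X, hX⟩) (Y := ⟨Y, hY⟩) g).op := by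
  have hs : ∀ c : Γ(X.left, ⊤), E.map (P.homMk (X := ⟨timesA1 X, hP X hX⟩) (Y := ⟨X, hX⟩)
      (projA1 X)).op ≫ E.map (P.homMk (X := ⟨X, hX⟩) (Y := ⟨timesA1 X, hP X hX⟩)
        (sectionA1 X c)).op = 𝟙 _ := by
    intro c
    rw [← E.map_comp, ← op_comp, ← E.map_id, ← op_id]
    congr 2
    exact ObjectProperty.hom_ext _ (sectionA1_projA1 c)
  have hiso := hE X hX
  have h01 : E.map (P.homMk (X := ⟨X, hX⟩) (Y := ⟨timesA1 X, hP X hX⟩) (sectionA1 X 0)).op =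
      E.map (P.homMk (X := ⟨X, hX⟩) (Y := ⟨timesA1 X, hP X hX⟩) (sectionA1 X 1)).op := by
    rw [← cancel_epi (E.map (P.homMk (X := ⟨timesA1 X, hP X hX⟩) (Y := ⟨X, hX⟩) (projA1 X)).op),
      hs, hs]
  have hcomp : ∀ (c : Γ(X.left, ⊤)) (H : timesA1 X ⟶ Y),
      E.map (P.homMk (X := ⟨X, hX⟩) (Y := ⟨Y, hY⟩) (sectionA1 X c ≫ H)).op =
        E.map (P.homMk (X := ⟨timesA1 X, hP X hX⟩) (Y := ⟨Y, hY⟩) H).op ≫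
          E.map (P.homMk (X := ⟨X, hX⟩) (Y := ⟨timesA1 X, hP X hX⟩) (sectionA1 X c)).op := by
    intro c H
    rw [← E.map_comp, ← op_comp]
    rfl
  induction h with
  | refl => rfl
  | tail _ h ih =>
    obtain ⟨H, rfl, rfl⟩ := h
    rw [ih, hcomp, hcomp, h01]

end Invariance

/-! ### Base change along a free quotient by the symmetric group -/

section Descent

open TensorProduct

variable {S : Type*} {T : Type u} [CommRing S] [CommRing T] [Algebra S T] {n r : ℕ}
  [MulSemiringAction (Equiv.Perm (Fin n)) T] [SMulCommClass (Equiv.Perm (Fin n)) S T]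
  [Algebra.IsInvariant S T (Equiv.Perm (Fin n))]

/-- The trace form as a linear map to the invariants. -/
lemma exists_linearMap_eq_permTrace (hinj : Function.Injective (algebraMap S T)) (w : T) :
    ∃ ρ : T →ₗ[S] S, ∀ z, algebraMap S T (ρ z) = permTrace n (z * w) := by
  choose ρ hρ using fun z : T ↦ Algebra.IsInvariant.isInvariant (A := S)
    (permTrace n (z * w)) fun σ : Equiv.Perm (Fin n) ↦ smul_permTrace σ _
  refine ⟨{ toFun := ρ, map_add' := fun y z ↦ hinj ?_, map_smul' := fun c z ↦ hinj ?_ }, hρ⟩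
  · simp only [map_add, hρ, permTrace, add_mul, smul_add, Finset.sum_add_distrib]
  · rw [hρ, smul_eq_mul, map_mul, RingHom.id_apply, hρ, permTrace, permTrace, Finset.mul_sum]
    refine Finset.sum_congr rfl fun σ _ ↦ ?_
    rw [smul_mul_assoc, smul_comm, Algebra.smul_def]

variable {x : Fin r → Fin n → T}

/-- For `w` of trace one, `z ↦ tr (z w)` is an `S`-linear retraction of `S → T`, and retractions
survive base change. -/
lemma includeLeft_injective_of_isInvariant (hx : ∀ j, IsEquivariant (x j))
    (hsep : ∀ i i', i ≠ i' → Ideal.span (Set.range fun j ↦ x j i - x j i') = ⊤)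
    (hinj : Function.Injective (algebraMap S T)) {R : Type*} [CommRing R] [Algebra S R] :
    Function.Injective (Algebra.TensorProduct.includeLeft : R →ₐ[S] R ⊗[S] T) := by
  obtain ⟨w, hw⟩ := exists_permTrace_eq_one hx hsep hinj
  obtain ⟨ρ, hρ⟩ := exists_linearMap_eq_permTrace (n := n) hinj w
  have h1 : ρ 1 = 1 := hinj (by rw [hρ, one_mul, hw, map_one])
  refine Function.LeftInverse.injective (g := (TensorProduct.rid S R) ∘ (ρ.lTensor R)) fun z ↦ ?_
  simp [h1]

/-- A base change of the algebra of equivariant functions is detected by sufficiently many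
families of homomorphisms. -/
lemma injective_of_equivariant (hx : ∀ j, IsEquivariant (x j))
    (hsep : ∀ i i', i ≠ i' → Ideal.span (Set.range fun j ↦ x j i - x j i') = ⊤)
    (hinj : Function.Injective (algebraMap S T)) {E R A : Type*} [CommRing E] [Algebra S E]
    [CommRing R] [Algebra S R] [CommRing A] [Algebra R A] (ev : Fin n → E →ₐ[S] T)
    (hev : ∀ z, IsEquivariant fun i ↦ ev i z) (hev_inj : ∀ z z', (∀ i, ev i z = ev i z') → z = z')
    (hev_surj : ∀ f : Fin n → T, IsEquivariant f → ∃ z, ∀ i, ev i z = f i)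
    (Φ : R ⊗[S] E →ₐ[R] A)
    (hloc : ∀ c : R, (∀ (L : Type u) [CommRing L] (h : R →+* L) (s : Fin n → A →+* L)
      (g : T →+* L), (∀ i d, s i (algebraMap R A d) = h d) →
        (∀ d, g (algebraMap S T d) = h (algebraMap S R d)) →
          (∀ i z, s i (Φ (1 ⊗ₜ z)) = g (ev i z)) → h c = 0) → c = 0) :
    Function.Injective Φ := by
  obtain ⟨ι, _, c, v, p, hp, hdual⟩ := exists_equivariant_dual_basis hx hsep hinj
  choose p' hp' using fun m ↦ hev_surj (p m) (hp m)
  choose ρ hρ using fun m ↦ exists_linearMap_eq_permTrace (n := n) hinj (v m)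
  -- Coordinates with respect to the dual basis of equivariant functions; `q'` is their base change
  -- to `R`.
  let q : ι → E →ₗ[S] S := fun m ↦ ρ m ∘ₗ (ev (c m)).toLinearMap
  have hq : ∀ z, z = ∑ m, q m z • p' m := fun z ↦ hev_inj _ _ fun i ↦ by
    rw [map_sum, hdual _ (hev z) i]
    refine Finset.sum_congr rfl fun m _ ↦ ?_
    rw [map_smul, hp', Algebra.smul_def]
    exact congrArg (· * p m i) (hρ m _).symm
  let q' : ι → R ⊗[S] E →ₗ[S] R := fun m ↦ (TensorProduct.rid S R).toLinearMap ∘ₗ (q m).lTensor R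
  have hq' : ∀ z, z = ∑ m, q' m z ⊗ₜ p' m := by
    intro z
    induction z using TensorProduct.induction_on with
    | zero => simp
    | tmul d z =>
      conv_lhs => rw [hq z, TensorProduct.tmul_sum]
      refine Finset.sum_congr rfl fun m _ ↦ ?_
      simp [q', TensorProduct.smul_tmul']
    | add y z hy hz =>
      conv_lhs => rw [hy, hz]
      simp [TensorProduct.add_tmul, Finset.sum_add_distrib]
  rw [injective_iff_map_eq_zero]
  intro z hz
  have h0 : ∀ m, q' m z = 0 := fun m ↦ hloc _ fun L _ h s g hs hg hsg ↦ by
    -- Expanding the trace and using equivariance expresses the coordinates of `z`, in any test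
    -- ring, through `Φ z` alone. So they vanish when `Φ z` does.
    have key : ∀ z, h (q' m z) = ∑ σ : Equiv.Perm (Fin n), g (σ • v m) * s (σ (c m)) (Φ z) := by
      intro z
      induction z using TensorProduct.induction_on with
      | zero => simp
      | tmul d z =>
        have h1 : q' m (d ⊗ₜ z) = q m z • d := by simp [q']
        have h2 : ∀ i, s i (Φ (d ⊗ₜ z)) = h d * g (ev i z) := fun i ↦ by
          have : (d ⊗ₜ z : R ⊗[S] E) = d • (1 ⊗ₜ z) := by simp [TensorProduct.smul_tmul']
          rw [this, map_smul, Algebra.smul_def, map_mul, hs, hsg]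
        rw [h1, Algebra.smul_def, map_mul, ← hg]
        change g (algebraMap S T (ρ m _)) * _ = _
        rw [hρ, permTrace, map_sum, Finset.sum_mul]
        refine Finset.sum_congr rfl fun σ _ ↦ ?_
        rw [h2, smul_mul', map_mul, AlgHom.toLinearMap_apply, hev z σ (c m)]
        ring
      | add y z hy hz => simp only [map_add, hy, hz, mul_add, Finset.sum_add_distrib]
    rw [key, hz]
    simp
  rw [hq' z]
  simp [h0]

end Descent

/-! ### Components of sections of the canonical algebra -/

section Components

open AlgSheaf

variable {k : Type u} [CommRing k] {n r : ℕ}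

/-- The `i`-th component of a section of the canonical algebra. -/
noncomputable def component (V : (BScheme k n r).Opens) (i : Fin n) :
    (canonicalAlg k n r).sec V →+* Γ(U k n r, quotU k n r ⁻¹ᵁ V) :=
  (Pi.evalRingHom _ i).comp (equivSec k n r V).subtype

lemma component_algebraMap (V : (BScheme k n r).Opens) (i : Fin n) (c : Γ(BScheme k n r, V)) :
    component V i (algebraMap Γ(BScheme k n r, V) ((canonicalAlg k n r).sec V) c) =
      (quotU k n r).app V c := rfl

lemma component_canonicalSec (V : (BScheme k n r).Opens) (i : Fin n) (j : Fin r) :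
    component V i ((canonicalAlg k n r).res le_top (canonicalSec k n r j)) =
      polySec _ (MvPolynomial.X (j, i)) := rfl

lemma isEquivariant_component (V : (BScheme k n r).Opens) (z : (canonicalAlg k n r).sec V) :
    IsEquivariant fun i ↦ component V i z :=
  fun σ i ↦ (show equivSec k n r V from z).2 σ i

lemma component_ext {V : (BScheme k n r).Opens} {z z' : (canonicalAlg k n r).sec V}
    (h : ∀ i, component V i z = component V i z') : z = z' :=
  Subtype.ext (funext h)

lemma exists_component_eq {V : (BScheme k n r).Opens} {f : Fin n → Γ(U k n r, quotU k n r ⁻¹ᵁ V)}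
    (hf : IsEquivariant f) : ∃ z : (canonicalAlg k n r).sec V, ∀ i, component V i z = f i :=
  ⟨(⟨f, hf⟩ : equivSec k n r V), fun _ ↦ rfl⟩

end Components

/-! ### Classifying morphisms compute multisymmetric functions -/

section ClassifiesComputes

open AlgSheaf TensorProduct

variable {k : Type u} [CommRing k] {n r : ℕ} {X : Over (Spec (.of k))} {A : AlgSheaf X.left}

/-- Over `R ⊗ T`, with `T` the functions on `π⁻¹ V`, the components of `ℰ` split `A` tautologically
and send `a_j` to the `x_{ji}`. There the value of `f` is `f(x)`, the pullback of the function on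
`B` defined by `f`. As `R` injects into `R ⊗ T`, this single splitting identifies the value, which
is already known to exist. -/
lemma isValue_of_isPushout (hA : A.IsEtaleOfDegree n) (φ : X ⟶ B k n r) {a : Fin r → A.sec ⊤}
    {V : (BScheme k n r).Opens} (hV : IsAffineOpen V) {W : X.left.Opens}
    (hW : A.IsTrivializing n W) (h : W ≤ φ.left ⁻¹ᵁ V) (t : (canonicalAlg k n r).sec V ⟶ A.sec W)
    (hpo : IsPushout (Scheme.Hom.appLE (Y := BScheme k n r) φ.left V W h)
      ((canonicalAlg k n r).str V) (A.str W) t)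
    (ht : ∀ j, t ((canonicalAlg k n r).res le_top (canonicalSec k n r j)) = A.res le_top (a j))
    (f : Inv k n r) :
    IsValue (baseSec X W) (fun j ↦ A.res (le_top : W ≤ ⊤) (a j)) (f : Coord k n r)
      (X.left.presheaf.map (homOfLE le_top).op (pullInv φ.left f)) := by
  have := hA.etale W hW.isAffineOpen
  let R := Γ(X.left, W)
  let S := Γ(BScheme k n r, V)
  let T := Γ(U k n r, quotU k n r ⁻¹ᵁ V)
  let α : S ⟶ R := Scheme.Hom.appLE (Y := BScheme k n r) φ.left V W h
  let _ : Algebra S R := α.hom.toAlgebra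
  let incl : R →+* R ⊗[S] T := (Algebra.TensorProduct.includeLeft : R →ₐ[S] R ⊗[S] T)
  let incr : T →+* R ⊗[S] T := (Algebra.TensorProduct.includeRight : T →ₐ[S] R ⊗[S] T)
  have hincl : Function.Injective incl :=
    includeLeft_injective_of_isInvariant (n := n)
      (x := fun j i ↦ polySec (quotU k n r ⁻¹ᵁ V) (MvPolynomial.X (j, i)))
      (isEquivariant_polySec V) (fun i i' hi ↦ span_polySec_eq_top
        (isAffineOpen_quotU_preimage hV) hi) (quotU_app_injective V)
  have hcomm : ∀ c : S, incl (α c) = incr ((quotU k n r).app V c) := fun c ↦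
    ((Algebra.TensorProduct.includeLeft : R →ₐ[S] R ⊗[S] T).commutes c).trans
      ((Algebra.TensorProduct.includeRight : T →ₐ[S] R ⊗[S] T).commutes c).symm
  have hw : ∀ i, α ≫ CommRingCat.ofHom incl = (canonicalAlg k n r).str V ≫
      CommRingCat.ofHom (incr.comp (component V i)) := fun i ↦
    CommRingCat.hom_ext (RingHom.ext hcomm)
  let s : Fin n → A.sec W →ₐ[R] R ⊗[S] T := fun i ↦
    { (hpo.desc _ _ (hw i)).hom with
      commutes' := fun c ↦ ConcreteCategory.congr_hom (hpo.inl_desc _ _ (hw i)) c }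
  have hst : ∀ i z, s i (t z) = incr (component V i z) := fun i z ↦
    ConcreteCategory.congr_hom (hpo.inr_desc _ _ (hw i)) z
  have hsa : ∀ i j, s i (A.res le_top (a j)) =
      incr (polySec (quotU k n r ⁻¹ᵁ V) (MvPolynomial.X (j, i))) := fun i j ↦ by
    rw [← ht, hst, component_canonicalSec]
  have hinv : ∀ f : Inv k n r, incr (polySec (quotU k n r ⁻¹ᵁ V) (f : Coord k n r)) =
      incl (X.left.presheaf.map (homOfLE le_top).op (pullInv φ.left f)) := fun f ↦ by
    rw [← quotU_app_invPolySec, ← hcomm]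
    exact congrArg incl (appLE_invPolySec _ _ _ h f)
  have hs : SepFamily s := by
    intro i i' hi
    rw [eq_top_iff, ← Ideal.map_top incr, ← span_polySec_eq_top
      (isAffineOpen_quotU_preimage hV) hi, Ideal.map_span, Ideal.span_le]
    rintro _ ⟨_, ⟨j, rfl⟩, rfl⟩
    refine Ideal.subset_span ⟨A.res le_top (a j), ?_⟩
    simp only [hsa, map_sub]
  have heval : evalPt ((algebraMap R (R ⊗[S] T)).comp (baseSec X W))
      (fun j i ↦ s i (A.res le_top (a j))) = incr.comp (polySec (quotU k n r ⁻¹ᵁ V)) := by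
    refine coord_ringHom_ext (fun c ↦ ?_) fun j i ↦ ?_
    · rw [evalPt_C]
      refine Eq.trans ?_ (hinv (algebraMap k (Inv k n r) c)).symm
      rw [pullInv_algebraMap, baseSec_map]
      rfl
    · rw [evalPt_X, hsa]
      rfl
  obtain ⟨y, hy⟩ := exists_isValue hW.basis (baseSec X W)
    (fun j ↦ A.res (le_top : W ≤ ⊤) (a j)) f
  have h1 : y = X.left.presheaf.map (homOfLE le_top).op (pullInv φ.left f) := by
    refine hincl ?_
    rw [← hinv]
    refine (hy (R ⊗[S] T) s hs).trans ?_
    rw [heval]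
    rfl
  rwa [← h1]

lemma EtaleGen.Classifies.computes (hA : A.IsEtaleOfDegree n) {φ : X ⟶ B k n r}
    {a : Fin r → A.sec ⊤} (h : Classifies φ A a) : Computes φ A a := by
  obtain ⟨θ, hθ, hθa⟩ := h
  intro W₀ hW₀ f
  refine hA.isValue_of_local hW₀ fun y hy ↦ ?_
  obtain ⟨_, ⟨V, hV, rfl⟩, hyV, -⟩ := (BScheme k n r).isBasis_affineOpens.exists_subset_of_mem_open
    (Opens.mem_top (φ.left y)) (⊤ : (BScheme k n r).Opens).isOpen
  obtain ⟨W, hW, hyW, hWO⟩ := hA.exists_isTrivializing (x := y) (O := W₀ ⊓ φ.left ⁻¹ᵁ V) ⟨hy, hyV⟩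
  refine ⟨W, hWO.trans inf_le_left, hyW, hW, ?_⟩
  rw [map_map_apply]
  simp only [res_res]
  refine isValue_of_isPushout hA φ hV hW (hWO.trans inf_le_right) _
    (hθ V W (hWO.trans inf_le_right) hV hW.isAffineOpen) (fun j ↦ ?_) f
  have h1 := ConcreteCategory.congr_hom (θ.naturality (le_top : V ≤ ⊤)) (canonicalSec k n r j)
  rw [CommRingCat.comp_apply, CommRingCat.comp_apply, hθa] at h1
  rw [CommRingCat.comp_apply, h1]
  exact A.res_res _ _ (a j)

end ClassifiesComputes

/-! ### Points of the torsor defined by splittings -/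

section SplittingPoints

open AlgSheaf

lemma specMap_fromSpec_appLE {X : Scheme.{u}} {W : X.Opens} (hW : IsAffineOpen W)
    {L : CommRingCat.{u}} (m : Γ(X, W) ⟶ L) {O : X.Opens} (h : W ≤ O)
    (e : ⊤ ≤ (Spec.map m ≫ hW.fromSpec) ⁻¹ᵁ O) (z : Γ(X, O)) :
    (Spec.map m ≫ hW.fromSpec).appLE O ⊤ e z =
      specSec ⊤ (m (X.presheaf.map (homOfLE h).op z)) := by
  have h1 : hW.fromSpec.app O = X.presheaf.map (homOfLE h).op ≫ specSec (hW.fromSpec ⁻¹ᵁ O) :=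
    hW.fromSpec_app_of_le O h
  rw [Scheme.Hom.comp_appLE, h1, Category.assoc]
  exact ConcreteCategory.congr_hom (specSec_appLE m (hW.fromSpec ⁻¹ᵁ O) ⊤ e) _

lemma appLE_app_of_comp_eq {Z Y Y' T : Scheme.{u}} {ψ : Z ⟶ Y} {π : Y ⟶ T} {χ : Z ⟶ Y'}
    {φ : Y' ⟶ T} (h : ψ ≫ π = χ ≫ φ) {V : T.Opens} {W : Y'.Opens} {O : Z.Opens}
    (hφ : W ≤ φ ⁻¹ᵁ V) (hχ : O ≤ χ ⁻¹ᵁ W) (hψ : O ≤ ψ ⁻¹ᵁ (π ⁻¹ᵁ V)) (c : Γ(T, V)) :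
    ψ.appLE (π ⁻¹ᵁ V) O hψ (π.app V c) = χ.appLE W O hχ (φ.appLE V W hφ c) := by
  have h1 : O ≤ (ψ ≫ π) ⁻¹ᵁ V := hψ
  have h2 : ∀ {f : Z ⟶ T} (hf : ψ ≫ π = f) (e : O ≤ f ⁻¹ᵁ V),
      (ψ ≫ π).appLE V O h1 = f.appLE V O e := by
    rintro f rfl e
    rfl
  refine (ConcreteCategory.congr_hom (Scheme.Hom.comp_appLE ψ π V O h1) c).symm.trans ?_
  rw [h2 h (hχ.trans (χ.preimage_mono hφ)), ← CommRingCat.comp_apply,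
    Scheme.Hom.appLE_comp_appLE]

variable {k : Type u} [CommRing k] {n r : ℕ} {X : Over (Spec (.of k))} {A : AlgSheaf X.left}

/-- The matrix `s i (a j)` is an `L`-point of `(𝔸ⁿ)^r`, which lies in `U` by separatedness. As `φ`
computes `a`, it lies over the `L`-point of `B` obtained through `W`; hence functions on `π⁻¹ V` can
be evaluated at it. -/
lemma exists_ringHom_of_sepFamily {φ : X ⟶ B k n r} {a : Fin r → A.sec ⊤}
    (hφ : Computes φ A a) (ha : A.Generates a) {V : (BScheme k n r).Opens} {W : X.left.Opens}
    (hW : A.IsTrivializing n W) (h : W ≤ φ.left ⁻¹ᵁ V) (L : Type u) [CommRing L]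
    [Algebra Γ(X.left, W) L] (s : Fin n → A.sec W →ₐ[Γ(X.left, W)] L) (hs : SepFamily s) :
    ∃ g : Γ(U k n r, quotU k n r ⁻¹ᵁ V) →+* L,
      (∀ c, g ((quotU k n r).app V c) = algebraMap Γ(X.left, W) L
        (Scheme.Hom.appLE (Y := BScheme k n r) φ.left V W h c)) ∧
      ∀ j i, g (polySec _ (MvPolynomial.X (j, i))) = s i (A.res le_top (a j)) := by
  let E := evalPt ((algebraMap Γ(X.left, W) L).comp (baseSec X W)) fun j i ↦
    s i (A.res le_top (a j))
  let ψ₀ : Spec (.of L) ⟶ AffR k n r := Spec.map (CommRingCat.ofHom E)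
  have hr : Set.range ψ₀ ⊆ Set.range (UOpens k n r).ι := by
    rw [Scheme.Opens.range_ι]
    rintro _ ⟨q, rfl⟩
    refine mem_UOpens.2 fun i i' hi ↦ ?_
    by_contra! hc
    have hq : q.asIdeal.IsPrime := q.isPrime
    refine hq.ne_top (top_le_iff.1 ?_)
    rw [← (sepFamily_iff_of_adjoin (ha W hW.isAffineOpen) s).1 hs i i' hi, Ideal.span_le]
    rintro _ ⟨j, rfl⟩
    have : E (MvPolynomial.X (j, i) - MvPolynomial.X (j, i')) ∈ q.asIdeal := hc j
    simpa [E] using this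
  let ψ : Spec (.of L) ⟶ U k n r := IsOpenImmersion.lift (UOpens k n r).ι ψ₀ hr
  have hψ : ψ ≫ (UOpens k n r).ι = ψ₀ := IsOpenImmersion.lift_fac _ _ _
  let m : Γ(X.left, W) ⟶ .of L := CommRingCat.ofHom (algebraMap Γ(X.left, W) L)
  let χ : Spec (.of L) ⟶ X.left := Spec.map m ≫ hW.isAffineOpen.fromSpec
  let φ₀ : X.left ⟶ BScheme k n r := φ.left
  have hE : globalHom (R := .of (Coord k n r)) ψ₀ = CommRingCat.ofHom E ≫ specSec ⊤ := by
    have h1 := Category.id_comp (Spec.map (CommRingCat.ofHom E))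
    have h2 := globalHom_comp_specMap (𝟙 (Spec (.of L))) (CommRingCat.ofHom E)
    rw [h1] at h2
    refine h2.trans ?_
    congr 1
  have heq : ψ ≫ quotU k n r = χ ≫ φ₀ := by
    refine pullInv_injective (RingHom.ext fun f ↦ ?_)
    have h1 : pullInv (χ ≫ φ₀) f = specSec ⊤ (m
        (X.left.presheaf.map (homOfLE le_top).op (pullInv φ₀ f))) := by
      have h4 : χ.appLE ⊤ ⊤ le_rfl = χ.appTop := Scheme.Hom.appLE_eq_app _
      rw [pullInv_comp]
      exact (ConcreteCategory.congr_hom h4 _).symm.trans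
        (specMap_fromSpec_appLE hW.isAffineOpen m le_top _ _)
    have h2 : m (X.left.presheaf.map (homOfLE le_top).op (pullInv φ₀ f)) = E (f : Coord k n r) :=
      hφ W hW f L s hs
    have h3 : (ψ ≫ quotU k n r) ≫ (BOpens k n r).ι = ψ₀ ≫ quotMap k n r := by
      rw [Category.assoc, quotU_ι, ← Category.assoc, hψ]
    rw [h1, h2, pullInv, h3, quotMap, globalHom_comp_specMap, hE]
    rfl
  have hχ : ⊤ ≤ χ ⁻¹ᵁ W := by
    intro q _
    change (hW.isAffineOpen.fromSpec (Spec.map m q)) ∈ (W : Set X.left)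
    rw [← hW.isAffineOpen.range_fromSpec]
    exact ⟨_, rfl⟩
  have hψV : ⊤ ≤ ψ ⁻¹ᵁ (quotU k n r ⁻¹ᵁ V) := by
    rw [← Scheme.Hom.comp_preimage, heq, Scheme.Hom.comp_preimage]
    exact hχ.trans (χ.preimage_mono h)
  have hinj : ∀ z : L, (Scheme.ΓSpecIso (.of L)).hom (specSec (R := .of L) ⊤ z) = z := fun z ↦ by
    have h1 : specSec (R := .of L) ⊤ = (Scheme.ΓSpecIso (.of L)).inv := by
      rw [specSec]
      exact (congrArg _ ((Spec (.of L)).presheaf.map_id (op ⊤))).trans (Category.comp_id _)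
    rw [h1]
    exact ConcreteCategory.congr_hom (Scheme.ΓSpecIso (.of L)).inv_hom_id z
  refine ⟨(ψ.appLE (quotU k n r ⁻¹ᵁ V) ⊤ hψV ≫ (Scheme.ΓSpecIso (.of L)).hom).hom,
    fun c ↦ ?_, fun j i ↦ ?_⟩
  · have h1 : ψ.appLE (quotU k n r ⁻¹ᵁ V) ⊤ hψV ((quotU k n r).app V c) =
        χ.appLE W ⊤ hχ (φ₀.appLE V W h c) := appLE_app_of_comp_eq heq h hχ hψV c
    refine (congrArg (Scheme.ΓSpecIso (.of L)).hom h1).trans ?_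
    refine (congrArg (Scheme.ΓSpecIso (.of L)).hom
      (specMap_fromSpec_appLE hW.isAffineOpen m le_rfl hχ _)).trans ?_
    rw [hinj]
    refine congrArg m ?_
    exact ConcreteCategory.congr_hom (X.left.presheaf.map_id (op W)) _
  · have h1 : ψ.appLE (quotU k n r ⁻¹ᵁ V) ⊤ hψV (polySec _ (MvPolynomial.X (j, i))) =
        specSec (R := .of L) ⊤ (E (MvPolynomial.X (j, i))) := by
      change ψ.appLE _ ⊤ hψV ((U k n r).presheaf.map (homOfLE le_top).op
        (globalHom (R := .of (Coord k n r)) (UOpens k n r).ι (MvPolynomial.X (j, i)))) = _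
      rw [map_appLE_apply]
      have h2 := globalHom_comp (R := .of (Coord k n r)) ψ (UOpens k n r).ι
      rw [hψ, hE] at h2
      have h3 : ψ.appLE ⊤ ⊤ le_rfl = ψ.appTop := Scheme.Hom.appLE_eq_app _
      refine (ConcreteCategory.congr_hom h3 _).trans ?_
      exact (ConcreteCategory.congr_hom h2 (MvPolynomial.X (j, i))).symm
    refine (congrArg (Scheme.ΓSpecIso (.of L)).hom h1).trans ?_
    rw [hinj]
    exact evalPt_X _ _ _

end SplittingPoints

/-! ### The pullback of the canonical algebra along a computing morphism -/

section Match

open AlgSheaf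

variable {k : Type u} [CommRing k] {n r : ℕ} {X : Scheme.{u}} (φ : X ⟶ BScheme k n r)
  (A : AlgSheaf X) (a : Fin r → A.sec ⊤)

/-- A section `b` of `A` over the preimage of `V` matches a section `z` of the canonical algebra
over `V` if over every splitting of `A` the values of `b` are the components of `z`. -/
def IsMatch (V : (BScheme k n r).Opens) (z : (canonicalAlg k n r).sec V)
    (b : A.sec (φ ⁻¹ᵁ V)) : Prop :=
  ∀ (V' : (BScheme k n r).Opens) (hV : V' ≤ V) (W : X.Opens) (h : W ≤ φ ⁻¹ᵁ V'), IsAffineOpen V' →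
    A.IsTrivializing n W → ∀ (L : Type u) [CommRing L] [Algebra Γ(X, W) L]
      (s : Fin n → A.sec W →ₐ[Γ(X, W)] L), SepFamily s → ∀ g : Γ(U k n r, quotU k n r ⁻¹ᵁ V') →+* L,
        (∀ c, g ((quotU k n r).app V' c) = algebraMap Γ(X, W) L (φ.appLE V' W h c)) →
        (∀ j i, g (polySec _ (MvPolynomial.X (j, i))) = s i (A.res le_top (a j))) →
        ∀ i, s i (A.res (h.trans (φ.preimage_mono hV)) b) =
          g (component V' i ((canonicalAlg k n r).res hV z))

variable {φ A a} {V : (BScheme k n r).Opens} {z z' : (canonicalAlg k n r).sec V}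
  {b b' : A.sec (φ ⁻¹ᵁ V)}

lemma IsMatch.add (hb : IsMatch φ A a V z b) (hb' : IsMatch φ A a V z' b') :
    IsMatch φ A a V (z + z') (b + b') :=
  fun V' hV W h hV' hW L _ _ s hs g h1 h2 i ↦ by
    simp only [map_add, hb V' hV W h hV' hW L s hs g h1 h2, hb' V' hV W h hV' hW L s hs g h1 h2]

lemma IsMatch.mul (hb : IsMatch φ A a V z b) (hb' : IsMatch φ A a V z' b') :
    IsMatch φ A a V (z * z') (b * b') :=
  fun V' hV W h hV' hW L _ _ s hs g h1 h2 i ↦ by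
    simp only [map_mul, hb V' hV W h hV' hW L s hs g h1 h2, hb' V' hV W h hV' hW L s hs g h1 h2]

lemma isMatch_algebraMap (c : Γ(BScheme k n r, V)) : IsMatch φ A a V
    (algebraMap Γ(BScheme k n r, V) ((canonicalAlg k n r).sec V) c)
    (algebraMap Γ(X, φ ⁻¹ᵁ V) (A.sec (φ ⁻¹ᵁ V)) (φ.app V c)) :=
  fun V' hV W h hV' hW L _ _ s hs g h1 h2 i ↦ by
    rw [res_algebraMap, res_algebraMap, component_algebraMap, h1, AlgHom.commutes,
      map_appLE_apply, ← Scheme.Hom.appLE_eq_app, appLE_map_apply]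

lemma isMatch_one : IsMatch φ A a V 1 1 := by
  have := isMatch_algebraMap (φ := φ) (A := A) (a := a) (V := V) 1
  rwa [map_one, map_one, map_one] at this

lemma isMatch_zero : IsMatch φ A a V 0 0 := by
  have := isMatch_algebraMap (φ := φ) (A := A) (a := a) (V := V) 0
  rwa [map_zero, map_zero, map_zero] at this

lemma isMatch_canonicalSec (j : Fin r) : IsMatch φ A a V
    ((canonicalAlg k n r).res le_top (canonicalSec k n r j)) (A.res le_top (a j)) :=
  fun V' hV W h hV' hW L _ _ s hs g h1 h2 i ↦ by
    rw [res_res, res_res, component_canonicalSec, h2]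

lemma IsMatch.res {V' : (BScheme k n r).Opens} (hV : V' ≤ V) (hb : IsMatch φ A a V z b) :
    IsMatch φ A a V' ((canonicalAlg k n r).res hV z) (A.res (φ.preimage_mono hV) b) :=
  fun V'' hV' W h hV'' hW L _ _ s hs g h1 h2 i ↦ by
    rw [res_res, res_res]
    exact hb V'' (hV'.trans hV) W h hV'' hW L s hs g h1 h2 i

lemma isMatch_of_forall_isAffineOpen
    (h : ∀ (V' : (BScheme k n r).Opens) (hV : V' ≤ V), IsAffineOpen V' →
      IsMatch φ A a V' ((canonicalAlg k n r).res hV z) (A.res (φ.preimage_mono hV) b)) :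
    IsMatch φ A a V z b := by
  intro V' hV W hW hV' hW' L _ _ s hs g h1 h2 i
  have := h V' hV hV' V' le_rfl W hW hV' hW' L s hs g h1 h2 i
  rw [res_res, res_res] at this
  exact this

/-- Over an affine open the equivariant functions are generated by the `t_j`, which are matched by
the `a_j`, and matching respects the algebra operations. The choice of polynomial expression is
harmless by `IsMatch.eq`. -/
lemma exists_isMatch_of_isAffineOpen (hV : IsAffineOpen V) (z : (canonicalAlg k n r).sec V) :
    ∃ b, IsMatch φ A a V z b := by
  have hz := mem_adjoin_of_isEquivariant (S := Γ(BScheme k n r, V))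
    (x := fun j i ↦ polySec (quotU k n r ⁻¹ᵁ V) (MvPolynomial.X (j, i)))
    (isEquivariant_polySec V) (fun i i' hi ↦ span_polySec_eq_top
      (isAffineOpen_quotU_preimage hV) hi) (quotU_app_injective V) (isEquivariant_component V z)
  have key : ∀ f ∈ Algebra.adjoin Γ(BScheme k n r, V) (Set.range fun (j : Fin r) (i : Fin n) ↦
      polySec (quotU k n r ⁻¹ᵁ V) (MvPolynomial.X (j, i) : Coord k n r)),
      ∃ (z : (canonicalAlg k n r).sec V) (b : A.sec (φ ⁻¹ᵁ V)),
        (∀ i, component V i z = f i) ∧ IsMatch φ A a V z b := by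
    intro f hf
    induction hf using Algebra.adjoin_induction with
    | mem f hf =>
      obtain ⟨j, rfl⟩ := hf
      exact ⟨_, _, fun i ↦ component_canonicalSec V i j, isMatch_canonicalSec j⟩
    | algebraMap c => exact ⟨_, _, fun i ↦ component_algebraMap V i c, isMatch_algebraMap c⟩
    | add f f' _ _ hf hf' =>
      obtain ⟨z, b, hz, hb⟩ := hf
      obtain ⟨z', b', hz', hb'⟩ := hf'
      exact ⟨_, _, fun i ↦ by rw [map_add, hz, hz']; rfl, hb.add hb'⟩
    | mul f f' _ _ hf hf' =>
      obtain ⟨z, b, hz, hb⟩ := hf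
      obtain ⟨z', b', hz', hb'⟩ := hf'
      exact ⟨_, _, fun i ↦ by rw [map_mul, hz, hz']; rfl, hb.mul hb'⟩
  obtain ⟨z', b, hz', hb⟩ := key _ hz
  rw [component_ext hz'] at hb
  exact ⟨b, hb⟩

lemma exists_isAffineOpen_mem {Y : Scheme.{u}} {O : Y.Opens} {y : Y} (hy : y ∈ O) :
    ∃ V : Y.Opens, IsAffineOpen V ∧ y ∈ V ∧ V ≤ O := by
  obtain ⟨_, ⟨V, hV, rfl⟩, hyV, hVO⟩ := Y.isBasis_affineOpens.exists_subset_of_mem_open hy O.isOpen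
  exact ⟨V, hV, hyV, hVO⟩

end Match

/-! ### Computing morphisms are classifying -/

section ComputesClassifies

open AlgSheaf TensorProduct

variable {k : Type u} [CommRing k] {n r : ℕ} {X : Over (Spec (.of k))} {A : AlgSheaf X.left}
  {φ : X ⟶ B k n r} {a : Fin r → A.sec ⊤}

/-- Two matches have the same image under every member of a splitting family. Over a faithfully flat
splitting ring these images determine a section of `A`. -/
lemma IsMatch.eq (hA : A.IsEtaleOfDegree n) (ha : A.Generates a) (hφ : Computes φ A a)
    {V : (BScheme k n r).Opens} {z : (canonicalAlg k n r).sec V} {b b' : A.sec (φ.left ⁻¹ᵁ V)}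
    (hb : IsMatch φ.left A a V z b) (hb' : IsMatch φ.left A a V z b') : b = b' := by
  refine A.sec_ext fun x hx ↦ ?_
  obtain ⟨V', hV', hxV', hV⟩ := exists_isAffineOpen_mem (Y := BScheme k n r) (y := φ.left x) hx
  obtain ⟨W, hW, hxW, h⟩ := hA.exists_isTrivializing (x := x) (O := φ.left ⁻¹ᵁ V') hxV'
  have := hA.etale W hW.isAffineOpen
  refine ⟨W, h.trans (Scheme.Hom.preimage_mono _ hV), hxW, ?_⟩
  obtain ⟨L, _, _, _, s, hs⟩ := exists_sepFamily hW.basis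
  obtain ⟨g, h1, h2⟩ := exists_ringHom_of_sepFamily hφ ha hW h L s hs
  have : Module.Free Γ(X.left, W) (A.sec W) := Module.Free.of_basis hW.basis
  have hinj : Function.Injective
      (Algebra.TensorProduct.includeRight : A.sec W →ₐ[Γ(X.left, W)] L ⊗[Γ(X.left, W)] A.sec W) :=
    Algebra.TensorProduct.includeRight_injective (FaithfulSMul.algebraMap_injective _ L)
  refine hinj ((hs.familyHom_bijective hW.basis).1 (funext fun i ↦ ?_))
  rw [Algebra.TensorProduct.includeRight_apply, Algebra.TensorProduct.includeRight_apply,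
    familyHom_tmul, familyHom_tmul]
  exact congrArg (1 * ·) ((hb V' hV W h hV' hW L s hs g h1 h2 i).trans
    (hb' V' hV W h hV' hW L s hs g h1 h2 i).symm)

/-- Matches over affine opens glue, since uniqueness forces agreement on overlaps, whether affine or
not. -/
lemma exists_isMatch (hA : A.IsEtaleOfDegree n) (ha : A.Generates a) (hφ : Computes φ A a)
    (V : (BScheme k n r).Opens) (z : (canonicalAlg k n r).sec V) :
    ∃ b, IsMatch φ.left A a V z b := by
  let φ₀ : X.left ⟶ BScheme k n r := φ.left
  let I := {V' : (BScheme k n r).Opens // V' ≤ V ∧ IsAffineOpen V'}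
  choose c hc using fun i : I ↦ exists_isMatch_of_isAffineOpen (φ := φ₀) (A := A) (a := a) i.2.2
    ((canonicalAlg k n r).res i.2.1 z)
  obtain ⟨b, hb, -⟩ := A.sheaf.existsUnique_gluing' (fun i : I ↦ φ₀ ⁻¹ᵁ i.1) (φ₀ ⁻¹ᵁ V)
    (fun i ↦ homOfLE (φ₀.preimage_mono i.2.1)) (fun x hx ↦ by
      obtain ⟨V', hV', hxV', hV⟩ := exists_isAffineOpen_mem (y := φ₀ x) hx
      exact Opens.mem_iSup.2 ⟨⟨V', hV, hV'⟩, hxV'⟩) c (fun i j ↦ by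
      have h1 := (hc i).res (inf_le_left : i.1 ⊓ j.1 ≤ i.1)
      have h2 := (hc j).res (inf_le_right : i.1 ⊓ j.1 ≤ j.1)
      rw [res_res] at h1 h2
      exact h1.eq hA ha hφ h2)
  refine ⟨b, isMatch_of_forall_isAffineOpen fun V' hV hV' ↦ ?_⟩
  have h1 : A.res (φ₀.preimage_mono hV) b = c ⟨V', hV, hV'⟩ := hb ⟨V', hV, hV'⟩
  exact h1 ▸ hc ⟨V', hV, hV'⟩

/-- The morphism from the canonical algebra to the pushforward of `A` along a morphism computing a
generating tuple of sections of `A`. -/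
noncomputable def matchHom (hA : A.IsEtaleOfDegree n) (ha : A.Generates a)
    (hφ : Computes φ A a) : HomOver (Y := BScheme k n r) φ.left (canonicalAlg k n r) A where
  app V := CommRingCat.ofHom
    { toFun := fun z ↦ (exists_isMatch hA ha hφ V z).choose
      map_one' := (exists_isMatch hA ha hφ V _).choose_spec.eq hA ha hφ isMatch_one
      map_zero' := (exists_isMatch hA ha hφ V _).choose_spec.eq hA ha hφ isMatch_zero
      map_add' := fun z z' ↦ (exists_isMatch hA ha hφ V _).choose_spec.eq hA ha hφ
        ((exists_isMatch hA ha hφ V z).choose_spec.add (exists_isMatch hA ha hφ V z').choose_spec)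
      map_mul' := fun z z' ↦ (exists_isMatch hA ha hφ V _).choose_spec.eq hA ha hφ
        ((exists_isMatch hA ha hφ V z).choose_spec.mul
          (exists_isMatch hA ha hφ V z').choose_spec) }
  naturality {V V'} h := CommRingCat.hom_ext <| RingHom.ext fun z ↦
    (exists_isMatch hA ha hφ V' _).choose_spec.eq hA ha hφ
      ((exists_isMatch hA ha hφ V z).choose_spec.res h)
  linear V := CommRingCat.hom_ext <| RingHom.ext fun c ↦
    (exists_isMatch hA ha hφ V _).choose_spec.eq hA ha hφ (isMatch_algebraMap c)

lemma isMatch_matchHom (hA : A.IsEtaleOfDegree n) (ha : A.Generates a) (hφ : Computes φ A a)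
    (V : (BScheme k n r).Opens) (z : (canonicalAlg k n r).sec V) :
    IsMatch φ.left A a V z ((matchHom hA ha hφ).app V z) :=
  (exists_isMatch hA ha hφ V z).choose_spec

lemma isPushout_of_bijective {S R E C : Type u} [CommRing S] [CommRing R] [CommRing E]
    [CommRing C] [Algebra S R] [Algebra S E] [Algebra R C] (Φ : R ⊗[S] E →ₐ[R] C)
    (hΦ : Function.Bijective Φ) (t : E →+* C) (ht : ∀ z, Φ (1 ⊗ₜ z) = t z) :
    IsPushout (CommRingCat.ofHom (algebraMap S R)) (CommRingCat.ofHom (algebraMap S E))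
      (CommRingCat.ofHom (algebraMap R C)) (CommRingCat.ofHom t) :=
  (CommRingCat.isPushout_tensorProduct S R E).of_iso (Iso.refl _) (Iso.refl _) (Iso.refl _)
    (RingEquiv.ofBijective Φ hΦ).toCommRingCatIso (by simp) (by simp)
    (CommRingCat.hom_ext (RingHom.ext fun c ↦ Φ.commutes c)) (CommRingCat.hom_ext (RingHom.ext ht))

/-- The comparison map is surjective because its image contains the generators `a_j`. For
injectivity, splittings of `A` over trivializing opens inside `W` provide enough test rings for
`injective_of_equivariant`. -/
lemma isPullback_matchHom (hA : A.IsEtaleOfDegree n) (ha : A.Generates a)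
    (hφ : Computes φ A a) : (matchHom hA ha hφ).IsPullback := by
  intro V W h hV hW
  let R := Γ(X.left, W)
  let S := Γ(BScheme k n r, V)
  let T := Γ(U k n r, quotU k n r ⁻¹ᵁ V)
  let α : S ⟶ R := Scheme.Hom.appLE (Y := BScheme k n r) φ.left V W h
  let _ : Algebra S R := α.hom.toAlgebra
  let _ : Algebra S (A.sec W) := ((algebraMap R (A.sec W)).comp (algebraMap S R)).toAlgebra
  have : IsScalarTower S R (A.sec W) := .of_algebraMap_eq' rfl
  let t : (canonicalAlg k n r).sec V →ₐ[S] A.sec W :=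
    { ((matchHom hA ha hφ).app V ≫ A.res h).hom with
      commutes' := fun c ↦ by
        have h1 := ConcreteCategory.congr_hom ((matchHom hA ha hφ).linear V) c
        refine (congrArg (A.res h) h1).trans ((A.res_algebraMap h _).trans ?_)
        refine congrArg (algebraMap R (A.sec W)) ?_
        rfl }
  have ht : ∀ z, t z = A.res h ((matchHom hA ha hφ).app V z) := fun z ↦ rfl
  let Φ : R ⊗[S] (canonicalAlg k n r).sec V →ₐ[R] A.sec W :=
    Algebra.TensorProduct.lift (Algebra.ofId R (A.sec W)) t (fun _ _ ↦ Commute.all _ _)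
  have hΦ : ∀ z, Φ (1 ⊗ₜ z) = t z := fun z ↦ by simp [Φ]
  have hsurj : Function.Surjective Φ := by
    rw [← AlgHom.range_eq_top, eq_top_iff, ← ha W hW, Algebra.adjoin_le_iff]
    rintro _ ⟨j, rfl⟩
    refine ⟨1 ⊗ₜ ((canonicalAlg k n r).res le_top (canonicalSec k n r j)), ?_⟩
    refine (hΦ _).trans ?_
    rw [ht, (isMatch_matchHom hA ha hφ V _).eq hA ha hφ (isMatch_canonicalSec j), res_res]
  have hinj : Function.Injective Φ := by
    refine injective_of_equivariant (S := S) (T := T)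
      (x := fun j i ↦ polySec (quotU k n r ⁻¹ᵁ V) (MvPolynomial.X (j, i)))
      (isEquivariant_polySec V) (fun i i' hi ↦ span_polySec_eq_top
        (isAffineOpen_quotU_preimage hV) hi) (quotU_app_injective V)
      (fun i ↦ { component V i with commutes' := component_algebraMap V i })
      (isEquivariant_component V) (fun z z' ↦ component_ext)
      (fun f hf ↦ exists_component_eq hf) Φ fun c hc ↦ section_ext fun x hx ↦ ?_
    obtain ⟨W', hW', hxW', hle⟩ := hA.exists_isTrivializing (x := x) (O := W) hx
    have := hA.etale W' hW'.isAffineOpen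
    refine ⟨W', hle, hxW', ?_⟩
    obtain ⟨L, _, _, _, s, hs⟩ := exists_sepFamily hW'.basis
    obtain ⟨g, h1, h2⟩ := exists_ringHom_of_sepFamily hφ ha hW' (hle.trans h) L s hs
    refine FaithfulSMul.algebraMap_injective Γ(X.left, W') L ?_
    rw [map_zero, map_zero]
    refine hc L ((algebraMap Γ(X.left, W') L).comp (X.left.presheaf.map (homOfLE hle).op).hom)
      (fun i ↦ (s i : A.sec W' →+* L).comp (A.res hle).hom) g (fun i d ↦ ?_) (fun d ↦ ?_)
      fun i z ↦ ?_
    · refine (congrArg (s i) (A.res_algebraMap hle d)).trans ((s i).commutes _)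
    · refine (h1 d).trans (congrArg (algebraMap Γ(X.left, W') L) ?_)
      exact (appLE_map_apply (Y := BScheme k n r) φ.left h hle d).symm
    · have h3 := isMatch_matchHom hA ha hφ V z V le_rfl W' (hle.trans h) hV hW' L s hs g h1 h2 i
      refine Eq.trans (congrArg (s i) ?_) (h3.trans (congrArg g (congrArg (component V i) ?_)))
      · refine (congrArg (A.res hle) ((hΦ z).trans (ht z))).trans ?_
        exact A.res_res _ _ _
      · exact ConcreteCategory.congr_hom ((canonicalAlg k n r).sheaf.obj.map_id (op V)) z
  exact isPushout_of_bijective Φ ⟨hinj, hsurj⟩ ((matchHom hA ha hφ).app V ≫ A.res h).hom hΦ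

lemma Computes.classifies (hA : A.IsEtaleOfDegree n) (ha : A.Generates a)
    (hφ : Computes φ A a) : Classifies φ A a := by
  refine ⟨matchHom hA ha hφ, isPullback_matchHom hA ha hφ, fun j ↦ ?_⟩
  have h1 : ∀ (E : AlgSheaf (BScheme k n r)) (z : E.sec ⊤), E.res le_top z = z := fun E z ↦
    ConcreteCategory.congr_hom (E.sheaf.obj.map_id (op ⊤)) z
  have h2 := isMatch_canonicalSec (φ := φ.left) (A := A) (a := a) (V := ⊤) j
  rw [h1] at h2
  refine ((isMatch_matchHom hA ha hφ ⊤ _).eq hA ha hφ h2).trans ?_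
  exact ConcreteCategory.congr_hom (A.sheaf.obj.map_id (op ⊤)) (a j)

end ComputesClassifies

/-! ### Transport of generators and the main theorem -/

section Main

open AlgSheaf

lemma EtaleGen.AlgSheaf.Generates.of_isIsomorphic {X : Scheme.{u}} {A A' : AlgSheaf X}
    {α : A.sheaf ≅ A'.sheaf}
    (hα : A.unit ≫ α.hom = A'.unit) {r : ℕ} {a' : Fin r → A'.sec ⊤} (ha' : A'.Generates a') :
    A.Generates fun j ↦ α.inv.hom.app (op ⊤) (a' j) := by
  have hα' : A'.unit ≫ α.inv = A.unit := by
    rw [← hα, Category.assoc, Iso.hom_inv_id, Category.comp_id]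
  intro W hW
  let f : A'.sec W →ₐ[Γ(X, W)] A.sec W :=
    { (α.inv.hom.app (op W)).hom with
      commutes' := fun c ↦ congrArg (fun f : X.sheaf ⟶ A.sheaf ↦ f.hom.app (op W) c) hα' }
  have hf : f.range = ⊤ := (AlgHom.range_eq_top f).2 fun z ↦ ⟨α.hom.hom.app (op W) z,
    congrArg (fun f : A.sheaf ⟶ A.sheaf ↦ f.hom.app (op W) z) α.hom_inv_id⟩
  have h1 := f.map_adjoin (Set.range fun j ↦ A'.res (le_top : W ≤ ⊤) (a' j))
  rw [ha' W hW, Algebra.map_top, hf, ← Set.range_comp] at h1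
  rw [h1]
  congr 2
  exact funext fun j ↦
    (ConcreteCategory.congr_hom (α.inv.hom.naturality (homOfLE (le_top : W ≤ ⊤)).op) (a' j)).symm

lemma existsUnique_classifies {k : Type u} [CommRing k] {n r : ℕ} {X : Over (Spec (.of k))}
    {A : AlgSheaf X.left} (hA : A.IsEtaleOfDegree n) {a : Fin r → A.sec ⊤} (ha : A.Generates a) :
    ∃! φ : X ⟶ B k n r, Classifies φ A a := by
  obtain ⟨φ, hφ⟩ := exists_computes (X := X) hA ha
  exact ⟨φ, hφ.classifies hA ha, fun ψ hψ ↦ (hψ.computes hA).eq hA hφ⟩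

end Main

theorem proposition4p2 (k : Type u) [CommRing k] (n r r' : ℕ) (hn : 2 ≤ n) (hr : 1 ≤ r)
    (hr' : 1 ≤ r') (X : Over (Spec (.of k))) (A A' : AlgSheaf X.left)
    (hA : A.IsEtaleOfDegree n) (hA' : A'.IsEtaleOfDegree n)
    (a : Fin r → A.sec ⊤) (a' : Fin r' → A'.sec ⊤) (ha : A.Generates a) (ha' : A'.Generates a')
    (hAA' : A.IsIsomorphic A') :
    (∃! φ : X ⟶ B k n r, Classifies φ A a) ∧ (∃! φ' : X ⟶ B k n r', Classifies φ' A' a') ∧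
    ∀ (φ : X ⟶ B k n r) (φ' : X ⟶ B k n r'), Classifies φ A a → Classifies φ' A' a' →
      NaivelyHomotopic (φ ≫ stab k n (Nat.le_add_right r r'))
        (φ' ≫ stab k n (Nat.le_add_left r' r)) ∧
      ∀ (P : ObjectProperty (Over (Spec (.of k)))) (hP : ∀ Y, P Y → P (timesA1 Y))
        (hX : P X) (hB : P (B k n (r + r'))) (C : Type v) [Category.{w} C]
        (E : P.FullSubcategoryᵒᵖ ⥤ C), IsA1Invariant hP E →
        E.map (P.homMk (X := ⟨X, hX⟩) (Y := ⟨B k n (r + r'), hB⟩)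
            (φ ≫ stab k n (Nat.le_add_right r r'))).op =
          E.map (P.homMk (X := ⟨X, hX⟩) (Y := ⟨B k n (r + r'), hB⟩)
            (φ' ≫ stab k n (Nat.le_add_left r' r))).op := by
  refine ⟨existsUnique_classifies hA ha, existsUnique_classifies hA' ha',
    fun φ φ' hφ hφ' ↦ ?_⟩
  obtain ⟨α, hα⟩ := hAA'
  have h : NaivelyHomotopic (φ ≫ stab k n (Nat.le_add_right r r'))
      (φ' ≫ stab k n (Nat.le_add_left r' r)) :=
    -- The second tuple is carried into `A` by `α⁻¹`; the morphism classifying it stays the same, so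
    -- both tuples now live in one algebra.
    naivelyHomotopic_of_computes hr hA ha (ha'.of_isIsomorphic hα)
      ((hφ.computes hA).comp_stab _)
      (((hφ'.computes hA').of_isIsomorphic hA hA' hα).comp_stab _)
  exact ⟨h, fun P hP hX hB C _ E hE ↦ hE.map_eq hX hB h⟩
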